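/- Let $k$ be a field, $X$ a set, and let $A=k\langle X\rangle/I$ be a connected graded algebra for which $X$ is a minimal set of generators, all of degree $1$; that is, $I$ is a two-sided ideal, homogeneous for the length of words, all of whose elements are combinations of words of length $\ge 2$. Let $r>1$ and let $X=X_1\sqcup\dots\sqcup X_r$ be a partition into non-empty parts. Give a word in $X$ the $\mathbb{Z}^r$-degree $\deg^r$ whose $i$-th entry is the number of its letters in $X_i$. Order $\mathbb{Z}^r$ by $\alpha<\beta$ iff $\sum\alpha_i<\sum\beta_i$, or $\sum\alpha_i=\sum\beta_i$ and $\alpha$ is lexicographically smaller than $\beta$. Let $F_\alpha(A)$ be the image in $A$ of the span of all words $w$ with $\deg^r w\le\alpha$, let $F_{<\alpha}(A)=\bigcup_{\alpha'<\alpha}F_{\alpha'}(A)$, and let $G^r(A)=\bigoplus_{\alpha\in\mathbb{Z}^r}F_\alpha(A)/F_{<\alpha}(A)$ be the associated $\mathbb{Z}^r$-graded algebra. An algebra $R$ is strongly noetherian if $R\otimes_k B$ is left and right noetherian for every commutative noetherian $k$-algebra $B$. A ring $R$ is Auslander regular if it is left and right noetherian, has finite global dimension, and for every finitely generated left $R$-module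 $M$, every $i\ge 0$ and every right submodule $N\subseteq\operatorname{Ext}^i_R(M,R)$ one has $\operatorname{Ext}^j_{R^{o}}(N,R)=0$ for all $j<i$, and the same holds with left and right exchanged. A graded algebra is graded Auslander regular if it is left and right noetherian, has finite global dimension, and the last condition holds for finitely generated graded modules $M$ and graded submodules $N$. (1) If $G^r(A)$ is strongly noetherian and graded Auslander regular (for its $\mathbb{Z}^r$-grading), then $A$ is strongly noetherian and Auslander regular, and also graded Auslander regular for its $\mathbb{Z}$-grading. (2) Let $\prec$ be a monomial ordering on the words in $X$ (a well-ordering compatible with multiplication on both sides, with $1$ smallest), and let $\prec_{\mathbb{Z}^r}$ be the ordering which compares $\mathbb{Z}^r$-degrees first and then uses $\prec$. Let $\mathcal{G}$ be the reduced monic Gröbner basis of $I$ with respect to $\prec_{\mathbb{Z}^r}$, and let $LH(\mathcal{G})=\{LH(f)\mid f\in\mathcal{G}\}$, where $LH(f)$ is the sum of the terms of $f$ of largest $\mathbb{Z}^r$-degree. If the $\mathbb{Z}^r$-graded algebra $k\langle X\rangle/(LH(\mathcal{G}))$ is strongly noetherian and graded Auslander regular, then $A$ is strongly noetherian and Auslander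 regular, and also graded Auslander regular for its $\mathbb{Z}$-grading. -/

import Mathlib

open CategoryTheory CategoryTheory.Abelian
open scoped TensorProduct DirectSum

universe u v

noncomputable section

/-! ### Strongly noetherian algebras -/

/-- Left and right noetherian. -/
def IsTwoSidedNoetherian (A : Type v) [Ring A] : Prop :=
  IsNoetherianRing A ∧ IsNoetherianRing Aᵐᵒᵖ

/-- `A ⊗ B` is (left and right) noetherian for every commutative noetherian `k`-algebra `B`. -/
def IsStronglyNoetherian (k : Type u) [Field k] (A : Type v) [Ring A] [Algebra k A] : Prop :=
  ∀ (B : Type u) [CommRing B] [Algebra k B], IsNoetherianRing B →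
    IsTwoSidedNoetherian (A ⊗[k] B)

/-! ### Auslander regular algebras -/

/-- Finite left and right global dimension. -/
def HasFiniteGlobalDimension (A : Type v) [Ring A] : Prop :=
  (∃ d : ℕ, ∀ M : ModuleCat.{v} A, HasProjectiveDimensionLE M d) ∧
  (∃ d : ℕ, ∀ M : ModuleCat.{v} Aᵐᵒᵖ, HasProjectiveDimensionLE M d)

/-- The endomorphism `x ↦ x * a` of the left `A`-module `A`. -/
def rightMulHom (A : Type v) [Ring A] (a : A) : ModuleCat.of A A ⟶ ModuleCat.of A A :=
  ModuleCat.ofHom (LinearMap.toSpanSingleton A A a)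

/-- The group `Ext^i_A(M, A)` for a left `A`-module `M`. -/
abbrev ExtToRing (A : Type v) [Ring A] (M : ModuleCat.{v} A) (i : ℕ) : Type v :=
  Ext.{v} M (ModuleCat.of A A) i

/-- The right `A`-module structure of `Ext^i_A(M, A)`, induced by right multiplication on `A`. -/
instance extRightModule (A : Type v) [Ring A] (M : ModuleCat.{v} A) (i : ℕ) :
    Module Aᵐᵒᵖ (ExtToRing A M i) where
  smul a e := e.comp (Ext.mk₀ (rightMulHom A a.unop)) (add_zero i)
  one_smul e := by
    have h : rightMulHom A 1 = 𝟙 _ := by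
      ext; simp [rightMulHom]
    change e.comp (Ext.mk₀ (rightMulHom A 1)) _ = _
    rw [h, Ext.comp_mk₀_id]
  mul_smul a b e := by
    have h : rightMulHom A (a * b).unop = rightMulHom A b.unop ≫ rightMulHom A a.unop := by
      ext; simp [rightMulHom]
    change e.comp (Ext.mk₀ (rightMulHom A (a * b).unop)) _ =
      (e.comp (Ext.mk₀ (rightMulHom A b.unop)) _).comp (Ext.mk₀ (rightMulHom A a.unop)) _
    rw [h, ← Ext.mk₀_comp_mk₀, Ext.comp_assoc_of_third_deg_zero]
  smul_zero a := Ext.zero_comp _ _ _ _ (add_zero i)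
  smul_add a x y := Ext.add_comp _ _ _ (add_zero i)
  add_smul a b e := by
    have h : rightMulHom A (a + b).unop = rightMulHom A a.unop + rightMulHom A b.unop := by
      ext; simp [rightMulHom]
    change e.comp (Ext.mk₀ (rightMulHom A (a + b).unop)) _ =
      e.comp (Ext.mk₀ (rightMulHom A a.unop)) _ + e.comp (Ext.mk₀ (rightMulHom A b.unop)) _
    rw [h, Ext.mk₀_add, Ext.comp_add]
  zero_smul e := by
    have h : rightMulHom A 0 = 0 := by
      ext; simp [rightMulHom]
    change e.comp (Ext.mk₀ (rightMulHom A 0)) _ = _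
    rw [h, Ext.mk₀_zero, Ext.comp_zero]

/-- `j(N) ≥ i`, where `j(N) = inf {j | Ext^j_R(N, R) ≠ 0}`. -/
def GradeGE (R : Type v) [Ring R] (N : Type v) [AddCommGroup N] [Module R N] (i : ℕ) : Prop :=
  ∀ j < i, Subsingleton (ExtToRing R (ModuleCat.of R N) j)

/-- The Auslander condition on left modules: for every finitely generated left module `M`, every
`i` and every right submodule `N` of `Ext^i_A(M, A)` one has `j(N) ≥ i`. -/
def LeftAuslanderCondition (A : Type v) [Ring A] : Prop :=
  ∀ M : ModuleCat.{v} A, Module.Finite A M → ∀ (i : ℕ) (N : Submodule Aᵐᵒᵖ (ExtToRing A M i)),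
    GradeGE Aᵐᵒᵖ N i

/-- Auslander regular rings: noetherian, of finite global dimension, with the Auslander condition
on left and on right modules (right modules are modules over the opposite ring). -/
def IsAuslanderRegular (A : Type v) [Ring A] : Prop :=
  IsTwoSidedNoetherian A ∧ HasFiniteGlobalDimension A ∧
    LeftAuslanderCondition A ∧ LeftAuslanderCondition Aᵐᵒᵖ

section Graded

variable {k : Type u} [Field k] {A : Type v} [Ring A] [Algebra k A]
  {Γ : Type*} [AddCommGroup Γ] [DecidableEq Γ]

/-- `M = ⨁ ℳ_γ` is a graded left module over the graded algebra `A = ⨁ 𝒜_γ`. -/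
structure IsModuleGrading (𝒜 : Γ → Submodule k A) {M : Type v} [AddCommGroup M] [Module A M]
    (ℳ : Γ → AddSubgroup M) : Prop where
  isInternal : DirectSum.IsInternal ℳ
  smul_mem : ∀ ⦃α β : Γ⦄ ⦃a : A⦄ ⦃m : M⦄, a ∈ 𝒜 α → m ∈ ℳ β → a • m ∈ ℳ (α + β)

/-- The classes of degree `α` in `Ext^n_A(M, A)` for a graded module `M`, i.e. the image of
`Ext^n(M, A(α))`, taken in the category of graded modules. For `n = 0` they are the homomorphisms
of degree `α`; in general they are the images of the classes of degree `α` under the connecting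
maps `Ext^n_A(K, A) → Ext^(n+1)_A(M, A)` of short exact sequences `0 → K → F → M → 0` of graded
modules. -/
def IsHomogeneousExt (𝒜 : Γ → Submodule k A) (α : Γ) : (n : ℕ) → (M : ModuleCat.{v} A) →
    (Γ → AddSubgroup M) → ExtToRing A M n → Prop
  | 0, M, ℳ, x => ∃ f : M ⟶ ModuleCat.of A A,
      (∀ β, ∀ m ∈ ℳ β, f.hom m ∈ 𝒜 (β + α)) ∧ x = Ext.mk₀ f
  | n + 1, M, ℳ, x => ∃ (K F : ModuleCat.{v} A) (𝒦 : Γ → AddSubgroup K) (ℱ : Γ → AddSubgroup F)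
      (f : K ⟶ F) (g : F ⟶ M) (w : f ≫ g = 0) (hS : (ShortComplex.mk f g w).ShortExact)
      (y : ExtToRing A K n),
      IsModuleGrading 𝒜 𝒦 ∧ IsModuleGrading 𝒜 ℱ ∧
      (∀ β, ∀ m ∈ 𝒦 β, f.hom m ∈ ℱ β) ∧ (∀ β, ∀ m ∈ ℱ β, g.hom m ∈ ℳ β) ∧
      IsHomogeneousExt 𝒜 α n K 𝒦 y ∧
      x = hS.extClass.comp y (Nat.add_comm 1 n)

/-- `N` is a graded right submodule of `Ext^i_A(M, A)`: it is generated by homogeneous classes. -/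
def IsGradedExtSubmodule (𝒜 : Γ → Submodule k A) (M : ModuleCat.{v} A) (ℳ : Γ → AddSubgroup M)
    (i : ℕ) (N : Submodule Aᵐᵒᵖ (ExtToRing A M i)) : Prop :=
  N = Submodule.span Aᵐᵒᵖ {x | x ∈ N ∧ ∃ α, IsHomogeneousExt 𝒜 α i M ℳ x}

/-- The Auslander condition for finitely generated graded left modules `M` and graded right
submodules `N` of `Ext^i_A(M, A)`. It is only used over noetherian `A`, where the Ext groups of
finitely generated graded modules with values in `A` are those of the graded category. -/
def GradedLeftAuslanderCondition (𝒜 : Γ → Submodule k A) : Prop :=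
  ∀ (M : ModuleCat.{v} A) (ℳ : Γ → AddSubgroup M), Module.Finite A M → IsModuleGrading 𝒜 ℳ →
    ∀ (i : ℕ) (N : Submodule Aᵐᵒᵖ (ExtToRing A M i)), IsGradedExtSubmodule 𝒜 M ℳ i N →
      GradeGE Aᵐᵒᵖ N i

/-- The grading of the opposite algebra. -/
def oppositeGrading (𝒜 : Γ → Submodule k A) (α : Γ) : Submodule k Aᵐᵒᵖ :=
  (𝒜 α).map (MulOpposite.opLinearEquiv k).toLinearMap

/-- Auslander regularity of a graded algebra, tested on graded modules. -/
def IsGradedAuslanderRegular (𝒜 : Γ → Submodule k A) : Prop :=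
  IsTwoSidedNoetherian A ∧ HasFiniteGlobalDimension A ∧
    GradedLeftAuslanderCondition 𝒜 ∧ GradedLeftAuslanderCondition (oppositeGrading 𝒜)

end Graded

/-! ### The admissible ordering on `ℤ^r` -/

/-- The ordering of `ℤ^r`: compare the sums of the entries first, then lexicographically. -/
def DegLT {r : ℕ} (α β : Fin r → ℤ) : Prop :=
  ∑ i, α i < ∑ i, β i ∨
    (∑ i, α i = ∑ i, β i ∧ ∃ t, (∀ i < t, α i = β i) ∧ α t < β t)

def DegLE {r : ℕ} (α β : Fin r → ℤ) : Prop := DegLT α β ∨ α = β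

theorem DegLT.add_right {r : ℕ} {α β : Fin r → ℤ} (h : DegLT α β) (γ : Fin r → ℤ) :
    DegLT (α + γ) (β + γ) := by
  rcases h with h | ⟨h, t, h1, h2⟩
  · left; simpa [Finset.sum_add_distrib] using h
  · refine Or.inr ⟨by simpa [Finset.sum_add_distrib] using h, t, ?_, by simpa using h2⟩
    intro i hi; simpa using h1 i hi

theorem DegLT.add_left {r : ℕ} {α β : Fin r → ℤ} (h : DegLT α β) (γ : Fin r → ℤ) :
    DegLT (γ + α) (γ + β) := by
  rw [add_comm γ, add_comm γ]; exact h.add_right γ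

theorem DegLT.trans {r : ℕ} {α β γ : Fin r → ℤ} (h : DegLT α β) (h' : DegLT β γ) :
    DegLT α γ := by
  rcases h with h | ⟨h, t, h1, h2⟩ <;> rcases h' with h' | ⟨h', t', h1', h2'⟩
  · exact Or.inl (h.trans h')
  · exact Or.inl (h'  ▸ h)
  · exact Or.inl (h ▸ h')
  · refine Or.inr ⟨h.trans h', min t t', fun i hi => ?_, ?_⟩
    · rw [h1 i (lt_of_lt_of_le hi (min_le_left _ _)), h1' i (lt_of_lt_of_le hi (min_le_right _ _))]
    · rcases lt_trichotomy t t' with ht | ht | ht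
      · rw [min_eq_left ht.le, ← h1' t ht]; exact h2
      · subst ht; rw [min_self]; exact h2.trans h2'
      · rw [min_eq_right ht.le, h1 t' ht]; exact h2'

theorem DegLE.trans {r : ℕ} {α β γ : Fin r → ℤ} (h : DegLE α β) (h' : DegLE β γ) :
    DegLE α γ := by
  rcases h with h | rfl
  · rcases h' with h' | rfl
    · exact Or.inl (h.trans h')
    · exact Or.inl h
  · exact h'

theorem DegLE.add {r : ℕ} {α β γ δ : Fin r → ℤ} (h : DegLE α β) (h' : DegLE γ δ) :
    DegLE (α + γ) (β + δ) := by
  have h1 : DegLE (α + γ) (β + γ) := h.imp (fun h => h.add_right γ) (fun h => by rw [h])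
  have h2 : DegLE (β + γ) (β + δ) := h'.imp (fun h => h.add_left β) (fun h => by rw [h])
  exact h1.trans h2

theorem DegLE.total {r : ℕ} (α β : Fin r → ℤ) : DegLE α β ∨ DegLE β α := by
  rcases lt_trichotomy (∑ i, α i) (∑ i, β i) with h | h | h
  · exact Or.inl (Or.inl (Or.inl h))
  · rcases lt_trichotomy (toLex α) (toLex β) with hl | hl | hl
    · obtain ⟨t, h1, h2⟩ := hl
      exact Or.inl (Or.inl (Or.inr ⟨h, t, h1, h2⟩))
    · exact Or.inl (Or.inr (toLex.injective hl))
    · obtain ⟨t, h1, h2⟩ := hl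
      exact Or.inr (Or.inl (Or.inr ⟨h.symm, t, h1, h2⟩))
  · exact Or.inr (Or.inl (Or.inl h))

/-! ### `ℤ^r`-filtered algebras and their associated graded algebras -/

/-- A `ℤ^r`-filtration of the `k`-algebra `A`. -/
structure ZrFiltration (k : Type u) [Field k] (A : Type v) [Ring A] [Algebra k A] (r : ℕ) where
  F : (Fin r → ℤ) → Submodule k A
  mono : ∀ ⦃α β⦄, DegLT α β → F α ≤ F β
  mul_mem : ∀ ⦃α β⦄ ⦃a b : A⦄, a ∈ F α → b ∈ F β → a * b ∈ F (α + β)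
  exhaustive : ∀ a : A, ∃ α, a ∈ F α
  one_mem : (1 : A) ∈ F 0

namespace ZrFiltration

variable {k : Type u} [Field k] {A : Type v} [Ring A] [Algebra k A] {r : ℕ}
  (𝓕 : ZrFiltration k A r)

/-- `F_{<α}`, the union of the chain of all `F_{α'}` with `α' < α`. -/
def Flt (α : Fin r → ℤ) : Submodule k A := ⨆ (α' : Fin r → ℤ) (_ : DegLT α' α), 𝓕.F α'

/-- The component `F_α / F_{<α}` of the associated graded algebra. -/
def Piece (α : Fin r → ℤ) : Type v := 𝓕.F α ⧸ (𝓕.Flt α).submoduleOf (𝓕.F α)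

instance (α : Fin r → ℤ) : AddCommGroup (𝓕.Piece α) :=
  inferInstanceAs (AddCommGroup (𝓕.F α ⧸ (𝓕.Flt α).submoduleOf (𝓕.F α)))

instance (α : Fin r → ℤ) : Module k (𝓕.Piece α) :=
  inferInstanceAs (Module k (𝓕.F α ⧸ (𝓕.Flt α).submoduleOf (𝓕.F α)))

theorem mul_mem_Flt_right {α β : Fin r → ℤ} {a b : A} (ha : a ∈ 𝓕.F α) (hb : b ∈ 𝓕.Flt β) :
    a * b ∈ 𝓕.Flt (α + β) := by
  have : 𝓕.Flt β ≤ (𝓕.Flt (α + β)).comap (LinearMap.mulLeft k a) := by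
    refine iSup₂_le fun β' h x hx => ?_
    exact Submodule.mem_iSup_of_mem (α + β')
      (Submodule.mem_iSup_of_mem (h.add_left α) (𝓕.mul_mem ha hx))
  exact this hb

theorem mul_mem_Flt_left {α β : Fin r → ℤ} {a b : A} (ha : a ∈ 𝓕.Flt α) (hb : b ∈ 𝓕.F β) :
    a * b ∈ 𝓕.Flt (α + β) := by
  have : 𝓕.Flt α ≤ (𝓕.Flt (α + β)).comap (LinearMap.mulRight k b) := by
    refine iSup₂_le fun α' h x hx => ?_
    exact Submodule.mem_iSup_of_mem (α' + β)
      (Submodule.mem_iSup_of_mem (h.add_right β) (𝓕.mul_mem hx hb))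
  exact this ha

/-- The class of `a ∈ F_α` in `F_α / F_{<α}`. -/
def cls (α : Fin r → ℤ) (a : A) (ha : a ∈ 𝓕.F α) : 𝓕.Piece α :=
  Submodule.Quotient.mk ⟨a, ha⟩

theorem cls_surj {α : Fin r → ℤ} (x : 𝓕.Piece α) : ∃ a ha, x = 𝓕.cls α a ha := by
  obtain ⟨⟨a, ha⟩, rfl⟩ := Submodule.Quotient.mk_surjective _ x
  exact ⟨a, ha, rfl⟩

/-- Multiplication `F_α / F_{<α} × F_β / F_{<β} → F_{α+β} / F_{<α+β}`. -/
def pieceMul {α β : Fin r → ℤ} (x : 𝓕.Piece α) (y : 𝓕.Piece β) : 𝓕.Piece (α + β) :=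
  Quotient.map₂ (fun a b => (⟨a.1 * b.1, 𝓕.mul_mem a.2 b.2⟩ : 𝓕.F (α + β)))
    (by
      intro a a' h b b' h'
      rw [← Quotient.eq_iff_equiv] at h h'
      have h1 := (Submodule.Quotient.eq _).1 h
      have h2 := (Submodule.Quotient.eq _).1 h'
      rw [← Quotient.eq_iff_equiv]
      refine (Submodule.Quotient.eq _).2 ?_
      change a.1 * b.1 - a'.1 * b'.1 ∈ 𝓕.Flt (α + β)
      have : a.1 * b.1 - a'.1 * b'.1 = (a.1 - a'.1) * b.1 + a'.1 * (b.1 - b'.1) := by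
        noncomm_ring
      rw [this]
      exact add_mem (𝓕.mul_mem_Flt_left h1 b.2) (𝓕.mul_mem_Flt_right a'.2 h2)) x y

theorem cls_eq_cls {α β : Fin r → ℤ} (h : α = β) {a b : A} (h' : a = b) (ha : a ∈ 𝓕.F α)
    (hb : b ∈ 𝓕.F β) :
    GradedMonoid.mk (A := 𝓕.Piece) α (𝓕.cls α a ha) = GradedMonoid.mk β (𝓕.cls β b hb) := by
  subst h h'; rfl

instance : GradedMonoid.GOne 𝓕.Piece where
  one := 𝓕.cls 0 1 𝓕.one_mem

instance : GradedMonoid.GMul 𝓕.Piece where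
  mul x y := 𝓕.pieceMul x y

instance : DirectSum.GRing 𝓕.Piece where
  mul x y := 𝓕.pieceMul x y
  mul_zero {α β} a := by
    obtain ⟨a, ha, rfl⟩ := 𝓕.cls_surj a
    change 𝓕.cls _ (a * 0) _ = 𝓕.cls _ 0 (zero_mem _)
    congr 1; simp
  zero_mul {α β} a := by
    obtain ⟨a, ha, rfl⟩ := 𝓕.cls_surj a
    change 𝓕.cls _ (0 * a) _ = 𝓕.cls _ 0 (zero_mem _)
    congr 1; simp
  mul_add {α β} a b c := by
    obtain ⟨a, ha, rfl⟩ := 𝓕.cls_surj a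
    obtain ⟨b, hb, rfl⟩ := 𝓕.cls_surj b
    obtain ⟨c, hc, rfl⟩ := 𝓕.cls_surj c
    change 𝓕.cls _ (a * (b + c)) _ =
      𝓕.cls _ (a * b + a * c) (add_mem (𝓕.mul_mem ha hb) (𝓕.mul_mem ha hc))
    congr 1; exact mul_add _ _ _
  add_mul {α β} a b c := by
    obtain ⟨a, ha, rfl⟩ := 𝓕.cls_surj a
    obtain ⟨b, hb, rfl⟩ := 𝓕.cls_surj b
    obtain ⟨c, hc, rfl⟩ := 𝓕.cls_surj c
    change 𝓕.cls _ ((a + b) * c) _ =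
      𝓕.cls _ (a * c + b * c) (add_mem (𝓕.mul_mem ha hc) (𝓕.mul_mem hb hc))
    congr 1; exact add_mul _ _ _
  one_mul := by
    rintro ⟨α, a⟩
    obtain ⟨a, ha, rfl⟩ := 𝓕.cls_surj a
    exact 𝓕.cls_eq_cls (zero_add α) (one_mul a) _ _
  mul_one := by
    rintro ⟨α, a⟩
    obtain ⟨a, ha, rfl⟩ := 𝓕.cls_surj a
    exact 𝓕.cls_eq_cls (add_zero α) (mul_one a) _ _
  mul_assoc := by
    rintro ⟨α, a⟩ ⟨β, b⟩ ⟨γ, c⟩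
    obtain ⟨a, ha, rfl⟩ := 𝓕.cls_surj a
    obtain ⟨b, hb, rfl⟩ := 𝓕.cls_surj b
    obtain ⟨c, hc, rfl⟩ := 𝓕.cls_surj c
    exact 𝓕.cls_eq_cls (add_assoc α β γ) (mul_assoc a b c) _ _
  natCast n := n • 𝓕.cls 0 1 𝓕.one_mem
  natCast_zero := zero_smul ℕ _
  natCast_succ n := succ_nsmul _ n
  intCast n := n • 𝓕.cls 0 1 𝓕.one_mem
  intCast_ofNat n := natCast_zsmul _ n
  intCast_negSucc_ofNat n := negSucc_zsmul _ n

theorem algebraMap_mem (c : k) : algebraMap k A c ∈ 𝓕.F 0 := by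
  rw [Algebra.algebraMap_eq_smul_one]; exact Submodule.smul_mem _ _ 𝓕.one_mem

instance : DirectSum.GAlgebra k 𝓕.Piece where
  toFun := AddMonoidHom.mk' (fun c => 𝓕.cls 0 (algebraMap k A c) (𝓕.algebraMap_mem c))
    (fun c d => by
      change _ = 𝓕.cls 0 (algebraMap k A c + algebraMap k A d)
        (add_mem (𝓕.algebraMap_mem c) (𝓕.algebraMap_mem d))
      congr 1; exact map_add _ _ _)
  map_one := by
    change 𝓕.cls _ _ _ = 𝓕.cls _ _ _
    congr 1; exact map_one _
  map_mul c d := 𝓕.cls_eq_cls (add_zero 0).symm (map_mul _ c d) _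
    (𝓕.mul_mem (𝓕.algebraMap_mem c) (𝓕.algebraMap_mem d))
  commutes c := by
    rintro ⟨α, a⟩
    obtain ⟨a, ha, rfl⟩ := 𝓕.cls_surj a
    exact 𝓕.cls_eq_cls (add_comm 0 α) (Algebra.commutes c a) (𝓕.mul_mem (𝓕.algebraMap_mem c) ha)
      (𝓕.mul_mem ha (𝓕.algebraMap_mem c))
  smul_def c := by
    rintro ⟨α, a⟩
    obtain ⟨a, ha, rfl⟩ := 𝓕.cls_surj a
    exact 𝓕.cls_eq_cls (zero_add α).symm (Algebra.smul_def c a) (Submodule.smul_mem _ c ha)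
      (𝓕.mul_mem (𝓕.algebraMap_mem c) ha)

/-- The associated `ℤ^r`-graded algebra `G^r(A) = ⨁_α F_α / F_{<α}`. -/
abbrev Gr : Type v := ⨁ α, 𝓕.Piece α

/-- The homogeneous component of degree `α` of `G^r(A)`. -/
def grGrading (α : Fin r → ℤ) : Submodule k 𝓕.Gr :=
  LinearMap.range (DirectSum.lof k (Fin r → ℤ) 𝓕.Piece α)

end ZrFiltration

/-! ### Connected graded algebras `k⟨X⟩ / I` and the filtration of a partition of `X` -/

/-- The free algebra `k⟨X⟩`, with the set `X^*` of words as a basis. -/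
abbrev FreeAlg (k : Type u) [Field k] (X : Type v) : Type (max u v) :=
  MonoidAlgebra k (FreeMonoid X)

section Presentation

variable {k : Type u} [Field k] {X : Type v}

/-- `A = k⟨X⟩ / I` is a connected graded algebra for which `X` is a minimal set of
generators, all of degree one: `I` is homogeneous and is spanned by elements of degree `≥ 2`. -/
structure IsConnectedGradedIdeal (I : TwoSidedIdeal (FreeAlg k X)) : Prop where
  homogeneous : ∀ f ∈ I, ∀ n : ℕ,
    MonoidAlgebra.ofCoeff (f.coeff.filter fun w => w.length = n) ∈ I
  two_le : ∀ f ∈ I, ∀ w ∈ f.coeff.support, 2 ≤ w.length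

/-- The quotient algebra `k⟨X⟩ / I`. -/
abbrev QuotAlg (I : TwoSidedIdeal (FreeAlg k X)) : Type (max u v) := I.ringCon.Quotient

/-- The projection `k⟨X⟩ → k⟨X⟩ / I`. -/
def proj (I : TwoSidedIdeal (FreeAlg k X)) : FreeAlg k X →ₐ[k] QuotAlg I := I.ringCon.mkₐ k

/-- The span of all words that satisfy `P`. -/
def wordSpan (k : Type u) [Field k] {X : Type v} (P : FreeMonoid X → Prop) :
    Submodule k (FreeAlg k X) :=
  Submodule.span k {f | ∃ w, P w ∧ f = MonoidAlgebra.of k (FreeMonoid X) w}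

/-- The `ℤ`-grading by length of words on `k⟨X⟩ / I`. -/
def lengthGrading (I : TwoSidedIdeal (FreeAlg k X)) (n : ℤ) : Submodule k (QuotAlg I) :=
  (wordSpan k fun w => (w.length : ℤ) = n).map (proj I).toLinearMap

variable {r : ℕ} (p : X → Fin r)

/-- The `ℤ^r`-degree of a word: `x ∈ X_i` has degree the `i`-th standard basis vector, where
`X_i` is the set of all `x` with `p x = i`. -/
def multideg (w : FreeMonoid X) : Fin r → ℤ :=
  (w.toList.map fun x => (Pi.single (p x) 1 : Fin r → ℤ)).sum

theorem multideg_mul (w w' : FreeMonoid X) :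
    multideg p (w * w') = multideg p w + multideg p w' := by
  simp [multideg, FreeMonoid.toList_mul]

/-- The `ℤ^r`-grading that the `ℤ^r`-degree of words induces on `k⟨X⟩ / I` (when `I` is
homogeneous for the `ℤ^r`-degree). -/
def multidegGrading (I : TwoSidedIdeal (FreeAlg k X)) (α : Fin r → ℤ) : Submodule k (QuotAlg I) :=
  (wordSpan k fun w => multideg p w = α).map (proj I).toLinearMap

theorem wordSpan_mul_mem {P Q R : FreeMonoid X → Prop} (h : ∀ w w', P w → Q w' → R (w * w'))
    {f g : FreeAlg k X} (hf : f ∈ wordSpan k P) (hg : g ∈ wordSpan k Q) :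
    f * g ∈ wordSpan k R := by
  have := Submodule.mul_mem_mul hf hg
  rw [wordSpan, wordSpan, Submodule.span_mul_span] at this
  refine Submodule.span_mono ?_ this
  rintro _ ⟨_, ⟨w, hw, rfl⟩, _, ⟨w', hw', rfl⟩, rfl⟩
  exact ⟨w * w', h w w' hw hw', (map_mul _ w w').symm⟩

/-- The `ℤ^r`-filtration on `A = k⟨X⟩ / I` induced by the partition `p` of `X`: `F_α(A)` is the
image of the span of all words of `ℤ^r`-degree `≤ α` (there are none if `α < 0`). -/
def partitionFiltration (I : TwoSidedIdeal (FreeAlg k X)) : ZrFiltration k (QuotAlg I) r where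
  F α := (wordSpan k fun w => DegLE (multideg p w) α).map (proj I).toLinearMap
  mono α β h := by
    refine Submodule.map_mono (Submodule.span_mono ?_)
    rintro _ ⟨w, hw, rfl⟩
    exact ⟨w, hw.trans (Or.inl h), rfl⟩
  mul_mem α β a b := by
    rintro ⟨f, hf, rfl⟩ ⟨g, hg, rfl⟩
    refine ⟨f * g, wordSpan_mul_mem (fun w w' hw hw' => ?_) hf hg, map_mul (proj I) f g⟩
    rw [multideg_mul]; exact hw.add hw'
  exhaustive a := by
    obtain ⟨f, rfl⟩ := (RingCon.mkₐ_surjective I.ringCon : Function.Surjective (proj I)) a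
    suffices h : ∃ α, f ∈ wordSpan k fun w => DegLE (multideg p w) α by
      obtain ⟨α, h⟩ := h
      exact ⟨α, f, h, rfl⟩
    induction f using MonoidAlgebra.induction_on with
    | of w => exact ⟨multideg p w, Submodule.subset_span ⟨w, Or.inr rfl, rfl⟩⟩
    | add f g hf hg =>
      obtain ⟨α, hα⟩ := hf
      obtain ⟨β, hβ⟩ := hg
      have mono : ∀ {α β : Fin r → ℤ}, DegLE α β →
          (wordSpan k fun w => DegLE (multideg p w) α) ≤
            wordSpan k fun w => DegLE (multideg p w) β := by
        intro α β h
        refine Submodule.span_mono ?_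
        rintro _ ⟨w, hw, rfl⟩
        exact ⟨w, hw.trans h, rfl⟩
      rcases DegLE.total α β with h | h
      · exact ⟨β, add_mem (mono h hα) hβ⟩
      · exact ⟨α, add_mem hα (mono h hβ)⟩
    | smul c f hf =>
      obtain ⟨α, hα⟩ := hf
      exact ⟨α, Submodule.smul_mem _ c hα⟩
  one_mem := ⟨1, Submodule.subset_span ⟨1, Or.inr (by simp [multideg]), (map_one _).symm⟩,
    map_one (proj I)⟩

/-! ### Gröbner bases -/

/-- A monomial ordering on `X^*`: a well-ordering, compatible with multiplication on both sides,
for which `1` is the smallest word. -/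
structure IsMonomialOrder (lt : FreeMonoid X → FreeMonoid X → Prop) : Prop where
  wellOrder : IsWellOrder (FreeMonoid X) lt
  mul_mul : ∀ u v s t, lt u v → lt (s * u * t) (s * v * t)
  one_lt : ∀ u, u ≠ 1 → lt 1 u

/-- The ordering on words which compares the `ℤ^r`-degrees first and then uses `lt`. -/
def RefinedLT (lt : FreeMonoid X → FreeMonoid X → Prop) (u v : FreeMonoid X) : Prop :=
  DegLT (multideg p u) (multideg p v) ∨ (multideg p u = multideg p v ∧ lt u v)

/-- `w` is the leading monomial of the (nonzero) polynomial `f`. -/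
def IsLeadingMonomial (lt : FreeMonoid X → FreeMonoid X → Prop) (f : FreeAlg k X)
    (w : FreeMonoid X) : Prop :=
  w ∈ f.coeff.support ∧ ∀ u ∈ f.coeff.support, u ≠ w → lt u w

/-- `u` is a factor of the word `w`. -/
def IsFactor (u w : FreeMonoid X) : Prop := ∃ s t, w = s * u * t

/-- `𝒢` is the reduced (monic) Gröbner basis of `I` for the ordering `lt`. -/
structure IsReducedGroebnerBasis (lt : FreeMonoid X → FreeMonoid X → Prop)
    (I : TwoSidedIdeal (FreeAlg k X)) (𝒢 : Set (FreeAlg k X)) : Prop where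
  subset : ∀ g ∈ 𝒢, g ∈ I
  groebner : ∀ f ∈ I, ∀ w, IsLeadingMonomial lt f w →
    ∃ g ∈ 𝒢, ∃ u, IsLeadingMonomial lt g u ∧ IsFactor u w
  monic : ∀ g ∈ 𝒢, ∃ w, IsLeadingMonomial lt g w ∧ g.coeff w = 1
  reduced : ∀ g ∈ 𝒢, ∀ g' ∈ 𝒢, g' ≠ g → ∀ u, IsLeadingMonomial lt g' u →
    ∀ w ∈ g.coeff.support, ¬ IsFactor u w

open Classical in
/-- The leading homogeneous polynomial `LH(f)`: the sum of the terms of `f` whose `ℤ^r`-degree is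
the largest one that occurs. -/
def leadingForm (f : FreeAlg k X) : FreeAlg k X :=
  MonoidAlgebra.ofCoeff (f.coeff.filter fun w =>
    ∀ u ∈ f.coeff.support, DegLE (multideg p u) (multideg p w))

/-- The two-sided ideal `(LH(𝒢))`. -/
def leadingFormIdeal (𝒢 : Set (FreeAlg k X)) : TwoSidedIdeal (FreeAlg k X) :=
  TwoSidedIdeal.span (leadingForm p '' 𝒢)

end Presentation

end

set_option linter.unusedSectionVars false

/-! ### Symbol relations: filtered modules together with their associated graded modules -/

/-! Both parts are instances of one transfer principle, from an associated graded ring `S` to a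
filtered ring `A`. A filtration is recorded together with its graded object by relations: `(m, q) ∈
R α` says that `m` lies in the step `α` and has symbol `q` there. The graded object may be larger
than the group of symbols, which is what duals require; `IsFull` says that symbols span it. Degrees
of nonzero symbols form a well-founded set, and this takes the place of completeness: subtracting
something with the same symbol lowers the degree, so successive approximation stops.

Chain conditions pass to `A` because `K ↦ gr K` is strictly increasing (`le_of_gr_le`). Since `A ⊗
B` is filtered with graded ring `S ⊗ B` (`tensor`), the strong form passes as well.

For homological properties, cover a filtered module `M` by a filtered free module whose generators
lift homogeneous generators of the graded module `Q`. Such a cover is strict (`gr_ker`), so the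
graded module of the syzygy of `M` is the syzygy of `Q`, and dimension shifting runs in parallel
over `A` and over `S`. If `Q` is projective, the degree-preserving part of a retraction onto its
syzygy lifts to `A` and splits the cover of `M` (`projective`); hence the projective dimension of
`M` is at most that of `Q`.

For Ext, `Hom_A(K, A)` is filtered with symbols in `Hom_S(gr K, S)` (`dual`), and every homomorphism
on a finite graded free module is a sum of symbols. Therefore `Ext^j_S(Q, S) = 0` forces `Ext^j_A(M,
A) = 0` (`subsingleton_ext`), and `Ext^(i+1)_A(M, A)` has a filtration whose graded module is a
subquotient of `Ext^(i+1)_S(Q, S)` (`exists_ext_presentation`); no spectral sequence is needed. A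
submodule `N` of the former thus has a graded module `W / V`, with `V ≤ W` graded submodules of the
latter. The graded Auslander condition bounds the grades of `V` and `W`, the long exact sequence
that of `W / V`, and vanishing of Ext lifts the bound to `N` (`leftAuslanderCondition`).

Well-foundedness comes from Dickson's lemma: multidegrees of words have non-negative entries. In
part (2) division by the Gröbner basis shows that `(LH(𝒢))` consists exactly of sums of top
components of elements of `I`, so `k⟨X⟩ / (LH(𝒢))` serves directly as `S`. Graded Auslander
regularity of `A` is a special case of the ungraded condition. -/

/-- A filtered abelian group `M` together with a realization `Q` of its associated graded group:
`(m, q) ∈ R α` means that `m ∈ F_α M` and that `q` is the class of `m` in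
`F_α M / F_{<α} M ⊆ Q`. -/
structure SymbolRel (Γ : Type) [LinearOrder Γ] (M Q : Type v) [AddCommGroup M]
    [AddCommGroup Q] where
  R : Γ → AddSubgroup (M × Q)
  zero_left : ∀ {α q}, ((0 : M), q) ∈ R α → q = 0
  mono : ∀ {α β m q}, α < β → (m, q) ∈ R α → (m, (0 : Q)) ∈ R β
  leading : ∀ {m}, m ≠ 0 → ∃ α q, q ≠ 0 ∧ (m, q) ∈ R α
  wf : {α | ∃ m q, q ≠ 0 ∧ (m, q) ∈ R α}.IsWF
  indep : ∀ f : Γ →₀ Q, (∀ α, ∃ m, (m, f α) ∈ R α) → (f.sum fun _ q => q) = 0 → f = 0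

/-- A filtered ring `A` together with a realization `S` of its associated graded ring. -/
structure SymbolRing (Γ : Type) [AddCommGroup Γ] [LinearOrder Γ] (A S : Type v) [Ring A]
    [Ring S] extends SymbolRel Γ A S where
  one_mem : ((1 : A), (1 : S)) ∈ R 0
  mul_mem : ∀ {α β a b s t}, (a, s) ∈ R α → (b, t) ∈ R β → (a * b, s * t) ∈ R (α + β)
  span : AddSubgroup.closure {s | ∃ α a, (a, s) ∈ R α} = ⊤

/-- A filtered module over a filtered ring, together with a graded module that contains its
associated graded module. -/
structure SymbolModule {Γ : Type} [AddCommGroup Γ] [LinearOrder Γ] {A S : Type v} [Ring A]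
    [Ring S] (ρ : SymbolRing Γ A S) (M Q : Type v) [AddCommGroup M] [AddCommGroup Q]
    [Module A M] [Module S Q] extends SymbolRel Γ M Q where
  smul_mem : ∀ {α β a s m q}, (a, s) ∈ ρ.R α → (m, q) ∈ R β → (a • m, s • q) ∈ R (α + β)

namespace SymbolRel

variable {Γ : Type} [LinearOrder Γ] {M Q : Type v} [AddCommGroup M] [AddCommGroup Q]
  (P : SymbolRel Γ M Q)

theorem eq_of_mem {α : Γ} {m : M} {q q' : Q} (h : (m, q) ∈ P.R α) (h' : (m, q') ∈ P.R α) :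
    q = q' := by
  have := sub_mem h h'
  rw [Prod.mk_sub_mk, sub_self] at this
  exact sub_eq_zero.1 (P.zero_left this)

/-- A nonzero symbol pins down the degree: above it the symbol vanishes by `mono`, and membership in
a step below it would make the symbol itself vanish. -/
theorem mem_compare {α γ : Γ} {m : M} {q y : Q} (hq : q ≠ 0) (h : (m, q) ∈ P.R γ)
    (h' : (m, y) ∈ P.R α) : (α = γ ∧ y = q) ∨ (γ < α ∧ y = 0) := by
  rcases lt_trichotomy α γ with hl | rfl | hl
  · exact absurd (P.eq_of_mem h (P.mono hl h')) hq
  · exact Or.inl ⟨rfl, P.eq_of_mem h' h⟩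
  · exact Or.inr ⟨hl, P.eq_of_mem h' (P.mono hl h)⟩

/-- Induction on the filtration degree. -/
theorem induction {p : M → Prop} (h0 : p 0)
    (h : ∀ α m q, q ≠ 0 → (m, q) ∈ P.R α → (∀ m', (m', (0 : Q)) ∈ P.R α → p m') → p m) (m : M) :
    p m := by
  by_cases hm : m = 0
  · exact hm ▸ h0
  obtain ⟨α, q, hq, hα⟩ := P.leading hm
  have key : ∀ α ∈ {α | ∃ m q, q ≠ 0 ∧ (m, q) ∈ P.R α}, ∀ m q, q ≠ 0 → (m, q) ∈ P.R α → p m := by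
    intro α hα
    refine Set.WellFoundedOn.induction (P := fun α => ∀ m q, q ≠ 0 → (m, q) ∈ P.R α → p m) P.wf hα ?_
    intro α _ ih m q hq hm
    refine h α m q hq hm fun m' hm' => ?_
    by_cases h' : m' = 0
    · exact h' ▸ h0
    obtain ⟨β, q', hq', hβ⟩ := P.leading h'
    -- The symbol of `m'` in degree `α` is zero, so its leading degree `β` is strictly smaller.
    rcases P.mem_compare hq' hβ hm' with h2 | h2
    · exact absurd h2.2.symm hq'
    · exact ih β ⟨m', q', hq', hβ⟩ h2.1 m' q' hq' hβ
  exact key α ⟨m, q, hq, hα⟩ m q hq hα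

/-- The elements of degree `α` of `Q` that are symbols. -/
def comp (α : Γ) : AddSubgroup Q := (P.R α).map (AddMonoidHom.snd M Q)

theorem mem_comp {α : Γ} {q : Q} : q ∈ P.comp α ↔ ∃ m, (m, q) ∈ P.R α := by
  simp [comp, AddSubgroup.mem_map]

/-- `Q` is spanned by symbols, i.e. it is the associated graded group. -/
def IsFull : Prop := AddSubgroup.closure {q | ∃ α m, (m, q) ∈ P.R α} = ⊤

theorem eq_of_sum_eq {f g : Γ →₀ Q} (hf : ∀ α, ∃ m, (m, f α) ∈ P.R α)
    (hg : ∀ α, ∃ m, (m, g α) ∈ P.R α)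
    (h : (f.sum fun _ q => q) = g.sum fun _ q => q) : f = g := by
  rw [← sub_eq_zero]
  refine P.indep _ (fun α => ?_) ?_
  · obtain ⟨m, hm⟩ := hf α
    obtain ⟨m', hm'⟩ := hg α
    exact ⟨m - m', sub_mem hm hm'⟩
  · rw [Finsupp.sum_sub_index (fun _ _ _ => rfl), h, sub_self]

end SymbolRel

theorem Finsupp.exists_sum_eq_of_mem_closure {Γ : Type} {Q : Type v} [AddCommGroup Q]
    {C : Γ → AddSubgroup Q} {q : Q} (hq : q ∈ AddSubgroup.closure {q | ∃ α, q ∈ C α}) :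
    ∃ f : Γ →₀ Q, (∀ α, f α ∈ C α) ∧ (f.sum fun _ q => q) = q := by
  classical
  induction hq using AddSubgroup.closure_induction with
  | mem q hq =>
    obtain ⟨α, hq⟩ := hq
    refine ⟨Finsupp.single α q, fun β => ?_, Finsupp.sum_single_index rfl⟩
    rw [Finsupp.single_apply]
    split_ifs with h
    · exact h ▸ hq
    · exact zero_mem _
  | zero => exact ⟨0, fun _ => zero_mem _, Finsupp.sum_zero_index⟩
  | add x y _ _ hx hy =>
    obtain ⟨f, hf, rfl⟩ := hx
    obtain ⟨g, hg, rfl⟩ := hy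
    exact ⟨f + g, fun α => add_mem (hf α) (hg α),
      Finsupp.sum_add_index' (fun _ => rfl) (fun _ _ _ => rfl)⟩
  | neg x _ hx =>
    obtain ⟨f, hf, rfl⟩ := hx
    exact ⟨-f, fun α => neg_mem (hf α), by
      rw [Finsupp.sum_neg_index (fun _ => rfl)]; exact Finsupp.sum_neg⟩

namespace SymbolRel

variable {Γ : Type} [LinearOrder Γ] {M Q : Type v} [AddCommGroup M] [AddCommGroup Q]
  (P : SymbolRel Γ M Q)

theorem IsFull.exists_sum {P : SymbolRel Γ M Q} (hP : P.IsFull) (q : Q) :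
    ∃ f : Γ →₀ Q, (∀ α, f α ∈ P.comp α) ∧ (f.sum fun _ q => q) = q := by
  refine Finsupp.exists_sum_eq_of_mem_closure ?_
  simp only [mem_comp]
  rw [show AddSubgroup.closure _ = ⊤ from hP]
  trivial

theorem IsFull.isInternal {P : SymbolRel Γ M Q} (hP : P.IsFull) :
    DirectSum.IsInternal P.comp := by
  classical
  constructor
  · rw [injective_iff_map_eq_zero]
    intro x hx
    have h := P.indep (∑ i ∈ x.support, Finsupp.single i (x i : Q)) ?_ ?_
    · ext i
      by_contra hi
      have h1 := DFunLike.congr_fun h i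
      rw [Finsupp.finsetSum_apply, Finset.sum_eq_single i] at h1
      · exact hi (by simpa using h1)
      · intro j _ hj
        exact Finsupp.single_eq_of_ne hj.symm
      · intro hi
        rw [DFinsupp.notMem_support_iff] at hi
        simp [hi]
    · intro α
      rw [← P.mem_comp, Finsupp.finsetSum_apply]
      refine sum_mem fun i _ => ?_
      rw [Finsupp.single_apply]
      split_ifs with h
      · exact h ▸ (x i).2
      · exact zero_mem _
    · rw [← Finsupp.sum_finsetSum_index (h := fun _ q => q) (fun _ => rfl) (fun _ _ _ => rfl)]
      rw [DirectSum.coeAddMonoidHom_eq_dfinsuppSum, DFinsupp.sum] at hx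
      rw [← hx]
      exact Finset.sum_congr rfl fun i _ => Finsupp.sum_single_index rfl
  · intro q
    obtain ⟨f, hf, rfl⟩ := hP.exists_sum q
    refine ⟨∑ i ∈ f.support, DirectSum.of (fun i => P.comp i) i ⟨f i, hf i⟩, ?_⟩
    rw [map_sum]
    exact Finset.sum_congr rfl fun i _ => DirectSum.coeAddMonoidHom_of _ _ _

end SymbolRel

/-! ### Associated graded submodules; induced filtrations on submodules and quotients -/

namespace SymbolModule

variable {Γ : Type} [AddCommGroup Γ] [LinearOrder Γ] {A S : Type v}
  [Ring A] [Ring S] {ρ : SymbolRing Γ A S} {M Q : Type v} [AddCommGroup M] [AddCommGroup Q]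
  [Module A M] [Module S Q] (P : SymbolModule ρ M Q)

/-- The associated graded submodule of a submodule. -/
def gr (K : Submodule A M) : Submodule S Q where
  __ := AddSubgroup.closure {q | ∃ α, ∃ m ∈ K, (m, q) ∈ P.R α}
  smul_mem' s q hq := by
    change q ∈ AddSubgroup.closure _ at hq
    change s • q ∈ AddSubgroup.closure _
    have hs : s ∈ AddSubgroup.closure {s | ∃ α a, (a, s) ∈ ρ.R α} := by
      rw [ρ.span]; trivial
    induction hs using AddSubgroup.closure_induction with
    | mem s hs =>
      obtain ⟨α, a, ha⟩ := hs
      induction hq using AddSubgroup.closure_induction with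
      | mem q hq =>
        obtain ⟨β, m, hm, h⟩ := hq
        exact AddSubgroup.subset_closure ⟨α + β, a • m, K.smul_mem a hm, P.smul_mem ha h⟩
      | zero => rw [smul_zero]; exact zero_mem _
      | add x y _ _ hx hy => rw [smul_add]; exact add_mem hx hy
      | neg x _ hx => rw [smul_neg]; exact neg_mem hx
    | zero => rw [zero_smul]; exact zero_mem _
    | add x y _ _ hx hy => rw [add_smul]; exact add_mem hx hy
    | neg x _ hx => rw [neg_smul]; exact neg_mem hx

theorem mem_gr_of_mem {K : Submodule A M} {α : Γ} {m : M} {q : Q} (hm : m ∈ K)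
    (h : (m, q) ∈ P.R α) : q ∈ P.gr K :=
  AddSubgroup.subset_closure ⟨α, m, hm, h⟩

theorem gr_induction {K : Submodule A M} {p : Q → Prop}
    (mem : ∀ α m q, m ∈ K → (m, q) ∈ P.R α → p q) (add : ∀ x y, p x → p y → p (x + y))
    {q : Q} (hq : q ∈ P.gr K) : p q := by
  change q ∈ AddSubgroup.closure _ at hq
  induction hq using AddSubgroup.closure_induction'' with
  | mem q hq => obtain ⟨α, m, hm, h⟩ := hq; exact mem α m q hm h
  | neg_mem q hq => obtain ⟨α, m, hm, h⟩ := hq; exact mem α (-m) (-q) (neg_mem hm) (neg_mem h)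
  | zero => exact mem 0 0 0 (zero_mem _) (zero_mem (P.R 0))
  | add x y _ _ hx hy => exact add x y hx hy

theorem gr_le_iff {K : Submodule A M} {L : Submodule S Q} :
    P.gr K ≤ L ↔ ∀ α m q, m ∈ K → (m, q) ∈ P.R α → q ∈ L :=
  ⟨fun h _ _ _ hm hq => h (P.mem_gr_of_mem hm hq),
    fun h _ hq => P.gr_induction (p := fun q => q ∈ L) h (fun _ _ => add_mem) hq⟩

theorem gr_mono {K L : Submodule A M} (h : K ≤ L) : P.gr K ≤ P.gr L :=
  P.gr_le_iff.2 fun _ _ _ hm hq => P.mem_gr_of_mem (h hm) hq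

theorem exists_sum_of_mem_gr {K : Submodule A M} {q : Q} (hq : q ∈ P.gr K) :
    ∃ f : Γ →₀ Q, (∀ α, ∃ m ∈ K, (m, f α) ∈ P.R α) ∧ (f.sum fun _ q => q) = q := by
  have := Finsupp.exists_sum_eq_of_mem_closure (q := q)
    (C := fun α => (P.R α ⊓ K.toAddSubgroup.prod ⊤).map (AddMonoidHom.snd M Q))
    (AddSubgroup.closure_mono ?_ hq)
  · obtain ⟨f, hf, h⟩ := this
    refine ⟨f, fun α => ?_, h⟩
    obtain ⟨⟨m, q⟩, hm, h⟩ := hf α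
    obtain ⟨hm, hm', -⟩ := hm
    exact ⟨m, hm', h ▸ hm⟩
  · rintro q ⟨α, m, hm, h⟩
    exact ⟨α, (m, q), ⟨h, hm, trivial⟩, rfl⟩

/-- `gr K` is a graded submodule, so a homogeneous element equals its own component, and components
of `gr K` are symbols of elements of `K`. The hypothesis on `m` serves only to say that `q` is
homogeneous of degree `α`. -/
theorem exists_of_mem_gr {K : Submodule A M} {q : Q} (hq : q ∈ P.gr K) {α : Γ} {m : M}
    (hm : (m, q) ∈ P.R α) : ∃ x ∈ K, (x, q) ∈ P.R α := by
  classical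
  obtain ⟨f, hf, rfl⟩ := P.exists_sum_of_mem_gr hq
  have h : f = Finsupp.single α (f.sum fun _ q => q) := by
    refine P.eq_of_sum_eq (fun β => (hf β).imp fun _ h => h.2) (fun β => ?_)
      (Finsupp.sum_single_index (h := fun _ q => q) rfl).symm
    rw [Finsupp.single_apply]
    split_ifs with h
    · exact ⟨m, h ▸ hm⟩
    · exact ⟨0, zero_mem (P.R β)⟩
  obtain ⟨x, hx, h'⟩ := hf α
  rw [h, Finsupp.single_eq_same] at h'
  exact ⟨x, hx, h'⟩

/-- Successive approximation: subtract from an element of `L` an element of `K` with the same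
symbol; the difference stays in `L` and has lower degree. -/
theorem le_of_gr_le {K L : Submodule A M} (hKL : K ≤ L) (h : P.gr L ≤ P.gr K) : L ≤ K := by
  intro x
  refine P.induction (p := fun x => x ∈ L → x ∈ K) (fun _ => zero_mem _) ?_ x
  intro α m q _ hm ih hL
  obtain ⟨x, hx, hxq⟩ := P.exists_of_mem_gr (h (P.mem_gr_of_mem hL hm)) hm
  have h1 := sub_mem hm hxq
  rw [Prod.mk_sub_mk, sub_self] at h1
  have := add_mem (ih _ h1 (sub_mem hL (hKL hx))) hx
  rwa [sub_add_cancel] at this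

theorem gr_strictMono : StrictMono P.gr := fun _ _ h =>
  lt_of_le_not_ge (P.gr_mono h.le) fun h' => h.not_ge (P.le_of_gr_le h.le h')

theorem isNoetherian (P : SymbolModule ρ M Q) [IsNoetherian S Q] : IsNoetherian A M := by
  rw [isNoetherian_iff']
  exact StrictMono.wellFoundedGT P.gr_strictMono

theorem isFull_iff : P.IsFull ↔ P.gr ⊤ = ⊤ := by
  rw [SymbolRel.IsFull, ← Submodule.toAddSubgroup_inj]
  have : (P.gr ⊤).toAddSubgroup = AddSubgroup.closure {q | ∃ α m, (m, q) ∈ P.R α} := by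
    change AddSubgroup.closure _ = _
    simp
  rw [this]; rfl

variable {P} in
theorem full_induction (hP : P.IsFull) {p : Q → Prop} (mem : ∀ α m q, (m, q) ∈ P.R α → p q)
    (add : ∀ x y, p x → p y → p (x + y)) (q : Q) : p q :=
  P.gr_induction (K := ⊤) (fun α m q _ => mem α m q) add
    (by rw [P.isFull_iff.1 hP]; trivial)

/-- A submodule with the induced filtration. -/
def restrict (K : Submodule A M) : SymbolModule ρ K (P.gr K) where
  R α := (P.R α).comap (K.subtype.toAddMonoidHom.prodMap (P.gr K).subtype.toAddMonoidHom)
  zero_left h := Subtype.ext (P.zero_left h)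
  mono hαβ h := P.mono hαβ h
  leading {m} hm := by
    obtain ⟨α, q, hq, h⟩ := P.leading (m := (m : M)) (by simpa using hm)
    exact ⟨α, ⟨q, P.mem_gr_of_mem m.2 h⟩, by simpa using hq, h⟩
  wf := P.wf.mono fun α ⟨m, q, hq, h⟩ => ⟨m, q, by simpa using hq, h⟩
  indep f hf h := by
    have := P.indep (f.mapRange (fun q : P.gr K => (q : Q)) rfl)
      (fun α => (hf α).imp' _ (fun m hm => hm)) (by
        rw [Finsupp.sum_mapRange_index (fun _ => rfl)]
        simpa [Finsupp.sum] using congrArg Subtype.val h)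
    ext α
    simpa using DFunLike.congr_fun this α
  smul_mem ha hm := P.smul_mem ha hm

theorem restrict_isFull (K : Submodule A M) : (P.restrict K).IsFull := by
  rw [isFull_iff, eq_top_iff]
  rintro ⟨q, hq⟩ -
  have : ∃ h : q ∈ P.gr K, (⟨q, h⟩ : P.gr K) ∈ (P.restrict K).gr ⊤ := by
    refine P.gr_induction (p := fun q => ∃ h, (⟨q, h⟩ : P.gr K) ∈ (P.restrict K).gr ⊤) ?_ ?_ hq
    · intro α m q hm h
      exact ⟨P.mem_gr_of_mem hm h, (P.restrict K).mem_gr_of_mem (m := ⟨m, hm⟩) trivial h⟩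
    · rintro x y ⟨hx, hx'⟩ ⟨hy, hy'⟩
      exact ⟨add_mem hx hy, add_mem hx' hy'⟩
  exact this.2

/-- The filtration induced on a quotient. -/
def pushforward {M₂ Q₂ : Type v} [AddCommGroup M₂] [AddCommGroup Q₂] [Module A M₂]
    [Module S Q₂] (p : M →ₗ[A] M₂) (p' : Q →ₗ[S] Q₂) (hp : Function.Surjective p)
    (hker : LinearMap.ker p' = P.gr (LinearMap.ker p)) : SymbolModule ρ M₂ Q₂ where
  R α := (P.R α).map (p.toAddMonoidHom.prodMap p'.toAddMonoidHom)
  zero_left {α q₂} := by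
    rintro ⟨⟨m, q⟩, h, he⟩
    obtain ⟨h1, rfl⟩ := Prod.mk.inj he
    have : q ∈ LinearMap.ker p' := hker ▸ P.mem_gr_of_mem (LinearMap.mem_ker.2 h1) h
    exact this
  mono {α β m₂ q₂} hαβ := by
    rintro ⟨⟨m, q⟩, h, he⟩
    obtain ⟨rfl, rfl⟩ := Prod.mk.inj he
    exact ⟨(m, 0), P.mono hαβ h, Prod.ext rfl (map_zero p')⟩
  leading {m₂} hm₂ := by
    obtain ⟨m, rfl⟩ := hp m₂
    -- The representative of `p m` is improved until its symbol survives in `Q₂`: a symbol killed by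
    -- `p'` is the symbol of some `x` in the kernel of `p`, and passing to `m - x` lowers the degree
    -- without changing the image.
    have : ∃ α q m', p' q ≠ 0 ∧ p m' = p m ∧ (m', q) ∈ P.R α := by
      revert hm₂
      refine P.induction (p := fun m => p m ≠ 0 → ∃ α q m', p' q ≠ 0 ∧ p m' = p m ∧
        (m', q) ∈ P.R α) (fun h => absurd (map_zero p) h) ?_ m
      intro α m q _ hm ih hm₂
      by_cases hq : p' q = 0
      · have hq' : q ∈ P.gr (LinearMap.ker p) := hker ▸ hq
        obtain ⟨x, hx, hxq⟩ := P.exists_of_mem_gr hq' hm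
        have h1 := sub_mem hm hxq
        rw [Prod.mk_sub_mk, sub_self] at h1
        have h2 : p (m - x) = p m := by rw [map_sub, LinearMap.mem_ker.1 hx, sub_zero]
        have := ih _ h1 (h2 ▸ hm₂)
        rwa [h2] at this
      · exact ⟨α, q, m, hq, rfl, hm⟩
    obtain ⟨α, q, m', hq, hm', h⟩ := this
    exact ⟨α, p' q, hq, (m', q), h, Prod.ext hm' rfl⟩
  wf := P.wf.mono fun α => by
    rintro ⟨m₂, q₂, hq, ⟨m, q⟩, h, he⟩
    obtain ⟨rfl, rfl⟩ := Prod.mk.inj he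
    exact ⟨m, q, fun h0 => hq (h0 ▸ map_zero p'), h⟩
  indep f hf h := by
    classical
    have hf' : ∀ α, ∃ q, (∃ m, (m, q) ∈ P.R α) ∧ p' q = f α := by
      intro α
      obtain ⟨m₂, ⟨m, q⟩, h, he⟩ := hf α
      exact ⟨q, ⟨m, h⟩, (Prod.mk.inj he).2⟩
    choose g hg hgf using hf'
    -- The chosen preimages of zero may be nonzero elements of the kernel, so they are replaced by
    -- zero to obtain finite support.
    let g' : Γ →₀ Q := Finsupp.onFinset f.support (fun α => if f α = 0 then 0 else g α)
      (fun α h => by simp only [ne_eq, ite_eq_left_iff, not_forall] at h; simpa using h.1)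
    have hg'f : ∀ α, p' (g' α) = f α := by
      intro α
      change p' (if f α = 0 then 0 else g α) = f α
      split_ifs with h
      · rw [map_zero, h]
      · exact hgf α
    have hsub : g'.support ⊆ f.support := Finsupp.support_onFinset_subset
    have hsum : (g'.sum fun _ q => q) ∈ P.gr (LinearMap.ker p) := by
      rw [← hker, LinearMap.mem_ker, Finsupp.sum_of_support_subset _ hsub _ (fun _ _ => rfl),
        map_sum, ← h]
      exact Finset.sum_congr rfl fun α _ => hg'f α
    obtain ⟨e, he, hes⟩ := P.exists_sum_of_mem_gr hsum
    have : e = g' := by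
      refine P.eq_of_sum_eq (fun β => (he β).imp fun _ h => h.2) (fun β => ?_) hes
      change ∃ m, (m, if f β = 0 then 0 else g β) ∈ P.R β
      split_ifs
      · exact ⟨0, zero_mem (P.R β)⟩
      · exact hg β
    ext α
    obtain ⟨m, hm, h⟩ := he α
    rw [this] at h
    have : g' α ∈ LinearMap.ker p' := hker ▸ P.mem_gr_of_mem hm h
    rw [← hg'f α, LinearMap.mem_ker.1 this]; rfl
  smul_mem {α β a s m₂ q₂} ha := by
    rintro ⟨⟨m, q⟩, h, he⟩
    obtain ⟨rfl, rfl⟩ := Prod.mk.inj he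
    exact ⟨(a • m, s • q), P.smul_mem ha h, Prod.ext (map_smul p a m) (map_smul p' s q)⟩

theorem pushforward_isFull {M₂ Q₂ : Type v} [AddCommGroup M₂] [AddCommGroup Q₂] [Module A M₂]
    [Module S Q₂] (p : M →ₗ[A] M₂) (p' : Q →ₗ[S] Q₂) (hp : Function.Surjective p)
    (hker : LinearMap.ker p' = P.gr (LinearMap.ker p)) (hP : P.IsFull)
    (hp' : Function.Surjective p') : (P.pushforward p p' hp hker).IsFull := by
  rw [isFull_iff, eq_top_iff]
  rintro q₂ -
  obtain ⟨q, rfl⟩ := hp' q₂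
  refine full_induction hP (p := fun q => p' q ∈ (P.pushforward p p' hp hker).gr ⊤) ?_ ?_ q
  · intro α m q h
    exact mem_gr_of_mem _ (m := p m) trivial ⟨(m, q), h, rfl⟩
  · intro x y hx hy
    rw [map_add]
    exact add_mem hx hy

/-- The map is the identity on symbols: a nonzero leading symbol survives, which gives injectivity,
and the range has the full associated graded module, which gives surjectivity. -/
theorem bijective_of_symbol_eq (f : M →ₗ[A] M)
    (hf : ∀ {α m q}, (m, q) ∈ P.R α → (f m, q) ∈ P.R α) : Function.Bijective f := by
  constructor
  · rw [injective_iff_map_eq_zero]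
    intro m hm
    by_contra h
    obtain ⟨α, q, hq, h⟩ := P.leading h
    have := hf h
    rw [hm] at this
    exact hq (P.zero_left this)
  · rw [← LinearMap.range_eq_top, eq_top_iff]
    refine P.le_of_gr_le le_top (P.gr_le_iff.2 fun α m q _ h => ?_)
    exact P.mem_gr_of_mem ⟨m, rfl⟩ (hf h)

end SymbolModule

/-! ### Free modules and presentations -/

namespace SymbolRel

variable {Γ : Type} [AddCommGroup Γ] [LinearOrder Γ] [IsOrderedAddMonoid Γ] {M Q : Type v}
  [AddCommGroup M] [AddCommGroup Q]

/-- The direct sum of copies of `M`, with the filtration of the `i`-th copy shifted by `d i`. -/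
noncomputable def finsupp.{w} (P : SymbolRel Γ M Q) (ι : Type w) (d : ι → Γ) (hd : (Set.range d).IsWF) :
    SymbolRel Γ (ι →₀ M) (ι →₀ Q) where
  R α :=
    { carrier := {x | ∀ i, (x.1 i, x.2 i) ∈ P.R (α - d i)}
      zero_mem' := fun i => zero_mem (P.R (α - d i))
      add_mem' := fun hx hy i => add_mem (hx i) (hy i)
      neg_mem' := fun hx i => neg_mem (hx i) }
  zero_left h := Finsupp.ext fun i => P.zero_left (h i)
  mono hαβ h i := P.mono (sub_lt_sub_right hαβ _) (h i)
  leading {m} hm := by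
    classical
    have h : ∀ i, ∃ γ q, m i ≠ 0 → q ≠ 0 ∧ (m i, q) ∈ P.R γ := by
      intro i
      by_cases hi : m i = 0
      · exact ⟨0, 0, fun h => absurd hi h⟩
      · obtain ⟨γ, q, h⟩ := P.leading hi
        exact ⟨γ, q, fun _ => h⟩
    choose γ q h using h
    -- The degree of a vector is the largest shifted degree of its coordinates; its symbol keeps
    -- only the coordinates that attain it.
    obtain ⟨j, hj, hmax⟩ := Finset.exists_max_image m.support (fun i => γ i + d i)
      (Finsupp.support_nonempty_iff.2 hm)
    rw [Finsupp.mem_support_iff] at hj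
    refine ⟨γ j + d j, Finsupp.onFinset m.support
      (fun i => if m i ≠ 0 ∧ γ i + d i = γ j + d j then q i else 0) (fun i hi => ?_), ?_, ?_⟩
    · simp only [ne_eq, ite_eq_right_iff, not_forall] at hi
      simpa using hi.1.1
    · intro h0
      have := DFunLike.congr_fun h0 j
      simp only [Finsupp.onFinset_apply, Finsupp.zero_apply] at this
      rw [if_pos ⟨hj, trivial⟩] at this
      exact (h j hj).1 this
    · intro i
      change (m i, if m i ≠ 0 ∧ γ i + d i = γ j + d j then q i else 0) ∈ P.R (γ j + d j - d i)
      split_ifs with hi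
      · rw [← hi.2, add_sub_cancel_right]
        exact (h i hi.1).2
      · by_cases h0 : m i = 0
        · rw [h0]; exact zero_mem (P.R _)
        · have hlt : γ i + d i < γ j + d j :=
            lt_of_le_of_ne (hmax i (by simpa using h0)) fun h' => hi ⟨h0, h'⟩
          exact P.mono (lt_sub_iff_add_lt.2 hlt) (h i h0).2
  -- Degrees lie in the sum of two well-founded sets, so infinitely many generators are allowed as
  -- long as their degrees are well-founded.
  wf := (hd.add P.wf).mono fun α => by
    rintro ⟨m, q, hq, h⟩
    obtain ⟨i, hi⟩ := Finsupp.ne_iff.1 hq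
    exact ⟨d i, ⟨i, rfl⟩, α - d i, ⟨m i, q i, hi, h i⟩, add_sub_cancel _ _⟩
  indep f hf h := by
    have key : ∀ i, (f.mapRange (fun x : ι →₀ Q => x i) rfl).equivMapDomain
        (Equiv.subRight (d i)) = 0 := by
      intro i
      refine P.indep _ (fun α => ?_) ?_
      · obtain ⟨m, hm⟩ := hf (α + d i)
        have := hm i
        rw [add_sub_cancel_right] at this
        exact ⟨m i, this⟩
      · rw [Finsupp.sum_equivMapDomain, Finsupp.sum_mapRange_index (fun _ => rfl)]
        have := DFunLike.congr_fun h i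
        rwa [Finsupp.sum, Finsupp.finsetSum_apply] at this
    ext α i
    have := DFunLike.congr_fun (key i) (α - d i)
    simpa using this

theorem single_mem_finsupp.{w} {P : SymbolRel Γ M Q} {ι : Type w} {d : ι → Γ}
    {hd : (Set.range d).IsWF} {α : Γ} {m : M} {q : Q} (h : (m, q) ∈ P.R α) (i : ι) :
    (Finsupp.single i m, Finsupp.single i q) ∈ (P.finsupp ι d hd).R (α + d i) := by
  classical
  intro j
  simp only [Finsupp.single_apply]
  split_ifs with hj
  · subst hj; rwa [add_sub_cancel_right]
  · exact zero_mem (P.R _)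

theorem finsupp_isFull.{w} {P : SymbolRel Γ M Q} (hP : P.IsFull) {ι : Type w} {d : ι → Γ}
    {hd : (Set.range d).IsWF} : (P.finsupp ι d hd).IsFull := by
  rw [IsFull, eq_top_iff]
  rintro q -
  induction q using Finsupp.induction_linear with
  | zero => exact zero_mem _
  | add f g hf hg => exact add_mem hf hg
  | single i q =>
    have hq : q ∈ AddSubgroup.closure {q | ∃ α m, (m, q) ∈ P.R α} := by
      rw [show AddSubgroup.closure _ = ⊤ from hP]; trivial
    induction hq using AddSubgroup.closure_induction with
    | mem q hq =>
      obtain ⟨α, m, h⟩ := hq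
      exact AddSubgroup.subset_closure ⟨_, _, single_mem_finsupp h i⟩
    | zero => rw [Finsupp.single_zero]; exact zero_mem _
    | add x y _ _ hx hy => rw [Finsupp.single_add]; exact add_mem hx hy
    | neg x _ hx => rw [Finsupp.single_neg]; exact neg_mem hx

end SymbolRel

namespace SymbolRing

variable {Γ : Type} [AddCommGroup Γ] [LinearOrder Γ] {A S : Type v} [Ring A] [Ring S]
  (ρ : SymbolRing Γ A S)

/-- The opposite ring of a filtered ring. -/
def op : SymbolRing Γ Aᵐᵒᵖ Sᵐᵒᵖ where
  R α :=
    { carrier := {x | (x.1.unop, x.2.unop) ∈ ρ.R α}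
      zero_mem' := zero_mem (ρ.R α)
      add_mem' := fun hx hy => add_mem (S := AddSubgroup (A × S)) hx hy
      neg_mem' := fun hx => neg_mem (S := AddSubgroup (A × S)) hx }
  zero_left h := MulOpposite.unop_injective (ρ.zero_left h)
  mono h h' := ρ.mono h h'
  leading {m} hm := by
    obtain ⟨α, s, hs, h⟩ := ρ.leading (m := m.unop) (by simpa using hm)
    exact ⟨α, MulOpposite.op s, by simpa using hs, h⟩
  wf := ρ.wf.mono fun α ⟨m, q, hq, h⟩ => ⟨m.unop, q.unop, by simpa using hq, h⟩
  indep f hf h := by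
    have := ρ.indep (f.mapRange MulOpposite.unop rfl) (fun α => (hf α).imp' _ fun m hm => hm) (by
      rw [Finsupp.sum_mapRange_index (fun _ => rfl)]
      simpa [Finsupp.sum] using congrArg MulOpposite.unop h)
    ext α
    simpa using DFunLike.congr_fun this α
  one_mem := ρ.one_mem
  mul_mem {α β _ _ _ _} h h' := by
    have := ρ.mul_mem h' h
    rw [add_comm] at this
    exact this
  span := by
    rw [eq_top_iff]
    rintro s -
    obtain ⟨s, rfl⟩ := MulOpposite.op_surjective s
    have hs : s ∈ AddSubgroup.closure {s | ∃ α a, (a, s) ∈ ρ.R α} := by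
      rw [ρ.span]; trivial
    induction hs using AddSubgroup.closure_induction with
    | mem s hs =>
      obtain ⟨α, a, ha⟩ := hs
      exact AddSubgroup.subset_closure ⟨α, MulOpposite.op a, ha⟩
    | zero => exact zero_mem _
    | add x y _ _ hx hy => exact add_mem hx hy
    | neg x _ hx => exact neg_mem hx

/-- A filtered ring as a module over itself. -/
def regular : SymbolModule ρ A S where
  __ := ρ.toSymbolRel
  smul_mem := ρ.mul_mem

theorem isNoetherianRing (ρ : SymbolRing Γ A S) (h : IsNoetherianRing S) : IsNoetherianRing A :=
  letI : IsNoetherian S S := h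
  ρ.regular.isNoetherian

theorem isTwoSidedNoetherian (ρ : SymbolRing Γ A S) (h : IsTwoSidedNoetherian S) : IsTwoSidedNoetherian A :=
  ⟨ρ.isNoetherianRing h.1, ρ.op.isNoetherianRing h.2⟩

variable [IsOrderedAddMonoid Γ]

/-- The filtered free module with generators of degrees `d i`. -/
noncomputable def free (ι : Type v) (d : ι → Γ) (hd : (Set.range d).IsWF) :
    SymbolModule ρ (ι →₀ A) (ι →₀ S) where
  __ := ρ.finsupp ι d hd
  smul_mem {α β a s m q} ha hm i := by
    have := ρ.mul_mem ha (hm i)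
    rwa [← add_sub_assoc] at this

theorem free_isFull {ι : Type v} {d : ι → Γ} {hd : (Set.range d).IsWF} :
    (ρ.free ι d hd).IsFull :=
  SymbolRel.finsupp_isFull (hd := hd) ρ.span

end SymbolRing

namespace SymbolModule

variable {Γ : Type} [AddCommGroup Γ] [LinearOrder Γ] {A S : Type v}
  [Ring A] [Ring S] {ρ : SymbolRing Γ A S} {M Q : Type v} [AddCommGroup M] [AddCommGroup Q]
  [Module A M] [Module S Q]

/-! ### Strictness of filtered maps that are surjective on graded modules -/

section Strict

variable {M₂ Q₂ : Type v} [AddCommGroup M₂] [AddCommGroup Q₂] [Module A M₂] [Module S Q₂]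
  {P : SymbolModule ρ M Q} {P₂ : SymbolModule ρ M₂ Q₂} {φ : M →ₗ[A] M₂} {φ' : Q →ₗ[S] Q₂}

theorem map_sum_components (hφ : ∀ {α m q}, (m, q) ∈ P.R α → (φ m, φ' q) ∈ P₂.R α)
    {f : Γ →₀ Q} (hf : ∀ α, f α ∈ P.comp α) {g : Γ →₀ Q₂} (hg : ∀ α, g α ∈ P₂.comp α)
    (h : φ' (f.sum fun _ q => q) = g.sum fun _ q => q) (α : Γ) : φ' (f α) = g α := by
  have : f.mapRange φ' (map_zero φ') = g := by
    refine P₂.eq_of_sum_eq (fun α => ?_) (fun α => P₂.mem_comp.1 (hg α)) ?_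
    · obtain ⟨m, hm⟩ := P.mem_comp.1 (hf α)
      exact ⟨φ m, hφ hm⟩
    · rw [← h, Finsupp.sum_mapRange_index (fun _ => rfl), Finsupp.sum, Finsupp.sum, map_sum]
  rw [← this, Finsupp.mapRange_apply]

/-- Since `φ'` preserves degrees, the component of degree `α` of any preimage of a homogeneous
element is again a preimage. -/
theorem exists_comp_preimage (hφ : ∀ {α m q}, (m, q) ∈ P.R α → (φ m, φ' q) ∈ P₂.R α)
    (hP : P.IsFull) (hφ' : Function.Surjective φ') {α : Γ} {m₂ : M₂} {q₂ : Q₂}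
    (h : (m₂, q₂) ∈ P₂.R α) : ∃ m q, (m, q) ∈ P.R α ∧ φ' q = q₂ := by
  classical
  obtain ⟨v, rfl⟩ := hφ' q₂
  obtain ⟨f, hf, rfl⟩ := hP.exists_sum v
  have := map_sum_components (g := Finsupp.single α (φ' (f.sum fun _ q => q))) hφ hf (fun β => by
    rw [Finsupp.single_apply]
    split_ifs with h'
    · exact P₂.mem_comp.2 ⟨m₂, h' ▸ h⟩
    · exact zero_mem _) (Finsupp.sum_single_index (h := fun _ q => q) rfl).symm α
  rw [Finsupp.single_eq_same] at this
  obtain ⟨m, hm⟩ := P.mem_comp.1 (hf α)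
  exact ⟨m, f α, hm, this⟩

/-- The leading degree `γ` of `m₂` is below `α`. Lift its symbol there and treat the remainder, of
degree below `γ`, by induction; all corrections stay below `α`. -/
theorem exists_lift_of_zero (hφ : ∀ {α m q}, (m, q) ∈ P.R α → (φ m, φ' q) ∈ P₂.R α)
    (hP : P.IsFull) (hφ' : Function.Surjective φ') {α : Γ} {m₂ : M₂}
    (h : (m₂, (0 : Q₂)) ∈ P₂.R α) : ∃ m, (m, (0 : Q)) ∈ P.R α ∧ φ m = m₂ := by
  revert α
  refine P₂.induction (p := fun m₂ => ∀ {α}, (m₂, (0 : Q₂)) ∈ P₂.R α →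
    ∃ m, (m, (0 : Q)) ∈ P.R α ∧ φ m = m₂) ?_ ?_ m₂
  · exact fun {α} _ => ⟨0, zero_mem (P.R α), map_zero φ⟩
  · intro γ m₂ q hq hγ ih α hα
    rcases P₂.mem_compare hq hγ hα with h | h
    · exact absurd h.2.symm hq
    obtain ⟨u, v, huv, rfl⟩ := exists_comp_preimage hφ hP hφ' hγ
    have h1 := sub_mem hγ (hφ huv)
    rw [Prod.mk_sub_mk, sub_self] at h1
    obtain ⟨u', hu', hφu'⟩ := ih _ h1 h1
    exact ⟨u' + u, P.mono h.1 (add_mem hu' huv), by rw [map_add, hφu', sub_add_cancel]⟩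

theorem exists_lift (hφ : ∀ {α m q}, (m, q) ∈ P.R α → (φ m, φ' q) ∈ P₂.R α)
    (hP : P.IsFull) (hφ' : Function.Surjective φ') {α : Γ} {m₂ : M₂} {q₂ : Q₂}
    (h : (m₂, q₂) ∈ P₂.R α) : ∃ m q, (m, q) ∈ P.R α ∧ φ m = m₂ ∧ φ' q = q₂ := by
  obtain ⟨u, v, huv, rfl⟩ := exists_comp_preimage hφ hP hφ' h
  have h1 := sub_mem h (hφ huv)
  rw [Prod.mk_sub_mk, sub_self] at h1
  obtain ⟨u', hu', hφu'⟩ := exists_lift_of_zero hφ hP hφ' h1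
  refine ⟨u' + u, 0 + v, add_mem hu' huv, ?_, by rw [zero_add]⟩
  rw [map_add, hφu', sub_add_cancel]

theorem surjective_of_symbols (hφ : ∀ {α m q}, (m, q) ∈ P.R α → (φ m, φ' q) ∈ P₂.R α)
    (hP : P.IsFull) (hφ' : Function.Surjective φ') : Function.Surjective φ := by
  intro m₂
  by_cases h : m₂ = 0
  · exact ⟨0, by rw [h, map_zero]⟩
  obtain ⟨α, q₂, -, h⟩ := P₂.leading h
  obtain ⟨m, q, -, h, -⟩ := exists_lift hφ hP hφ' h
  exact ⟨m, h⟩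

/-- For the hard inclusion, lift a homogeneous element of the kernel of `φ'` to `u`. Then `φ u` has
zero symbol, so it is also the image of some `u'` with zero symbol in that degree, and `u - u'` is a
genuine kernel element with the prescribed symbol. -/
theorem gr_ker (hφ : ∀ {α m q}, (m, q) ∈ P.R α → (φ m, φ' q) ∈ P₂.R α)
    (hP : P.IsFull) (hφ' : Function.Surjective φ') :
    P.gr (LinearMap.ker φ) = LinearMap.ker φ' := by
  apply le_antisymm
  · rw [gr_le_iff]
    intro α m q hm h
    have := hφ h
    rw [LinearMap.mem_ker.1 hm] at this
    exact P₂.zero_left this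
  · intro v hv
    obtain ⟨f, hf, rfl⟩ := hP.exists_sum v
    refine sum_mem fun α _ => ?_
    have h0 := map_sum_components (g := 0) hφ hf (fun _ => zero_mem _)
      (by rw [LinearMap.mem_ker.1 hv, Finsupp.sum_zero_index]) α
    obtain ⟨u, hu⟩ := P.mem_comp.1 (hf α)
    have h1 := hφ hu
    rw [h0, Finsupp.zero_apply] at h1
    obtain ⟨u', hu', he⟩ := exists_lift_of_zero hφ hP hφ' h1
    have h2 := sub_mem hu hu'
    rw [Prod.mk_sub_mk, sub_zero] at h2
    exact P.mem_gr_of_mem (m := u - u') (by rw [LinearMap.mem_ker, map_sub, he, sub_self]) h2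

end Strict

/-- A family of homogeneous generators of `Q`, lifted to `M`. -/
structure Generators (P : SymbolModule ρ M Q) where
  ι : Type v
  d : ι → Γ
  wf : (Set.range d).IsWF
  x : ι → M
  q : ι → Q
  mem : ∀ i, (x i, q i) ∈ P.R (d i)
  span : Submodule.span S (Set.range q) = ⊤

theorem exists_generators {P : SymbolModule ρ M Q} (hP : P.IsFull) : Nonempty P.Generators := by
  -- All nonzero symbols are taken as generators; being nonzero keeps their degrees inside the
  -- well-founded set `P.wf`.
  refine ⟨⟨{t : M × Q × Γ // t.2.1 ≠ 0 ∧ (t.1, t.2.1) ∈ P.R t.2.2}, fun t => t.1.2.2, ?_,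
    fun t => t.1.1, fun t => t.1.2.1, fun t => t.2.2, ?_⟩⟩
  · refine P.wf.mono ?_
    rintro _ ⟨t, rfl⟩
    exact ⟨_, _, t.2⟩
  · rw [eq_top_iff]
    rintro q -
    refine full_induction hP (p := fun q => q ∈ Submodule.span S _) ?_ (fun _ _ => add_mem) q
    intro α m q h
    by_cases hq : q = 0
    · rw [hq]; exact zero_mem _
    · exact Submodule.subset_span ⟨⟨(m, q, α), hq, h⟩, rfl⟩

theorem exists_finite_generators {P : SymbolModule ρ M Q} (hP : P.IsFull) [Module.Finite S Q] :
    ∃ g : P.Generators, Finite g.ι := by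
  obtain ⟨g⟩ := exists_generators hP
  have := (Submodule.fg_span_iff_fg_span_finset_subset (R := S) (Set.range g.q)).1
    (by rw [g.span]; exact Module.Finite.fg_top)
  obtain ⟨s, hs, h⟩ := this
  choose f hf using fun i : s => hs i.2
  refine ⟨⟨s, fun i => g.d (f i), (Set.finite_range _).isWF, fun i => g.x (f i), fun i => g.q (f i),
    fun i => g.mem _, ?_⟩, (inferInstance : Finite s)⟩
  rw [← g.span, h]
  congr 1
  ext q
  exact ⟨fun ⟨i, hi⟩ => by rw [← hi]; simp only [hf]; exact i.2, fun hq => ⟨⟨q, hq⟩, hf ⟨q, hq⟩⟩⟩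

variable [IsOrderedAddMonoid Γ]

theorem linearCombination_mem (P : SymbolModule ρ M Q) {ι : Type v} {d : ι → Γ}
    {hd : (Set.range d).IsWF} {x : ι → M} {q : ι → Q} (h : ∀ i, (x i, q i) ∈ P.R (d i)) {α : Γ}
    {a : ι →₀ A} {s : ι →₀ S} (hα : (a, s) ∈ (ρ.free ι d hd).R α) :
    (Finsupp.linearCombination A x a, Finsupp.linearCombination S q s) ∈ P.R α := by
  classical
  rw [Finsupp.linearCombination_apply, Finsupp.linearCombination_apply,
    Finsupp.sum_of_support_subset a (Finset.subset_union_left (s₂ := s.support)) _ (by simp),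
    Finsupp.sum_of_support_subset s (Finset.subset_union_right (s₁ := a.support)) _ (by simp)]
  have h2 : ∀ s : Finset ι, ∀ f : ι → M, ∀ f' : ι → Q, (∑ i ∈ s, f i, ∑ i ∈ s, f' i) =
      ∑ i ∈ s, (f i, f' i) := fun s f f' =>
    Prod.ext (by simp [Prod.fst_sum]) (by simp [Prod.snd_sum])
  rw [h2]
  refine sum_mem fun i _ => ?_
  have := P.smul_mem (hα i) (h i)
  rwa [sub_add_cancel] at this

namespace Generators

variable {P : SymbolModule ρ M Q} (g : P.Generators)

/-- The filtered free module on the generators. -/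
noncomputable abbrev F : SymbolModule ρ (g.ι →₀ A) (g.ι →₀ S) := ρ.free g.ι g.d g.wf

/-- The map from the free module to the filtered module. -/
noncomputable abbrev π : (g.ι →₀ A) →ₗ[A] M := Finsupp.linearCombination A g.x

/-- The map from the free module to the graded module. -/
noncomputable abbrev π' : (g.ι →₀ S) →ₗ[S] Q := Finsupp.linearCombination S g.q

theorem π_mem {α : Γ} {a : g.ι →₀ A} {s : g.ι →₀ S} (h : (a, s) ∈ g.F.R α) :
    (g.π a, g.π' s) ∈ P.R α :=
  P.linearCombination_mem g.mem h

theorem π'_surjective : Function.Surjective g.π' := by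
  rw [← LinearMap.range_eq_top, Finsupp.range_linearCombination, g.span]

theorem π_surjective : Function.Surjective g.π :=
  surjective_of_symbols g.π_mem ρ.free_isFull g.π'_surjective

/-- The kernel of `π`. -/
noncomputable abbrev K : Submodule A (g.ι →₀ A) := LinearMap.ker g.π

theorem gr_K : g.F.gr g.K = LinearMap.ker g.π' :=
  gr_ker g.π_mem ρ.free_isFull g.π'_surjective

/-- The first syzygy module, with the induced filtration. -/
noncomputable abbrev syz : SymbolModule ρ g.K (g.F.gr g.K) := g.F.restrict g.K

theorem syz_isFull : g.syz.IsFull := g.F.restrict_isFull g.K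

end Generators

end SymbolModule

/-! ### The dual of a filtered module -/

theorem LinearMap.exists_comp_eq_of_ker_le {R M N P : Type*} [Ring R] [AddCommGroup M]
    [AddCommGroup N] [AddCommGroup P] [Module R M] [Module R N] [Module R P] {p : M →ₗ[R] N}
    (hp : Function.Surjective p) {f : M →ₗ[R] P} (h : LinearMap.ker p ≤ LinearMap.ker f) :
    ∃ g : N →ₗ[R] P, ∀ m, g (p m) = f m := by
  refine ⟨(LinearMap.ker p).liftQ f h ∘ₗ (p.quotKerEquivOfSurjective hp).symm.toLinearMap,
    fun m => ?_⟩
  have : (p.quotKerEquivOfSurjective hp).symm (p m) = (LinearMap.ker p).mkQ m := by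
    rw [LinearEquiv.symm_apply_eq]; rfl
  simp [this]

namespace SymbolModule

variable {Γ : Type} [AddCommGroup Γ] [LinearOrder Γ] [IsOrderedAddMonoid Γ] {A S : Type v}
  [Ring A] [Ring S] {ρ : SymbolRing Γ A S} {M Q : Type v} [AddCommGroup M] [AddCommGroup Q]
  [Module A M] [Module S Q]

theorem exists_dual_leading {P : SymbolModule ρ M Q} (hP : P.IsFull) [Module.Finite S Q]
    {f : M →ₗ[A] A} (hf : f ≠ 0) : ∃ (δ : Γ) (f' : Q →ₗ[S] S), f' ≠ 0 ∧
      ∀ {α m q}, (m, q) ∈ P.R α → (f m, f' q) ∈ ρ.R (α + δ) := by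
  classical
  obtain ⟨g, _⟩ := exists_finite_generators hP
  have := Fintype.ofFinite g.ι
  have hlead : ∀ i, ∃ γ t, f (g.x i) ≠ 0 → t ≠ 0 ∧ (f (g.x i), t) ∈ ρ.R γ := by
    intro i
    by_cases hi : f (g.x i) = 0
    · exact ⟨0, 0, fun h => absurd hi h⟩
    · obtain ⟨γ, q, h⟩ := ρ.leading hi
      exact ⟨γ, q, fun _ => h⟩
  choose γ t₀ ht₀ using hlead
  have hcomp : ∀ u, Finsupp.linearCombination A (fun i => f (g.x i)) u = f (g.π u) := by
    intro u
    rw [← LinearMap.comp_apply]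
    congr 1
    ext i
    simp
  have hne : (Finset.univ.filter fun i => f (g.x i) ≠ 0).Nonempty := by
    by_contra h
    rw [Finset.not_nonempty_iff_eq_empty, Finset.filter_eq_empty_iff] at h
    apply hf
    ext m
    obtain ⟨u, rfl⟩ := g.π_surjective m
    rw [← hcomp]
    have : (fun i => f (g.x i)) = 0 := funext fun i => not_not.1 (h (Finset.mem_univ i))
    rw [this, Finsupp.linearCombination_zero]; rfl
  -- The degree `δ` of `f` is the largest amount by which it raises the degree of a generator;
  -- finiteness of the generating family makes the maximum exist. The symbol `f'` is prescribed on
  -- the generators where it is attained and is zero on the others.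
  obtain ⟨j, hj, hmax⟩ := Finset.exists_max_image _ (fun i => γ i - g.d i) hne
  simp only [Finset.mem_filter, Finset.mem_univ, true_and] at hj hmax
  let δ := γ j - g.d j
  let t : g.ι → S := fun i => if f (g.x i) ≠ 0 ∧ γ i - g.d i = δ then t₀ i else 0
  have ht : ∀ i, (f (g.x i), t i) ∈ ρ.R (g.d i + δ) := by
    intro i
    simp only [t]
    split_ifs with h
    · rw [← h.2, add_sub_cancel]
      exact (ht₀ i h.1).2
    · by_cases h0 : f (g.x i) = 0
      · rw [h0]; exact zero_mem (ρ.R _)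
      · have hlt : γ i - g.d i < δ := lt_of_le_of_ne (hmax i h0) fun h' => h ⟨h0, h'⟩
        exact ρ.mono (sub_lt_iff_lt_add'.1 hlt) (ht₀ i h0).2
  have key : ∀ {α u v}, (u, v) ∈ g.F.R α →
      (f (g.π u), Finsupp.linearCombination S t v) ∈ ρ.R (α + δ) := by
    intro α u v h
    rw [← hcomp]
    refine ρ.regular.linearCombination_mem (d := fun i => g.d i + δ)
      (hd := (Set.finite_range _).isWF) ht fun i => ?_
    rw [add_sub_add_right_eq_sub]
    exact h i
  -- `f'` is well defined: by strictness, relations among the `q i` are sums of symbols of relations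
  -- among the `x i`, and `f` respects the latter.
  have hker : LinearMap.ker g.π' ≤ LinearMap.ker (Finsupp.linearCombination S t) := by
    rw [← g.gr_K, gr_le_iff]
    intro α u v hu h
    have := key h
    rw [LinearMap.mem_ker.1 hu, map_zero] at this
    exact ρ.zero_left this
  obtain ⟨f', hf'⟩ := LinearMap.exists_comp_eq_of_ker_le g.π'_surjective hker
  refine ⟨δ, f', ?_, ?_⟩
  · rintro rfl
    have := hf' (Finsupp.single j 1)
    simp only [LinearMap.zero_apply, Finsupp.linearCombination_single, one_smul, t] at this
    rw [if_pos ⟨hj, rfl⟩] at this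
    exact (ht₀ j hj).1 this.symm
  · intro α m q h
    obtain ⟨u, v, huv, rfl, rfl⟩ := exists_lift g.π_mem ρ.free_isFull g.π'_surjective h
    rw [hf']
    exact key huv

/-- The filtration of the dual `Hom_A(M, A)`; its associated graded module is contained in
`Hom_S(Q, S)`. -/
def dual (P : SymbolModule ρ M Q) (hP : P.IsFull) [Module.Finite S Q] :
    SymbolModule ρ.op (M →ₗ[A] A) (Q →ₗ[S] S) where
  R δ :=
    { carrier := {x | ∀ α m q, (m, q) ∈ P.R α → (x.1 m, x.2 q) ∈ ρ.R (α + δ)}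
      zero_mem' := fun α _ _ _ => zero_mem (ρ.R (α + δ))
      add_mem' := fun hx hy α m q h => add_mem (hx α m q h) (hy α m q h)
      neg_mem' := fun hx α m q h => neg_mem (hx α m q h) }
  zero_left {δ f'} h := by
    ext q
    refine full_induction hP (p := fun q => f' q = 0) ?_ ?_ q
    · exact fun α m q hm => ρ.zero_left (h α m q hm)
    · intro x y hx hy
      rw [map_add, hx, hy, add_zero]
  mono hδ h α m q hm := ρ.mono (add_lt_add_right hδ α) (h α m q hm)
  leading hf := by
    obtain ⟨δ, f', hf', h⟩ := exists_dual_leading hP hf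
    exact ⟨δ, f', hf', fun α m q hm => h hm⟩
  wf := by
    obtain ⟨g, _⟩ := exists_finite_generators hP
    -- A nonzero symbol `f'` of degree `δ` is nonzero on some generator, whose image is a nonzero
    -- symbol of `A` of degree `g.d i + δ`; so `δ` lies in a finite set plus a well-founded one.
    have hneg : (Set.range fun i => - g.d i).IsWF := (Set.finite_range _).isWF
    refine (hneg.add ρ.wf).mono ?_
    rintro δ ⟨f, f', hf', h⟩
    obtain ⟨i, hi⟩ : ∃ i, f' (g.q i) ≠ 0 := by
      by_contra hcon
      push Not at hcon
      apply hf'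
      ext q
      obtain ⟨v, rfl⟩ := g.π'_surjective q
      rw [Finsupp.linearCombination_apply, map_finsuppSum]
      simp [hcon]
    exact ⟨-g.d i, ⟨i, rfl⟩, g.d i + δ, ⟨_, _, hi, h _ _ _ (g.mem i)⟩, neg_add_cancel_left _ _⟩
  indep f hf h := by
    classical
    have key : ∀ q δ, f δ q = 0 := by
      intro q
      refine full_induction hP (p := fun q => ∀ δ, f δ q = 0) ?_ ?_ q
      · intro α m q hm δ
        -- Evaluation at an element of degree `α` turns a component of degree `δ` into one of degree
        -- `α + δ`, so independence in `S`, reindexed by the shift, applies.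
        have := ρ.indep ((f.mapRange (fun e : Q →ₗ[S] S => e q) rfl).equivMapDomain
          (Equiv.addLeft α)) (fun β => ?_) ?_
        · have := DFunLike.congr_fun this (α + δ)
          simpa using this
        · obtain ⟨e, he⟩ := hf (-α + β)
          have := he α m q hm
          rw [add_neg_cancel_left] at this
          exact ⟨e m, this⟩
        · rw [Finsupp.sum_equivMapDomain, Finsupp.sum_mapRange_index (fun _ => rfl)]
          have := LinearMap.congr_fun h q
          rwa [Finsupp.sum, LinearMap.sum_apply] at this
      · intro x y hx hy δ
        rw [map_add, hx, hy, add_zero]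
    ext δ q
    exact key q δ
  smul_mem {δ ε a s f f'} ha hf α m q hm := by
    have := ρ.mul_mem (hf α m q hm) ha
    rw [add_assoc, add_comm ε δ] at this
    exact this

/-- The restrictions of homomorphisms on the graded free module are symbols of restrictions of
homomorphisms on the filtered free module. -/
theorem domRestrict_mem_gr_dual {ι : Type v} [Finite ι] {d : ι → Γ} {hd : (Set.range d).IsWF}
    {K : Submodule A (ι →₀ A)} [Module.Finite S ((ρ.free ι d hd).gr K)]
    {Z : Submodule Aᵐᵒᵖ (K →ₗ[A] A)} (hZ : ∀ f : (ι →₀ A) →ₗ[A] A, f.domRestrict K ∈ Z)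
    (f' : (ι →₀ S) →ₗ[S] S) : f'.domRestrict ((ρ.free ι d hd).gr K) ∈
      (((ρ.free ι d hd).restrict K).dual ((ρ.free ι d hd).restrict_isFull K)).gr Z := by
  classical
  have := Fintype.ofFinite ι
  -- Expand `f'` in the coordinate functions: the `i`-th one over `S` is the symbol, in degree `- d
  -- i`, of the `i`-th one over `A`.
  have h : f'.domRestrict ((ρ.free ι d hd).gr K) = ∑ i, MulOpposite.op (f' (Finsupp.single i 1)) •
      (Finsupp.lapply i : (ι →₀ S) →ₗ[S] S).domRestrict ((ρ.free ι d hd).gr K) := by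
    ext ⟨q, hq⟩
    rw [LinearMap.sum_apply]
    simp only [LinearMap.domRestrict_apply, LinearMap.smul_apply, Finsupp.lapply_apply,
      MulOpposite.smul_eq_mul_unop, MulOpposite.unop_op]
    conv_lhs => rw [← Finsupp.sum_single q]
    rw [map_finsuppSum, Finsupp.sum_fintype _ _ (by simp)]
    refine Finset.sum_congr rfl fun i _ => ?_
    rw [← smul_eq_mul, ← map_smul, Finsupp.smul_single_one]
  rw [h]
  refine sum_mem fun i _ => Submodule.smul_mem _ _ ?_
  refine mem_gr_of_mem _ (α := - d i) (hZ (Finsupp.lapply i)) ?_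
  rintro α ⟨u, hu⟩ ⟨v, hv⟩ huv
  have := huv i
  rw [sub_eq_add_neg] at this
  exact this

end SymbolModule

/-! ### Ext groups with values in the ring -/

section ExtRing

variable {R : Type v} [Ring R]

theorem smul_ext_def {M : ModuleCat.{v} R} {i : ℕ} (a : Rᵐᵒᵖ) (e : ExtToRing R M i) :
    a • e = e.comp (Ext.mk₀ (rightMulHom R a.unop)) (add_zero i) := rfl

/-- The connecting map `Ext^n(K, R) → Ext^(n+1)(M, R)` of a short exact sequence
`0 → K → F → M → 0`. -/
noncomputable def extConn {T : ShortComplex (ModuleCat.{v} R)} (hT : T.ShortExact) (n : ℕ) :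
    ExtToRing R T.X₁ n →ₗ[Rᵐᵒᵖ] ExtToRing R T.X₃ (n + 1) where
  toFun y := hT.extClass.comp y (Nat.add_comm 1 n)
  map_add' x y := Ext.comp_add _ _ _ _
  map_smul' a y := by
    rw [RingHom.id_apply, smul_ext_def, smul_ext_def, Ext.comp_assoc_of_third_deg_zero]

theorem extConn_apply {T : ShortComplex (ModuleCat.{v} R)} (hT : T.ShortExact) (n : ℕ)
    (y : ExtToRing R T.X₁ n) : extConn hT n y = hT.extClass.comp y (Nat.add_comm 1 n) := rfl

theorem extConn_surjective {T : ShortComplex (ModuleCat.{v} R)} (hT : T.ShortExact)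
    [Projective T.X₂] (n : ℕ) : Function.Surjective (extConn hT n) := fun x =>
  Ext.contravariant_sequence_exact₃ hT _ x (Ext.eq_zero_of_projective _) (Nat.add_comm 1 n)

theorem extConn_injective {T : ShortComplex (ModuleCat.{v} R)} (hT : T.ShortExact)
    [Projective T.X₂] (n : ℕ) : Function.Injective (extConn hT (n + 1)) := by
  rw [injective_iff_map_eq_zero]
  intro x hx
  obtain ⟨y, rfl⟩ := Ext.contravariant_sequence_exact₁ hT _ x (Nat.add_comm 1 (n + 1)) hx
  rw [Ext.eq_zero_of_projective y, Ext.comp_zero]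

/-- `Ext^0(M, R) = Hom(M, R)`. -/
noncomputable def homExtEquiv (M : Type v) [AddCommGroup M] [Module R M] :
    (M →ₗ[R] R) ≃ₗ[Rᵐᵒᵖ] ExtToRing R (ModuleCat.of R M) 0 where
  toFun f := Ext.mk₀ (ModuleCat.ofHom f)
  map_add' f g := by rw [ModuleCat.ofHom_add, Ext.mk₀_add]
  map_smul' a f := by
    rw [RingHom.id_apply, smul_ext_def, Ext.mk₀_comp_mk₀]
    rfl
  invFun e := (Ext.homEquiv₀ e).hom
  left_inv f :=
    congrArg ModuleCat.Hom.hom (Ext.homEquiv₀.apply_symm_apply (ModuleCat.ofHom f))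
  right_inv e := Ext.mk₀_homEquiv₀_apply e

theorem homExtEquiv_apply {M : Type v} [AddCommGroup M] [Module R M] (f : M →ₗ[R] R) :
    homExtEquiv M f = Ext.mk₀ (ModuleCat.ofHom f) := rfl

section Sequence

variable {F M : Type v} [AddCommGroup F] [Module R F] [AddCommGroup M]
  [Module R M]

/-- The short complex `K → F → M` for a submodule `K` of the kernel of `p : F → M`. -/
abbrev kerComplex (K : Submodule R F) (p : F →ₗ[R] M) (h : K = LinearMap.ker p) :
    ShortComplex (ModuleCat.{v} R) :=
  ShortComplex.mk (ModuleCat.ofHom K.subtype) (ModuleCat.ofHom p) (by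
    ext x
    have : (x : F) ∈ LinearMap.ker p := h ▸ x.2
    exact this)

theorem kerComplex_shortExact {K : Submodule R F} {p : F →ₗ[R] M} (h : K = LinearMap.ker p)
    (hp : Function.Surjective p) : (kerComplex K p h).ShortExact where
  exact := by
    rw [ShortComplex.moduleCat_exact_iff]
    intro x hx
    exact ⟨⟨x, h ▸ hx⟩, rfl⟩
  mono_f := (ModuleCat.mono_iff_injective _).2 K.injective_subtype
  epi_g := (ModuleCat.epi_iff_surjective _).2 hp

theorem mk₀_subtype_comp (K : Submodule R F) (e : F →ₗ[R] R) :
    (Ext.mk₀ (ModuleCat.ofHom K.subtype)).comp (homExtEquiv F e) (zero_add 0) =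
      homExtEquiv K (e.domRestrict K) := by
  rw [homExtEquiv_apply, homExtEquiv_apply, Ext.mk₀_comp_mk₀, ← ModuleCat.ofHom_comp]
  rfl

theorem extConn_mk₀_eq_zero_iff {K : Submodule R F} {p : F →ₗ[R] M} (h : K = LinearMap.ker p)
    (hp : Function.Surjective p) (f : K →ₗ[R] R) :
    extConn (kerComplex_shortExact h hp) 0 (homExtEquiv K f) = 0 ↔
      ∃ e : F →ₗ[R] R, e.domRestrict K = f := by
  constructor
  · intro hf
    obtain ⟨y, hy⟩ := Ext.contravariant_sequence_exact₁ (kerComplex_shortExact h hp) _ _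
      (Nat.add_comm 1 0) hf
    obtain ⟨e, rfl⟩ := (homExtEquiv F).surjective y
    refine ⟨e, (homExtEquiv K).injective ?_⟩
    rw [← hy]
    exact (mk₀_subtype_comp K e).symm
  · rintro ⟨e, rfl⟩
    rw [extConn_apply, ← mk₀_subtype_comp K e]
    exact (kerComplex_shortExact h hp).extClass_comp_assoc _

theorem GradeGE.of_equiv {N N' : Type v} [AddCommGroup N] [AddCommGroup N'] [Module R N]
    [Module R N'] (e : N ≃ₗ[R] N') {i : ℕ} (h : GradeGE R N i) : GradeGE R N' i := by
  intro j hj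
  have := h j hj
  refine ⟨fun x y => ?_⟩
  have key : ∀ x : ExtToRing R (ModuleCat.of R N') j, x =
      (Ext.mk₀ e.toModuleIso.inv).comp ((Ext.mk₀ e.toModuleIso.hom).comp x (zero_add j))
        (zero_add j) := by
    intro x
    rw [← Ext.comp_assoc_of_second_deg_zero, Ext.mk₀_comp_mk₀, Iso.inv_hom_id, Ext.mk₀_id_comp]
  rw [key x, key y]
  congr 1
  exact Subsingleton.elim _ _

/-- Long exact sequence: `Ext^j(M, R)` lies between `Ext^(j-1)(K, R)` and `Ext^j(F, R)`, both zero
for `j < i`. Only the bound in degrees below `i - 1` is used for `K`. -/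
theorem GradeGE.of_surjective {i : ℕ} {K : Submodule R F} {p : F →ₗ[R] M}
    (h : K = LinearMap.ker p) (hp : Function.Surjective p) (hK : GradeGE R K i)
    (hF : GradeGE R F i) : GradeGE R M i := by
  intro j hj
  have hT := kerComplex_shortExact h hp
  have := hF j hj
  refine subsingleton_of_forall_eq 0 fun x => ?_
  have hx : (Ext.mk₀ (kerComplex K p h).g).comp x (zero_add j) = 0 := Subsingleton.elim _ _
  cases j with
  | zero =>
    have := hT.epi_g
    exact Ext.precomp_mk₀_injective_of_epi _
      (kerComplex K p h).g (hx.trans (map_zero _).symm)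
  | succ n =>
    obtain ⟨y, rfl⟩ := Ext.contravariant_sequence_exact₃ hT _ x hx (Nat.add_comm 1 n)
    have := hK n (by omega)
    have hy : y = 0 := Subsingleton.elim _ _
    rw [hy, Ext.comp_zero]

end Sequence

end ExtRing

namespace SymbolModule

variable {Γ : Type} [AddCommGroup Γ] [LinearOrder Γ] [IsOrderedAddMonoid Γ] {A S : Type v}
  [Ring A] [Ring S] {ρ : SymbolRing Γ A S} {M Q : Type v} [AddCommGroup M] [AddCommGroup Q]
  [Module A M] [Module S Q]

theorem Generators.finite_gr [IsNoetherianRing S] {P : SymbolModule ρ M Q} (g : P.Generators)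
    [Finite g.ι] : Module.Finite S (g.F.gr g.K) := by
  have : IsNoetherian S (g.ι →₀ S) := isNoetherian_of_isNoetherianRing_of_finite S _
  infer_instance

theorem Generators.shortExact {P : SymbolModule ρ M Q} (g : P.Generators) :
    (kerComplex g.K g.π rfl).ShortExact :=
  kerComplex_shortExact rfl g.π_surjective

theorem Generators.shortExact' {P : SymbolModule ρ M Q} (g : P.Generators) :
    (kerComplex (g.F.gr g.K) g.π' g.gr_K).ShortExact :=
  kerComplex_shortExact g.gr_K g.π'_surjective

theorem projective_kerComplex {R F M : Type v} [Ring R] [AddCommGroup F] [Module R F]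
    [AddCommGroup M] [Module R M] [Module.Projective R F] (K : Submodule R F) (p : F →ₗ[R] M)
    (h : K = LinearMap.ker p) : Projective (kerComplex K p h).X₂ :=
  (IsProjective.iff_projective F).1 inferInstance

/-- Degree 0 holds because a nonzero homomorphism has a nonzero symbol. Degrees from 2 on shift to
the syzygy. In degree 1, vanishing means that homomorphisms on the syzygy extend to the free module,
a statement which `le_of_gr_le` carries from graded to filtered modules. -/
theorem subsingleton_ext [IsNoetherianRing S] {P : SymbolModule ρ M Q} (hP : P.IsFull)
    [Module.Finite S Q] (j : ℕ) (h : Subsingleton (ExtToRing S (ModuleCat.of S Q) j)) :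
    Subsingleton (ExtToRing A (ModuleCat.of A M) j) := by
  induction j generalizing M Q with
  | zero =>
    have h' := (homExtEquiv (R := S) Q).toEquiv.subsingleton
    refine (homExtEquiv (R := A) M).symm.toEquiv.subsingleton_congr.2 ?_
    refine subsingleton_of_forall_eq 0 fun f => ?_
    by_contra hf
    obtain ⟨_, f', hf', -⟩ := exists_dual_leading hP hf
    exact hf' (Subsingleton.elim _ _)
  | succ n ih =>
    obtain ⟨g, _⟩ := exists_finite_generators hP
    have := g.finite_gr
    have := projective_kerComplex g.K g.π rfl
    have := projective_kerComplex _ g.π' g.gr_K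
    cases n with
    | zero =>
      refine subsingleton_of_forall_eq 0 fun x => ?_
      obtain ⟨y, rfl⟩ := extConn_surjective g.shortExact 0 x
      obtain ⟨f, rfl⟩ := (homExtEquiv g.K).surjective y
      rw [extConn_mk₀_eq_zero_iff rfl g.π_surjective]
      let Z : Submodule Aᵐᵒᵖ (g.K →ₗ[A] A) :=
        { carrier := {f | ∃ e : (g.ι →₀ A) →ₗ[A] A, e.domRestrict g.K = f}
          zero_mem' := ⟨0, rfl⟩
          add_mem' := by rintro _ _ ⟨e, rfl⟩ ⟨e', rfl⟩; exact ⟨e + e', rfl⟩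
          smul_mem' := by rintro a _ ⟨e, rfl⟩; exact ⟨a • e, rfl⟩ }
      -- Over `S` every homomorphism on the graded syzygy extends, hence is a sum of symbols of
      -- restrictions, so `gr Z` is everything.
      have hZ : (⊤ : Submodule Aᵐᵒᵖ (g.K →ₗ[A] A)) ≤ Z := by
        refine (g.syz.dual g.syz_isFull).le_of_gr_le le_top fun f' _ => ?_
        have hf' : extConn g.shortExact' 0 (homExtEquiv _ f') = 0 := Subsingleton.elim _ _
        obtain ⟨e', rfl⟩ := (extConn_mk₀_eq_zero_iff g.gr_K g.π'_surjective f').1 hf'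
        exact domRestrict_mem_gr_dual (Z := Z) (fun e => ⟨e, rfl⟩) e'
      exact hZ (x := f) trivial
    | succ n =>
      have h1 : Subsingleton (ExtToRing S (ModuleCat.of S (g.F.gr g.K)) (n + 1)) :=
        (extConn_injective g.shortExact' n).subsingleton
      have := ih g.syz_isFull h1
      exact (extConn_surjective g.shortExact (n + 1)).subsingleton

theorem gradeGE [IsNoetherianRing S] {P : SymbolModule ρ M Q} (hP : P.IsFull)
    [Module.Finite S Q] {i : ℕ} (h : GradeGE S Q i) : GradeGE A M i :=
  fun j hj => subsingleton_ext hP j (h j hj)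

end SymbolModule

/-! ### The Auslander condition -/

/-- A ring as a right module over itself is the regular module of the opposite ring. -/
def opSelfEquiv (S : Type v) [Ring S] : S ≃ₗ[Sᵐᵒᵖ] Sᵐᵒᵖ where
  __ := MulOpposite.opAddEquiv
  map_smul' _ _ := rfl

/-- Evaluation at finitely many generators embeds the dual in a finite power of `S`. -/
theorem isNoetherian_dual {S Q : Type v} [Ring S] [AddCommGroup Q] [Module S Q]
    [Module.Finite S Q] (hS : IsNoetherianRing Sᵐᵒᵖ) : IsNoetherian Sᵐᵒᵖ (Q →ₗ[S] S) := by
  obtain ⟨n, x, hx⟩ := Module.Finite.exists_fin (R := S) (M := Q)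
  have : IsNoetherian Sᵐᵒᵖ Sᵐᵒᵖ := hS
  have : IsNoetherian Sᵐᵒᵖ S := isNoetherian_of_linearEquiv (opSelfEquiv S).symm
  let ev : (Q →ₗ[S] S) →ₗ[Sᵐᵒᵖ] (Fin n → S) :=
    { toFun := fun f i => f (x i)
      map_add' := fun _ _ => rfl
      map_smul' := fun _ _ => rfl }
  refine isNoetherian_of_injective ev fun f f' h => LinearMap.ext_on_range hx fun i => ?_
  exact congrFun h i

namespace SymbolModule

variable {Γ : Type} [AddCommGroup Γ] [LinearOrder Γ] {A S : Type v}
  [Ring A] [Ring S] {ρ : SymbolRing Γ A S} {M Q : Type v} [AddCommGroup M] [AddCommGroup Q]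
  [Module A M] [Module S Q]

theorem mem_gr_restrict (P : SymbolModule ρ M Q) {K L : Submodule A M} {L' : Submodule A K}
    (h : ∀ x ∈ L, ∃ hK : x ∈ K, ⟨x, hK⟩ ∈ L') {q : P.gr K} (hq : (q : Q) ∈ P.gr L) :
    q ∈ (P.restrict K).gr L' := by
  obtain ⟨q, hqK⟩ := q
  have : ∃ h : q ∈ P.gr K, (⟨q, h⟩ : P.gr K) ∈ (P.restrict K).gr L' := by
    refine P.gr_induction (p := fun q => ∃ h, (⟨q, h⟩ : P.gr K) ∈ (P.restrict K).gr L') ?_ ?_ hq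
    · intro α m q hm hR
      obtain ⟨hK, hL'⟩ := h m hm
      exact ⟨P.mem_gr_of_mem hK hR, (P.restrict K).mem_gr_of_mem hL' hR⟩
    · rintro x y ⟨hx, hx'⟩ ⟨hy, hy'⟩
      exact ⟨add_mem hx hy, add_mem hx' hy'⟩
  exact this.2

variable {k : Type u} [Field k] [Algebra k S] {𝒮 : Γ → Submodule k S}

theorem isModuleGrading (h𝒮 : ∀ α s, s ∈ 𝒮 α ↔ ∃ a, (a, s) ∈ ρ.R α) {P : SymbolModule ρ M Q}
    (hP : P.IsFull) : IsModuleGrading 𝒮 P.comp where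
  isInternal := hP.isInternal
  smul_mem α β s q hs hq := by
    obtain ⟨a, ha⟩ := (h𝒮 α s).1 hs
    obtain ⟨m, hm⟩ := P.mem_comp.1 hq
    exact P.mem_comp.2 ⟨_, P.smul_mem ha hm⟩

variable [IsOrderedAddMonoid Γ]

/-- The syzygy sequence over `S` is a short exact sequence of graded modules, so it is one of those
allowed in the recursive clause of `IsHomogeneousExt`. -/
theorem isHomogeneousExt_succ (h𝒮 : ∀ α s, s ∈ 𝒮 α ↔ ∃ a, (a, s) ∈ ρ.R α)
    {P : SymbolModule ρ M Q} (g : P.Generators) {δ : Γ} {n : ℕ}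
    {y : ExtToRing S (ModuleCat.of S (g.F.gr g.K)) n}
    (hy : IsHomogeneousExt 𝒮 δ n (ModuleCat.of S (g.F.gr g.K)) g.syz.comp y) :
    IsHomogeneousExt 𝒮 δ (n + 1) (ModuleCat.of S Q) P.comp (extConn g.shortExact' n y) := by
  refine ⟨_, _, g.syz.comp, g.F.comp, _, _, _, g.shortExact', y,
    isModuleGrading h𝒮 g.syz_isFull, isModuleGrading h𝒮 ρ.free_isFull, ?_, ?_, hy, rfl⟩
  · intro β q hq
    obtain ⟨m, hm⟩ := g.syz.mem_comp.1 hq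
    exact g.F.mem_comp.2 ⟨m, hm⟩
  · intro β q hq
    obtain ⟨m, hm⟩ := g.F.mem_comp.1 hq
    exact P.mem_comp.2 ⟨g.π m, g.π_mem hm⟩

/-- `Ext^(i+1)_A(M, A)` is filtered, and its associated graded module is a subquotient of
`Ext^(i+1)_S(Q, S)`: both are presented by a filtered module and its associated graded module. -/
theorem exists_ext_presentation (h𝒮 : ∀ α s, s ∈ 𝒮 α ↔ ∃ a, (a, s) ∈ ρ.R α)
    (hS : IsNoetherianRing S) (hS' : IsNoetherianRing Sᵐᵒᵖ) (i : ℕ) {P : SymbolModule ρ M Q}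
    (hP : P.IsFull) (_ : Module.Finite S Q) :
    ∃ (H H' : Type v) (_ : AddCommGroup H) (_ : AddCommGroup H') (_ : Module Aᵐᵒᵖ H)
      (_ : Module Sᵐᵒᵖ H') (D : SymbolModule ρ.op H H')
      (φ : H →ₗ[Aᵐᵒᵖ] ExtToRing A (ModuleCat.of A M) (i + 1))
      (φ' : H' →ₗ[Sᵐᵒᵖ] ExtToRing S (ModuleCat.of S Q) (i + 1)),
      IsNoetherian Sᵐᵒᵖ H' ∧ Function.Surjective φ ∧
      LinearMap.ker φ' ≤ D.gr (LinearMap.ker φ) ∧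
      ∀ δ f f', (f, f') ∈ D.R δ →
        IsHomogeneousExt 𝒮 δ (i + 1) (ModuleCat.of S Q) P.comp (φ' f') := by
  induction i generalizing M Q with
  | zero =>
    obtain ⟨g, _⟩ := exists_finite_generators hP
    have := g.finite_gr
    have := projective_kerComplex g.K g.π rfl
    have := projective_kerComplex _ g.π' g.gr_K
    have hN := isNoetherian_dual (Q := g.F.gr g.K) hS'
    refine ⟨_, _, _, _, _, _, g.syz.dual g.syz_isFull,
      extConn g.shortExact 0 ∘ₗ (homExtEquiv g.K).toLinearMap,
      extConn g.shortExact' 0 ∘ₗ (homExtEquiv (g.F.gr g.K)).toLinearMap,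
      hN, (extConn_surjective g.shortExact 0).comp (homExtEquiv g.K).surjective,
      ?_, ?_⟩
    -- A class killed by the connecting map over `S` is a restriction from the graded free module,
    -- hence a sum of symbols of restrictions over `A`, which the connecting map over `A` kills.
    · intro f' hf'
      obtain ⟨e', rfl⟩ := (extConn_mk₀_eq_zero_iff g.gr_K g.π'_surjective f').1 hf'
      refine domRestrict_mem_gr_dual (fun e => ?_) e'
      exact (extConn_mk₀_eq_zero_iff rfl g.π_surjective _).2 ⟨e, rfl⟩
    · intro δ f f' hff'
      refine isHomogeneousExt_succ h𝒮 g ⟨ModuleCat.ofHom f', fun β q hq => ?_, rfl⟩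
      obtain ⟨m, hm⟩ := g.syz.mem_comp.1 hq
      exact (h𝒮 _ _).2 ⟨f m, hff' β m q hm⟩
  | succ n ih =>
    obtain ⟨g, _⟩ := exists_finite_generators hP
    have := g.finite_gr
    have := projective_kerComplex g.K g.π rfl
    have := projective_kerComplex _ g.π' g.gr_K
    obtain ⟨H, H', _, _, _, _, D, φ, φ', hH', hφ, hker, hhom⟩ := ih g.syz_isFull g.finite_gr
    refine ⟨H, H', _, _, _, _, D, extConn g.shortExact (n + 1) ∘ₗ φ,
      extConn g.shortExact' (n + 1) ∘ₗ φ', hH', (extConn_surjective g.shortExact (n + 1)).comp hφ,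
      ?_, fun δ f f' hff' => isHomogeneousExt_succ h𝒮 g (hhom δ f f' hff')⟩
    -- In positive degrees the connecting map over `S` is injective, so the kernel of `φ'` does not
    -- change, while that of `φ` cannot shrink.
    rw [LinearMap.ker_comp_of_ker_eq_bot _
      (LinearMap.ker_eq_bot.2 (extConn_injective g.shortExact' n))]
    exact hker.trans (D.gr_mono (LinearMap.ker_le_ker_comp _ _))

/-- Put all generators in degree 0 and give `M` the quotient filtration from the free module. Finite
families serve the Auslander condition; the family of all elements serves global dimension. -/
theorem exists_of_span (ρ : SymbolRing Γ A S) {ι : Type v} {x : ι → M}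
    (hx : Submodule.span A (Set.range x) = ⊤) :
    ∃ (Q : Type v) (_ : AddCommGroup Q) (_ : Module S Q) (P : SymbolModule ρ M Q),
      P.IsFull ∧ (Finite ι → Module.Finite S Q) := by
  let F := ρ.free ι (fun _ => 0) ((Set.finite_singleton (0 : Γ)).subset
    (Set.range_subset_iff.2 fun _ => rfl)).isWF
  have hp : Function.Surjective (Finsupp.linearCombination A x) := by
    rw [← LinearMap.range_eq_top, Finsupp.range_linearCombination, hx]
  refine ⟨(ι →₀ S) ⧸ F.gr (LinearMap.ker (Finsupp.linearCombination A x)), inferInstance,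
    inferInstance, F.pushforward (Finsupp.linearCombination A x) (Submodule.mkQ _) hp
      (Submodule.ker_mkQ _), ?_, fun _ => ?_⟩
  · exact F.pushforward_isFull _ _ _ _ ρ.free_isFull (Submodule.mkQ_surjective _)
  · infer_instance

end SymbolModule

namespace SymbolRing

variable {Γ : Type} [AddCommGroup Γ] [LinearOrder Γ] [IsOrderedAddMonoid Γ] {A S : Type v}
  [Ring A] [Ring S] (ρ : SymbolRing Γ A S)
  {k : Type u} [Field k] [Algebra k S] {𝒮 : Γ → Submodule k S}

theorem isGradedExtSubmodule_map {M : ModuleCat.{v} S} {ℳ : Γ → AddSubgroup M} {i : ℕ}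
    {H H' : Type v} [AddCommGroup H] [AddCommGroup H'] [Module Aᵐᵒᵖ H] [Module Sᵐᵒᵖ H']
    (D : SymbolModule ρ.op H H') (φ' : H' →ₗ[Sᵐᵒᵖ] ExtToRing S M i)
    (hhom : ∀ δ f f', (f, f') ∈ D.R δ → IsHomogeneousExt 𝒮 δ i M ℳ (φ' f'))
    (Z : Submodule Aᵐᵒᵖ H) : IsGradedExtSubmodule 𝒮 M ℳ i ((D.gr Z).map φ') := by
  apply le_antisymm
  · rw [Submodule.map_le_iff_le_comap, SymbolModule.gr_le_iff]
    intro δ f f' hf hff'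
    exact Submodule.subset_span ⟨⟨f', D.mem_gr_of_mem hf hff', rfl⟩, δ, hhom δ f f' hff'⟩
  · exact Submodule.span_le.2 fun x hx => hx.1

/-- The preimage `N₁` of `N` in the presentation has `gr N₁ / gr (ker φ) ≅ W / V`, because the
kernel of `φ'` lies in `gr (ker φ)`. So `W / V` is the graded module of `N`, and its grade bounds
that of `N`. -/
theorem leftAuslanderCondition (h𝒮 : ∀ α s, s ∈ 𝒮 α ↔ ∃ a, (a, s) ∈ ρ.R α)
    (hS : IsTwoSidedNoetherian S) (h : GradedLeftAuslanderCondition 𝒮) :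
    LeftAuslanderCondition A := by
  intro M hM i N
  cases i with
  | zero => exact fun j hj => absurd hj (Nat.not_lt_zero j)
  | succ i =>
  obtain ⟨n, x, hx⟩ := Module.Finite.exists_fin (R := A) (M := M)
  obtain ⟨Q, _, _, P, hP, hQ⟩ := SymbolModule.exists_of_span ρ (x := fun i : ULift (Fin n) =>
    x i.down) (by rw [← hx]; congr 1; exact (ULift.down_surjective).range_comp x)
  have hQ := hQ inferInstance
  obtain ⟨H, H', _, _, _, _, D, φ, φ', hH', hφ, hker, hhom⟩ :=
    SymbolModule.exists_ext_presentation h𝒮 hS.1 hS.2 i hP hQ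
  let N₁ : Submodule Aᵐᵒᵖ H := N.comap φ
  have hkN : LinearMap.ker φ ≤ N₁ := fun y hy => by
    change φ y ∈ N
    rw [LinearMap.mem_ker.1 hy]; exact zero_mem _
  let W := (D.gr N₁).map φ'
  let V := (D.gr (LinearMap.ker φ)).map φ'
  have hVW : V ≤ W := Submodule.map_mono (D.gr_mono hkN)
  have hgrade : ∀ Z, GradeGE Sᵐᵒᵖ ((D.gr Z).map φ') (i + 1) := fun Z =>
    h (ModuleCat.of S Q) P.comp hQ (SymbolModule.isModuleGrading h𝒮 hP) (i + 1) _
      (ρ.isGradedExtSubmodule_map D φ' hhom Z)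
  -- Both `V` and `W` are images of associated graded submodules, hence graded submodules of Ext, so
  -- the graded hypothesis applies to each of them.
  have hWV : GradeGE Sᵐᵒᵖ (W ⧸ V.submoduleOf W) (i + 1) :=
    GradeGE.of_surjective (Submodule.ker_mkQ _).symm (Submodule.mkQ_surjective _)
      ((hgrade _).of_equiv (Submodule.submoduleOfEquivOfLe hVW).symm) (hgrade _)
  let p : N₁ →ₗ[Aᵐᵒᵖ] N := φ.restrict fun y hy => hy
  let p₁ : D.gr N₁ →ₗ[Sᵐᵒᵖ] W := φ'.restrict fun y hy => ⟨y, hy, rfl⟩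
  let p' : D.gr N₁ →ₗ[Sᵐᵒᵖ] W ⧸ V.submoduleOf W := (V.submoduleOf W).mkQ ∘ₗ p₁
  have hp : Function.Surjective p := by
    rintro ⟨e, he⟩
    obtain ⟨y, rfl⟩ := hφ e
    exact ⟨⟨y, he⟩, rfl⟩
  have hp' : Function.Surjective p' := by
    refine (Submodule.mkQ_surjective _).comp ?_
    rintro ⟨_, y, hy, rfl⟩
    exact ⟨⟨y, hy⟩, rfl⟩
  have hmem : ∀ y, y ∈ LinearMap.ker p' ↔ φ' y ∈ V := fun y => by
    rw [LinearMap.ker_comp, Submodule.ker_mkQ]; rfl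
  -- If `φ' y = φ' z` with `z ∈ gr (ker φ)`, then `y - z` is in the kernel of `φ'`, hence in `gr
  -- (ker φ)`, and so is `y`.
  have hkerp : LinearMap.ker p' = (D.restrict N₁).gr (LinearMap.ker p) := by
    apply le_antisymm
    · intro y hy
      obtain ⟨z, hz, hzy⟩ := (hmem y).1 hy
      have h1 : (y : H') ∈ D.gr (LinearMap.ker φ) := by
        have : (y : H') - z ∈ LinearMap.ker φ' := by
          rw [LinearMap.mem_ker, map_sub, hzy, sub_self]
        have := add_mem (hker this) hz
        rwa [sub_add_cancel] at this
      refine D.mem_gr_restrict (fun x hx => ⟨hkN hx, ?_⟩) h1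
      have h0 : p ⟨x, hkN hx⟩ = 0 := Subtype.ext hx
      exact h0
    · rw [SymbolModule.gr_le_iff]
      intro δ m q hm hR
      exact (hmem q).2 ⟨q, D.mem_gr_of_mem (congrArg Subtype.val hm) hR, rfl⟩
  have : IsNoetherianRing Sᵐᵒᵖ := hS.2
  have : Module.Finite Sᵐᵒᵖ (W ⧸ V.submoduleOf W) := Module.Finite.of_surjective p' hp'
  exact SymbolModule.gradeGE
    ((D.restrict N₁).pushforward_isFull p p' hp hkerp (D.restrict_isFull N₁) hp') hWV

end SymbolRing

/-! ### Global dimension -/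

namespace SymbolModule

variable {Γ : Type} [AddCommGroup Γ] [LinearOrder Γ] [IsOrderedAddMonoid Γ] {A S : Type v}
  [Ring A] [Ring S] {ρ : SymbolRing Γ A S} {M Q : Type v} [AddCommGroup M] [AddCommGroup Q]
  [Module A M] [Module S Q]

/-- The homogeneous part of degree zero of a homomorphism on a graded free module agrees with the
identity where the homomorphism does. -/
theorem linearCombination_component_eq {P : SymbolModule ρ M Q} {ι : Type v} {d : ι → Γ}
    {hd : (Set.range d).IsWF} {f : ι → Γ →₀ Q} (hf : ∀ i α, f i α ∈ P.comp α) {α : Γ}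
    {u : ι →₀ A} {v : ι →₀ S} (huv : (u, v) ∈ (ρ.free ι d hd).R α) {m : M} {q : Q}
    (hq : (m, q) ∈ P.R α)
    (h : Finsupp.linearCombination S (fun i => (f i).sum fun _ q => q) v = q) :
    Finsupp.linearCombination S (fun i => f i (d i)) v = q := by
  classical
  -- Since `v i` has degree `α - d i`, multiplication by it shifts components by that amount; the
  -- part of degree `α` of the sum sees exactly `f i (d i)`.
  let e : ι → Γ →₀ Q := fun i => ((f i).mapRange (fun q => v i • q) (smul_zero _)).equivMapDomain
    (Equiv.subRight (α - d i)).symm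
  have he : ∀ i β, e i β = v i • f i (β - (α - d i)) := fun _ _ => rfl
  have key : (∑ i ∈ v.support, e i) = Finsupp.single α q := by
    refine P.eq_of_sum_eq (fun β => ?_) (fun β => ?_) ?_
    · rw [← P.mem_comp, Finsupp.finsetSum_apply]
      refine sum_mem fun i _ => P.mem_comp.2 ?_
      obtain ⟨m, hm⟩ := P.mem_comp.1 (hf i (β - (α - d i)))
      have := P.smul_mem (huv i) hm
      rw [add_sub_cancel] at this
      exact ⟨_, (he i β).symm ▸ this⟩
    · rw [Finsupp.single_apply]
      split_ifs with hβ
      · exact ⟨m, hβ ▸ hq⟩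
      · exact ⟨0, zero_mem (P.R β)⟩
    · rw [Finsupp.sum_single_index rfl,
        ← Finsupp.sum_finsetSum_index (h := fun _ q => q) (fun _ => rfl) (fun _ _ _ => rfl), ← h,
        Finsupp.linearCombination_apply, Finsupp.sum]
      refine Finset.sum_congr rfl fun i _ => ?_
      simp only [e]
      rw [Finsupp.sum_equivMapDomain, Finsupp.sum_mapRange_index (fun _ => rfl), Finsupp.sum,
        Finsupp.sum, Finset.smul_sum]
  have := DFunLike.congr_fun key α
  rw [Finsupp.single_eq_same, Finsupp.finsetSum_apply] at this
  rw [← this, Finsupp.linearCombination_apply, Finsupp.sum]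
  refine Finset.sum_congr rfl fun i _ => ?_
  rw [he, sub_sub_cancel]

/-- Projectivity of `Q` is ungraded, so its splitting need not respect degrees. The
degree-preserving part of the resulting retraction onto the graded syzygy is still a retraction, and
it can be lifted to `A`. -/
theorem projective {P : SymbolModule ρ M Q} (hP : P.IsFull) [Module.Projective S Q] :
    Module.Projective A M := by
  obtain ⟨g⟩ := exists_generators hP
  obtain ⟨s', hs'⟩ := Module.projective_lifting_property g.π' LinearMap.id g.π'_surjective
  have hs' : ∀ q, g.π' (s' q) = q := LinearMap.congr_fun hs'
  let r'' : (g.ι →₀ S) →ₗ[S] g.F.gr g.K := (LinearMap.id - s' ∘ₗ g.π').codRestrict _ fun v => by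
    rw [g.gr_K, LinearMap.mem_ker]
    simp only [LinearMap.sub_apply, LinearMap.id_apply, LinearMap.comp_apply, map_sub, hs',
      sub_self]
  have hr'' : ∀ v : g.F.gr g.K, r'' v = v := by
    rintro ⟨v, hv⟩
    have hv' : g.π' v = 0 := by rwa [g.gr_K] at hv
    apply Subtype.ext
    simp [r'', hv']
  choose f hf hfr using fun i => g.syz_isFull.exists_sum (r'' (Finsupp.single i 1))
  -- Only the component of degree `g.d i` of the image of the `i`-th basis vector is lifted, so that
  -- `r` respects the filtrations.
  choose x hx using fun i => g.syz.mem_comp.1 (hf i (g.d i))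
  let r : (g.ι →₀ A) →ₗ[A] g.K := Finsupp.linearCombination A x
  -- `r` need not be a retraction, but on `g.K` it preserves symbols and is therefore invertible;
  -- composing with the inverse repairs it.
  have hr : Function.Bijective (r ∘ₗ g.K.subtype) := by
    refine g.syz.bijective_of_symbol_eq _ fun {α m q} h => ?_
    have h1 := g.syz.linearCombination_mem (hd := g.wf) hx (a := m) (s := q) h
    rw [linearCombination_component_eq (hd := g.wf) hf (u := m) (v := q) h h] at h1
    · exact h1
    · conv_rhs => rw [← hr'' q]
      simp only [hfr]
      refine LinearMap.congr_fun (f := Finsupp.linearCombination S _) ?_ (q : g.ι →₀ S)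
      ext i
      simp
  let e : g.K ≃ₗ[A] g.K := LinearEquiv.ofBijective _ hr
  -- The map `u ↦ u - e⁻¹ (r u)` kills `g.K`, so it factors through `g.π`, and the factor is a
  -- section.
  obtain ⟨s, hs⟩ := LinearMap.exists_comp_eq_of_ker_le (f := LinearMap.id - g.K.subtype ∘ₗ
    e.symm.toLinearMap ∘ₗ r) g.π_surjective (by
      intro u hu
      have : e.symm (r u) = ⟨u, hu⟩ := by
        rw [LinearEquiv.symm_apply_eq]; rfl
      rw [LinearMap.mem_ker]
      simp [this])
  refine Module.Projective.of_split s g.π ?_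
  ext m
  obtain ⟨u, rfl⟩ := g.π_surjective m
  rw [LinearMap.comp_apply, hs]
  have : g.π (e.symm (r u)) = 0 := (e.symm (r u)).2
  simp only [LinearMap.sub_apply, LinearMap.comp_apply, LinearMap.id_apply, map_sub,
    Submodule.subtype_apply, LinearEquiv.coe_coe, this, sub_zero]

/-- Syzygies over `A` and `S` correspond, so dimension shifting reduces to the projective case. -/
theorem hasProjectiveDimensionLE {P : SymbolModule ρ M Q} (hP : P.IsFull) (n : ℕ)
    (h : HasProjectiveDimensionLE (ModuleCat.of S Q) n) :
    HasProjectiveDimensionLE (ModuleCat.of A M) n := by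
  induction n generalizing M Q with
  | zero =>
    rw [← projective_iff_hasProjectiveDimensionLE_zero] at h ⊢
    have : Module.Projective S Q := (IsProjective.iff_projective Q).2 h
    exact (IsProjective.iff_projective M).1 (projective hP)
  | succ n ih =>
    obtain ⟨g⟩ := exists_generators hP
    have h1 := (g.shortExact'.hasProjectiveDimensionLT_X₃_iff n
      (projective_kerComplex _ _ _)).1 h
    exact (g.shortExact.hasProjectiveDimensionLT_X₃_iff n
      (projective_kerComplex _ _ _)).2 (ih g.syz_isFull h1)

end SymbolModule

namespace SymbolRing

variable {Γ : Type} [AddCommGroup Γ] [LinearOrder Γ] [IsOrderedAddMonoid Γ] {A S : Type v}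
  [Ring A] [Ring S] (ρ : SymbolRing Γ A S)

theorem exists_projectiveDimension_le (ρ : SymbolRing Γ A S)
    (h : ∃ d : ℕ, ∀ M : ModuleCat.{v} S, HasProjectiveDimensionLE M d) :
    ∃ d : ℕ, ∀ M : ModuleCat.{v} A, HasProjectiveDimensionLE M d := by
  obtain ⟨d, hd⟩ := h
  refine ⟨d, fun M => ?_⟩
  obtain ⟨Q, _, _, P, hP, -⟩ := SymbolModule.exists_of_span ρ (x := fun m : M => m) (by simp)
  exact SymbolModule.hasProjectiveDimensionLE hP d (hd _)

theorem hasFiniteGlobalDimension (ρ : SymbolRing Γ A S) (h : HasFiniteGlobalDimension S) :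
    HasFiniteGlobalDimension A :=
  ⟨ρ.exists_projectiveDimension_le h.1, ρ.op.exists_projectiveDimension_le h.2⟩

theorem isAuslanderRegular {k : Type u} [Field k] [Algebra k S] {𝒮 : Γ → Submodule k S}
    (h𝒮 : ∀ α s, s ∈ 𝒮 α ↔ ∃ a, (a, s) ∈ ρ.R α) (h : IsGradedAuslanderRegular 𝒮) :
    IsAuslanderRegular A := by
  obtain ⟨h1, h2, h3, h4⟩ := h
  have hop : IsTwoSidedNoetherian Sᵐᵒᵖ := by
    refine ⟨h1.2, ?_⟩
    have : IsNoetherianRing S := h1.1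
    exact isNoetherianRing_of_ringEquiv S (RingEquiv.opOp S)
  refine ⟨ρ.isTwoSidedNoetherian h1, ρ.hasFiniteGlobalDimension h2,
    ρ.leftAuslanderCondition h𝒮 h1 h3, ρ.op.leftAuslanderCondition (fun α s => ?_) hop h4⟩
  constructor
  · rintro ⟨t, ht, rfl⟩
    obtain ⟨a, ha⟩ := (h𝒮 α t).1 ht
    exact ⟨MulOpposite.op a, ha⟩
  · rintro ⟨a, ha⟩
    exact ⟨s.unop, (h𝒮 α _).2 ⟨a.unop, ha⟩, rfl⟩

end SymbolRing

theorem IsAuslanderRegular.isGradedAuslanderRegular {k : Type u} [Field k] {A : Type v} [Ring A]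
    [Algebra k A] {Γ : Type*} [AddCommGroup Γ] [DecidableEq Γ] (h : IsAuslanderRegular A)
    (𝒜 : Γ → Submodule k A) : IsGradedAuslanderRegular 𝒜 :=
  ⟨h.1, h.2.1, fun M _ hM _ i N _ => h.2.2.1 M hM i N, fun M _ hM _ i N _ => h.2.2.2 M hM i N⟩

/-! ### Extension of scalars -/

/-- Transport of a filtration along isomorphisms. -/
def SymbolRel.comap {Γ : Type} [LinearOrder Γ] {M Q M₂ Q₂ : Type v} [AddCommGroup M]
    [AddCommGroup Q] [AddCommGroup M₂] [AddCommGroup Q₂] (P : SymbolRel Γ M₂ Q₂) (e : M ≃+ M₂)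
    (e' : Q ≃+ Q₂) : SymbolRel Γ M Q where
  R α := (P.R α).comap (e.toAddMonoidHom.prodMap e'.toAddMonoidHom)
  zero_left {α q} h := by
    have h : (e 0, e' q) ∈ P.R α := h
    rw [map_zero] at h
    simpa using P.zero_left h
  mono {α β m q} hαβ h := by
    have := P.mono hαβ h
    change (e m, e' 0) ∈ P.R β
    rw [map_zero]
    exact this
  leading {m} hm := by
    obtain ⟨α, q, hq, h⟩ := P.leading (m := e m) (by simpa using hm)
    refine ⟨α, e'.symm q, by simpa using hq, ?_⟩
    change (e m, e' (e'.symm q)) ∈ P.R α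
    rwa [AddEquiv.apply_symm_apply]
  wf := P.wf.mono fun α ⟨m, q, hq, h⟩ => ⟨e m, e' q, by simpa using hq, h⟩
  indep f hf h := by
    have := P.indep (f.mapRange e' (map_zero e')) (fun α => (hf α).imp' _ fun m hm => hm) (by
      rw [Finsupp.sum_mapRange_index (fun _ => rfl)]
      simpa [Finsupp.sum] using congrArg e' h)
    ext α
    simpa using DFunLike.congr_fun this α

theorem SymbolRel.mem_comap {Γ : Type} [LinearOrder Γ] {M Q M₂ Q₂ : Type v} [AddCommGroup M]
    [AddCommGroup Q] [AddCommGroup M₂] [AddCommGroup Q₂] {P : SymbolRel Γ M₂ Q₂} {e : M ≃+ M₂}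
    {e' : Q ≃+ Q₂} {α : Γ} {m : M} {q : Q} :
    (m, q) ∈ (P.comap e e').R α ↔ (e m, e' q) ∈ P.R α := Iff.rfl

theorem SymbolRel.zero_mem {Γ : Type} [LinearOrder Γ] {M Q : Type v} [AddCommGroup M]
    [AddCommGroup Q] (P : SymbolRel Γ M Q) (α : Γ) : ((0 : M), (0 : Q)) ∈ P.R α :=
  AddSubgroup.zero_mem _

theorem SymbolRel.add_mem {Γ : Type} [LinearOrder Γ] {M Q : Type v} [AddCommGroup M]
    [AddCommGroup Q] (P : SymbolRel Γ M Q) {α : Γ} {m m' : M} {q q' : Q} (h : (m, q) ∈ P.R α)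
    (h' : (m', q') ∈ P.R α) : (m + m', q + q') ∈ P.R α :=
  AddSubgroup.add_mem _ h h'

namespace SymbolRing

variable {Γ : Type} [AddCommGroup Γ] [LinearOrder Γ] [IsOrderedAddMonoid Γ] {A S : Type v}
  [Ring A] [Ring S] (ρ : SymbolRing Γ A S) {k : Type u} [Field k] [Algebra k A] [Algebra k S]
  (B : Type u) [CommRing B] [Algebra k B]

open Classical in
/-- The filtration `F_α(A) ⊗ B` of `A ⊗ B`. -/
noncomputable def tensorRel (ρ : SymbolRing Γ A S) (k : Type u) [Field k] [Algebra k A]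
    [Algebra k S] (B : Type u) [CommRing B] [Algebra k B] :
    SymbolRel Γ (A ⊗[k] B) (S ⊗[k] B) :=
  (ρ.toSymbolRel.finsupp (Module.Basis.ofVectorSpaceIndex k B) (fun _ => (0 : Γ))
    ((Set.finite_singleton (0 : Γ)).subset (Set.range_subset_iff.2 fun _ => rfl)).isWF).comap
    (TensorProduct.equivFinsuppOfBasisRight (Module.Basis.ofVectorSpace k B)).toAddEquiv
    (TensorProduct.equivFinsuppOfBasisRight (Module.Basis.ofVectorSpace k B)).toAddEquiv

open Classical in
theorem tmul_mem_tensorRel (hk : ∀ {α a s} (c : k), (a, s) ∈ ρ.R α → (c • a, c • s) ∈ ρ.R α)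
    {α : Γ} {a : A} {s : S} (h : (a, s) ∈ ρ.R α) (b : B) :
    (a ⊗ₜ[k] b, s ⊗ₜ[k] b) ∈ (ρ.tensorRel k B).R α := by
  refine SymbolRel.mem_comap.2 fun i => ?_
  rw [sub_zero]
  change (TensorProduct.equivFinsuppOfBasisRight _ _ i,
    TensorProduct.equivFinsuppOfBasisRight _ _ i) ∈ _
  rw [TensorProduct.equivFinsuppOfBasisRight_apply_tmul_apply,
    TensorProduct.equivFinsuppOfBasisRight_apply_tmul_apply]
  exact hk _ h

open Classical in
theorem tensorRel_induction {α : Γ} {p : (A ⊗[k] B) → (S ⊗[k] B) → Prop}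
    (zero : p 0 0)
    (add : ∀ {x y x' y'}, p x y → p x' y' → p (x + x') (y + y'))
    (tmul : ∀ {a s} (b : B), (a, s) ∈ ρ.R α → p (a ⊗ₜ b) (s ⊗ₜ b)) {x : A ⊗[k] B}
    {y : S ⊗[k] B} (h : (x, y) ∈ (ρ.tensorRel k B).R α) : p x y := by
  set b := Module.Basis.ofVectorSpace k B
  set e := TensorProduct.equivFinsuppOfBasisRight (M := A) b with he
  set e' := TensorProduct.equivFinsuppOfBasisRight (M := S) b with he'
  have h : ∀ i, (e x i, e' y i) ∈ ρ.R α := fun i => by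
    have := h i
    rw [sub_zero] at this
    exact this
  -- Both tensors are expanded in the same basis of `B` and summed over the union of their supports,
  -- so that the terms can be paired.
  rw [← e.symm_apply_apply x, ← e'.symm_apply_apply y, he, he',
    TensorProduct.equivFinsuppOfBasisRight_symm_apply,
    TensorProduct.equivFinsuppOfBasisRight_symm_apply, ← he, ← he',
    Finsupp.sum_of_support_subset (e x) (Finset.subset_union_left (s₂ := (e' y).support)) _
      (by simp),
    Finsupp.sum_of_support_subset (e' y) (Finset.subset_union_right (s₁ := (e x).support)) _
      (by simp)]
  generalize (e x).support ∪ (e' y).support = T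
  induction T using Finset.induction_on with
  | empty => simpa using zero
  | insert i T hi ih =>
    rw [Finset.sum_insert hi, Finset.sum_insert hi]
    exact add (tmul _ (h i)) ih

/-- The filtered ring `A ⊗ B`, with associated graded ring `S ⊗ B`. -/
noncomputable def tensor (hk : ∀ {α a s} (c : k), (a, s) ∈ ρ.R α → (c • a, c • s) ∈ ρ.R α) :
    SymbolRing Γ (A ⊗[k] B) (S ⊗[k] B) where
  __ := ρ.tensorRel k B
  one_mem := by
    rw [Algebra.TensorProduct.one_def, Algebra.TensorProduct.one_def]
    exact ρ.tmul_mem_tensorRel B hk ρ.one_mem 1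
  mul_mem {α β x x' y y'} h h' := by
    refine ρ.tensorRel_induction B (p := fun x y => (x * x', y * y') ∈ (ρ.tensorRel k B).R (α + β))
      ?_ ?_ ?_ h
    · rw [zero_mul, zero_mul]; exact (ρ.tensorRel k B).zero_mem _
    · intro x₁ y₁ x₂ y₂ h₁ h₂
      rw [add_mul, add_mul]; exact (ρ.tensorRel k B).add_mem h₁ h₂
    · intro a s b has
      refine ρ.tensorRel_induction B
        (p := fun x y => ((a ⊗ₜ b) * x, (s ⊗ₜ b) * y) ∈ (ρ.tensorRel k B).R (α + β)) ?_ ?_ ?_ h'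
      · rw [mul_zero, mul_zero]; exact (ρ.tensorRel k B).zero_mem _
      · intro x₁ y₁ x₂ y₂ h₁ h₂
        rw [mul_add, mul_add]; exact (ρ.tensorRel k B).add_mem h₁ h₂
      · intro a' s' b' has'
        rw [Algebra.TensorProduct.tmul_mul_tmul, Algebra.TensorProduct.tmul_mul_tmul]
        exact ρ.tmul_mem_tensorRel B hk (ρ.mul_mem has has') _
  span := by
    rw [eq_top_iff]
    rintro y -
    induction y using TensorProduct.induction_on with
    | zero => exact zero_mem _
    | add x y hx hy => exact add_mem hx hy
    | tmul s b =>
      have hs : s ∈ AddSubgroup.closure {s | ∃ α a, (a, s) ∈ ρ.R α} := by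
        rw [ρ.span]; trivial
      induction hs using AddSubgroup.closure_induction with
      | mem s hs =>
        obtain ⟨α, a, ha⟩ := hs
        exact AddSubgroup.subset_closure ⟨α, _, ρ.tmul_mem_tensorRel B hk ha b⟩
      | zero => rw [TensorProduct.zero_tmul]; exact zero_mem _
      | add x y _ _ hx hy => rw [TensorProduct.add_tmul]; exact add_mem hx hy
      | neg x _ hx => rw [TensorProduct.neg_tmul]; exact neg_mem hx

theorem isStronglyNoetherian
    (hk : ∀ {α a s} (c : k), (a, s) ∈ ρ.R α → (c • a, c • s) ∈ ρ.R α)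
    (h : IsStronglyNoetherian k S) : IsStronglyNoetherian k A := fun B _ _ hB =>
  (ρ.tensor B hk).isTwoSidedNoetherian (h B hB)

end SymbolRing

/-- The common core of both parts. The grading of `A` is arbitrary, since the graded Auslander
condition only restricts which modules and submodules are tested. -/
theorem SymbolRing.transfer {Γ : Type} [AddCommGroup Γ] [LinearOrder Γ] [IsOrderedAddMonoid Γ]
    {A S : Type v} [Ring A] [Ring S] (ρ : SymbolRing Γ A S) {k : Type u} [Field k] [Algebra k A]
    [Algebra k S] {𝒮 : Γ → Submodule k S} (h𝒮 : ∀ α s, s ∈ 𝒮 α ↔ ∃ a, (a, s) ∈ ρ.R α)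
    (hk : ∀ {α a s} (c : k), (a, s) ∈ ρ.R α → (c • a, c • s) ∈ ρ.R α)
    (h₁ : IsStronglyNoetherian k S) (h₂ : IsGradedAuslanderRegular 𝒮) (𝒜 : ℤ → Submodule k A) :
    IsStronglyNoetherian k A ∧ IsAuslanderRegular A ∧ IsGradedAuslanderRegular 𝒜 :=
  have h := ρ.isAuslanderRegular h𝒮 h₂
  ⟨ρ.isStronglyNoetherian hk h₁, h, h.isGradedAuslanderRegular 𝒜⟩

/-! ### The ordered group `ℤ^r` -/

theorem DegLT.irrefl {r : ℕ} (α : Fin r → ℤ) : ¬ DegLT α α := by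
  rintro (h | ⟨-, t, -, h⟩)
  · exact lt_irrefl _ h
  · exact lt_irrefl _ h

theorem DegLE.of_le {r : ℕ} {α β : Fin r → ℤ} (h : ∀ i, α i ≤ β i) : DegLE α β := by
  by_cases he : α = β
  · exact Or.inr he
  · obtain ⟨j, hj⟩ := Function.ne_iff.1 he
    exact Or.inl (Or.inl (Finset.sum_lt_sum (fun i _ => h i)
      ⟨j, Finset.mem_univ j, lt_of_le_of_ne (h j) hj⟩))

/-- The group `ℤ^r`, to be ordered by `DegLT`. -/
def DegVec (r : ℕ) : Type := Fin r → ℤ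

instance (r : ℕ) : AddCommGroup (DegVec r) := inferInstanceAs (AddCommGroup (Fin r → ℤ))

noncomputable instance (r : ℕ) : LinearOrder (DegVec r) where
  le := DegLE
  lt := DegLT
  le_refl _ := Or.inr rfl
  le_trans _ _ _ := DegLE.trans
  lt_iff_le_not_ge α β := by
    constructor
    · intro h
      refine ⟨Or.inl h, ?_⟩
      rintro (h' | rfl)
      · exact DegLT.irrefl _ (h.trans h')
      · exact DegLT.irrefl _ h
    · rintro ⟨h | rfl, h'⟩
      · exact h
      · exact absurd (Or.inr rfl) h'
  le_antisymm α β h h' := by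
    rcases h with h | h
    · rcases h' with h' | h'
      · exact absurd (h.trans h') (DegLT.irrefl _)
      · exact h'.symm
    · exact h
  le_total := DegLE.total
  toDecidableLE := Classical.decRel _
  toDecidableEq := inferInstanceAs (DecidableEq (Fin r → ℤ))

instance (r : ℕ) : IsOrderedAddMonoid (DegVec r) where
  add_le_add_left α β h γ := by
    rcases h with h | rfl
    · exact Or.inl (h.add_right γ)
    · exact Or.inr rfl

/-- The vectors with non-negative entries are well-ordered. -/
theorem DegVec.isWF_nonneg (r : ℕ) : {α : DegVec r | ∀ i, 0 ≤ α i}.IsWF := by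
  rw [Set.isWF_iff_no_descending_seq]
  intro f hf hmem
  -- Dickson's lemma: any sequence in `ℕ^r` has two terms that increase entrywise, and entrywise
  -- comparison implies `DegLE`.
  have hpwo := Set.isPWO_of_wellQuasiOrderedLE (Set.univ : Set (Fin r → ℕ))
  obtain ⟨m, n, hmn, hle⟩ := hpwo fun n => ⟨fun i => (f n i).toNat, trivial⟩
  refine (hf hmn).not_ge (DegLE.of_le fun i => ?_)
  have h1 : (f m i).toNat ≤ (f n i).toNat := hle i
  have h2 := hmem m i
  have h3 := hmem n i
  omega

/-! ### Associated graded algebras of filtrations -/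

namespace ZrFiltration

variable {k : Type u} [Field k] {A : Type v} [Ring A] [Algebra k A] {r : ℕ}
  (𝓕 : ZrFiltration k A r)

/-- The steps below `α` form a chain, so their supremum is their union; zero is listed separately to
cover the case of no index below `α`. -/
theorem eq_zero_or_exists_of_mem_Flt {α : Fin r → ℤ} {a : A} (ha : a ∈ 𝓕.Flt α) :
    a = 0 ∨ ∃ β, DegLT β α ∧ a ∈ 𝓕.F β := by
  have mono : ∀ {β γ}, DegLE β γ → 𝓕.F β ≤ 𝓕.F γ := by
    rintro β γ (h | rfl)
    · exact 𝓕.mono h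
    · exact le_rfl
  let L : Submodule k A :=
    { carrier := {a | a = 0 ∨ ∃ β, DegLT β α ∧ a ∈ 𝓕.F β}
      zero_mem' := Or.inl rfl
      add_mem' := by
        rintro a b (rfl | ⟨β, hβ, ha⟩) (rfl | ⟨γ, hγ, hb⟩)
        · exact Or.inl (add_zero 0)
        · exact Or.inr ⟨γ, hγ, by rwa [zero_add]⟩
        · exact Or.inr ⟨β, hβ, by rwa [add_zero]⟩
        · rcases DegLE.total β γ with h | h
          · exact Or.inr ⟨γ, hγ, add_mem (mono h ha) hb⟩
          · exact Or.inr ⟨β, hβ, add_mem ha (mono h hb)⟩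
      smul_mem' := by
        rintro c a (rfl | ⟨β, hβ, ha⟩)
        · exact Or.inl (smul_zero c)
        · exact Or.inr ⟨β, hβ, Submodule.smul_mem _ c ha⟩ }
  have : 𝓕.Flt α ≤ L := iSup₂_le fun β h x hx => Or.inr ⟨β, h, hx⟩
  exact this ha

theorem mem_Flt_of_lt {α β : Fin r → ℤ} (h : DegLT α β) {a : A} (ha : a ∈ 𝓕.F α) : a ∈ 𝓕.Flt β :=
  Submodule.mem_iSup_of_mem α (Submodule.mem_iSup_of_mem h ha)

theorem cls_eq_zero_iff {α : Fin r → ℤ} {a : A} (ha : a ∈ 𝓕.F α) :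
    𝓕.cls α a ha = 0 ↔ a ∈ 𝓕.Flt α :=
  Submodule.Quotient.mk_eq_zero _

/-- The symbol of `a ∈ F_α`, as an element of the associated graded algebra. -/
noncomputable def symb (α : Fin r → ℤ) : 𝓕.F α →ₗ[k] 𝓕.Gr :=
  DirectSum.lof k (Fin r → ℤ) 𝓕.Piece α ∘ₗ ((𝓕.Flt α).submoduleOf (𝓕.F α)).mkQ

theorem symb_apply {α : Fin r → ℤ} (a : 𝓕.F α) :
    𝓕.symb α a = DirectSum.of 𝓕.Piece α (𝓕.cls α a a.2) := rfl

theorem symb_eq_lof {α : Fin r → ℤ} (a : 𝓕.F α) :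
    𝓕.symb α a = DirectSum.lof k (Fin r → ℤ) 𝓕.Piece α (𝓕.cls α a a.2) := rfl

theorem symb_eq_zero_iff {α : Fin r → ℤ} (a : 𝓕.F α) : 𝓕.symb α a = 0 ↔ (a : A) ∈ 𝓕.Flt α := by
  rw [symb_apply, ← 𝓕.cls_eq_zero_iff a.2]
  exact map_eq_zero_iff _ (DirectSum.of_injective α)

theorem symb_mul {α β : Fin r → ℤ} (a : 𝓕.F α) (b : 𝓕.F β) :
    𝓕.symb (α + β) ⟨a * b, 𝓕.mul_mem a.2 b.2⟩ = 𝓕.symb α a * 𝓕.symb β b := by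
  rw [symb_apply, symb_apply, symb_apply, DirectSum.of_mul_of]
  rfl

theorem eq_zero_of_sum_symb (f : (Fin r → ℤ) →₀ 𝓕.Gr) (hf : ∀ α, ∃ a, 𝓕.symb α a = f α)
    (h : (f.sum fun _ q => q) = 0) (α : Fin r → ℤ) : f α = 0 := by
  have key : ∀ β, DirectSum.component k _ 𝓕.Piece α (f β) =
      if β = α then DirectSum.component k _ 𝓕.Piece α (f α) else 0 := by
    intro β
    split_ifs with hβ
    · rw [hβ]
    · obtain ⟨a, ha⟩ := hf β
      rw [← ha]
      exact (DirectSum.component.of (R := k) (M := 𝓕.Piece) α β _).trans (dif_neg hβ)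
  have h1 : DirectSum.component k _ 𝓕.Piece α (f.sum fun _ q => q) = 0 := by rw [h, map_zero]
  rw [Finsupp.sum, map_sum, Finset.sum_congr rfl fun β _ => key β, Finset.sum_ite_eq'] at h1
  split_ifs at h1 with hα
  · obtain ⟨a, ha⟩ := hf α
    rw [← ha, symb_eq_lof, DirectSum.component.lof_self] at h1
    rw [← ha, symb_eq_lof, h1, map_zero]
  · exact Finsupp.notMem_support_iff.1 hα

/-- A filtration with well-ordered jumps and its associated graded algebra. -/
noncomputable def symbolRing (T : Set (DegVec r)) (hT : T.IsWF)
    (hF : ∀ (α : DegVec r) (a : A), a ∈ 𝓕.F α → a ≠ 0 → ∃ β ∈ T, β ≤ α ∧ a ∈ 𝓕.F β) :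
    SymbolRing (DegVec r) A 𝓕.Gr where
  R α := (LinearMap.range ((𝓕.F α).subtype.prod (𝓕.symb α))).toAddSubgroup
  zero_left {α s} := by
    rintro ⟨a, ha⟩
    obtain ⟨h, rfl⟩ := Prod.mk.inj ha
    have : a = 0 := Subtype.ext h
    rw [this, map_zero]
  mono {α β a s} hαβ := by
    rintro ⟨a, ha⟩
    obtain ⟨rfl, rfl⟩ := Prod.mk.inj ha
    exact ⟨⟨a, 𝓕.mono hαβ a.2⟩, Prod.ext rfl
      ((𝓕.symb_eq_zero_iff _).2 (𝓕.mem_Flt_of_lt hαβ a.2))⟩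
  leading {a} ha := by
    obtain ⟨α, hα⟩ := 𝓕.exhaustive a
    obtain ⟨β, hβT, -, hβ⟩ := hF α a hα ha
    have hwf : {β | β ∈ T ∧ a ∈ 𝓕.F β}.IsWF := hT.mono fun _ h => h.1
    have hne : {β | β ∈ T ∧ a ∈ 𝓕.F β}.Nonempty := ⟨β, hβT, hβ⟩
    -- The leading degree is the least element of `T` whose step contains `a`. A zero symbol would
    -- put `a` in a lower step, hence by `hF` in the step of a smaller element of `T`.
    refine ⟨hwf.min hne, 𝓕.symb _ ⟨a, (hwf.min_mem hne).2⟩, ?_, ⟨⟨a, (hwf.min_mem hne).2⟩, rfl⟩⟩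
    intro h
    rcases 𝓕.eq_zero_or_exists_of_mem_Flt ((𝓕.symb_eq_zero_iff _).1 h) with h | ⟨γ, hγ, h⟩
    · exact ha h
    · obtain ⟨δ, hδT, hδγ, hδ⟩ := hF γ a h ha
      exact hwf.not_lt_min hne ⟨hδT, hδ⟩ (lt_of_le_of_lt (α := DegVec r) hδγ hγ)
  wf := hT.mono fun α => by
    rintro ⟨_, _, hs, a, he⟩
    obtain ⟨rfl, rfl⟩ := Prod.mk.inj he
    have ha : (a : A) ≠ 0 := fun h => hs (by
      have : a = 0 := Subtype.ext h
      rw [this]; exact map_zero (𝓕.symb α))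
    -- Outside `T` the filtration does not jump, so there the symbol would vanish.
    obtain ⟨β, hβT, hβ, h⟩ := hF α a a.2 ha
    rcases hβ.eq_or_lt with rfl | hlt
    · exact hβT
    · exact absurd ((𝓕.symb_eq_zero_iff a).2 (𝓕.mem_Flt_of_lt hlt h)) hs
  indep f hf h := by
    refine Finsupp.ext (𝓕.eq_zero_of_sum_symb f (fun α => ?_) h)
    obtain ⟨a, b, hb⟩ := hf α
    exact ⟨b, (Prod.mk.inj hb).2⟩
  one_mem := ⟨⟨1, 𝓕.one_mem⟩, rfl⟩
  mul_mem {α β a b s t} := by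
    rintro ⟨a, ha⟩ ⟨b, hb⟩
    obtain ⟨rfl, rfl⟩ := Prod.mk.inj ha
    obtain ⟨rfl, rfl⟩ := Prod.mk.inj hb
    refine ⟨⟨a * b, 𝓕.mul_mem a.2 b.2⟩, Prod.ext rfl ?_⟩
    exact 𝓕.symb_mul a b
  span := by
    rw [eq_top_iff]
    rintro s -
    induction s using DirectSum.induction_on with
    | zero => exact zero_mem _
    | add x y hx hy => exact add_mem hx hy
    | of α x =>
      obtain ⟨a, ha, rfl⟩ := 𝓕.cls_surj x
      exact AddSubgroup.subset_closure ⟨α, a, ⟨a, ha⟩, rfl⟩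

theorem mem_grGrading_iff {T : Set (DegVec r)} {hT : T.IsWF}
    {hF : ∀ (α : DegVec r) (a : A), a ∈ 𝓕.F α → a ≠ 0 → ∃ β ∈ T, β ≤ α ∧ a ∈ 𝓕.F β}
    (α : DegVec r) (s : 𝓕.Gr) :
    s ∈ 𝓕.grGrading α ↔ ∃ a, (a, s) ∈ (𝓕.symbolRing T hT hF).R α := by
  constructor
  · rintro ⟨x, rfl⟩
    obtain ⟨a, ha, rfl⟩ := 𝓕.cls_surj x
    exact ⟨a, ⟨a, ha⟩, rfl⟩
  · rintro ⟨a, b, hb⟩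
    exact ⟨_, (Prod.mk.inj hb).2⟩

end ZrFiltration

/-! ### Components of polynomials -/

section FreeAlgebra

variable {k : Type u} [Field k] {X : Type v}

theorem mem_wordSpan {P : FreeMonoid X → Prop} {f : FreeAlg k X} :
    f ∈ wordSpan k P ↔ ∀ w, f.coeff w ≠ 0 → P w := by
  have : wordSpan k P = MonoidAlgebra.supported k k {w | P w} := by
    rw [MonoidAlgebra.supported_eq_span_single, wordSpan]
    congr 1
    ext f
    exact ⟨fun ⟨w, hw, h⟩ => ⟨w, hw, h.symm⟩, fun ⟨w, hw, h⟩ => ⟨w, hw, h.symm⟩⟩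
  rw [this, MonoidAlgebra.mem_supported']
  exact forall_congr' fun w => not_imp_comm

theorem proj_eq_zero_iff {I : TwoSidedIdeal (FreeAlg k X)} {f : FreeAlg k X} :
    proj I f = 0 ↔ f ∈ I := by
  rw [TwoSidedIdeal.mem_iff]
  exact RingCon.eq I.ringCon (a := f) (b := 0)

theorem proj_surjective (I : TwoSidedIdeal (FreeAlg k X)) : Function.Surjective (proj I) :=
  RingCon.mkₐ_surjective I.ringCon

variable {r : ℕ} (p : X → Fin r)

theorem multideg_nonneg (w : FreeMonoid X) (i : Fin r) : 0 ≤ multideg p w i := by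
  rw [multideg]
  induction w.toList with
  | nil => simp
  | cons x l ih =>
    rw [List.map_cons, List.sum_cons, Pi.add_apply]
    refine add_nonneg ?_ ih
    rw [Pi.single_apply]
    split_ifs <;> simp

/-- A nonzero polynomial has a word of largest `ℤ^r`-degree. -/
theorem exists_max_multideg {f : FreeAlg k X} (hf : f ≠ 0) :
    ∃ w, f.coeff w ≠ 0 ∧ f ∈ wordSpan k fun v => DegLE (multideg p v) (multideg p w) := by
  have hne : f.coeff.support.Nonempty := by
    rw [Finsupp.support_nonempty_iff]
    exact fun h => hf (MonoidAlgebra.coeff_eq_zero.1 h)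
  obtain ⟨w, hw, hmax⟩ := Finset.exists_max_image (α := DegVec r) f.coeff.support
    (fun v => multideg p v) hne
  exact ⟨w, Finsupp.mem_support_iff.1 hw,
    mem_wordSpan.2 fun v hv => hmax v (Finsupp.mem_support_iff.2 hv)⟩

/-- The witness is the largest multidegree occurring in a polynomial representing `a`. -/
theorem exists_partitionFiltration_mem (I : TwoSidedIdeal (FreeAlg k X)) (α : DegVec r)
    (a : QuotAlg I) (ha : a ∈ (partitionFiltration p I).F α) (h0 : a ≠ 0) :
    ∃ β ∈ {α : DegVec r | ∀ i, 0 ≤ α i}, β ≤ α ∧ a ∈ (partitionFiltration p I).F β := by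
  obtain ⟨f, hf, rfl⟩ := ha
  obtain ⟨w, hw, hfw⟩ := exists_max_multideg p (f := f) (by rintro rfl; exact h0 (map_zero _))
  exact ⟨multideg p w, multideg_nonneg p w, mem_wordSpan.1 hf w hw, f, hfw, rfl⟩

open Classical in
/-- The component of `ℤ^r`-degree `β` of a polynomial. -/
noncomputable def degComp (β : Fin r → ℤ) : FreeAlg k X →ₗ[k] FreeAlg k X where
  toFun f := MonoidAlgebra.ofCoeff (f.coeff.filter fun w => multideg p w = β)
  map_add' f g := by
    rw [MonoidAlgebra.coeff_add, Finsupp.filter_add, MonoidAlgebra.ofCoeff_add]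
  map_smul' c f := by
    rw [MonoidAlgebra.coeff_smul, Finsupp.filter_smul, MonoidAlgebra.ofCoeff_smul, RingHom.id_apply]

open Classical in
theorem coeff_degComp (β : Fin r → ℤ) (f : FreeAlg k X) (w : FreeMonoid X) :
    (degComp p β f).coeff w = if multideg p w = β then f.coeff w else 0 :=
  Finsupp.filter_apply _ _ _

theorem degComp_eq_self {β : Fin r → ℤ} {f : FreeAlg k X}
    (h : ∀ w, f.coeff w ≠ 0 → multideg p w = β) : degComp p β f = f := by
  ext w
  rw [coeff_degComp]
  split_ifs with hw
  · rfl
  · by_contra h'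
    exact hw (h w (Ne.symm h'))

theorem degComp_eq_zero {β : Fin r → ℤ} {f : FreeAlg k X}
    (h : ∀ w, f.coeff w ≠ 0 → multideg p w ≠ β) : degComp p β f = 0 := by
  ext w
  rw [coeff_degComp]
  split_ifs with hw
  · by_contra h'
    exact h w h' hw
  · rfl

theorem multideg_of_coeff_degComp_ne_zero {β : Fin r → ℤ} {f : FreeAlg k X} {w : FreeMonoid X}
    (h : (degComp p β f).coeff w ≠ 0) : multideg p w = β := by
  rw [coeff_degComp] at h
  by_contra hw
  exact h (if_neg hw)

theorem degComp_degComp (β γ : Fin r → ℤ) (f : FreeAlg k X) :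
    degComp p γ (degComp p β f) = if β = γ then degComp p β f else 0 := by
  split_ifs with h
  · exact degComp_eq_self p fun w hw => h ▸ multideg_of_coeff_degComp_ne_zero p hw
  · exact degComp_eq_zero p fun w hw hw' =>
      h ((multideg_of_coeff_degComp_ne_zero p hw).symm.trans hw')

theorem degComp_mem_wordSpan (β : Fin r → ℤ) (f : FreeAlg k X) :
    degComp p β f ∈ wordSpan k fun w => multideg p w = β :=
  mem_wordSpan.2 fun _ => multideg_of_coeff_degComp_ne_zero p

theorem degComp_single (β : Fin r → ℤ) (w : FreeMonoid X) (c : k) :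
    degComp p β (MonoidAlgebra.single w c) =
      if multideg p w = β then MonoidAlgebra.single w c else 0 := by
  classical
  split_ifs with h
  · refine degComp_eq_self p fun v hv => ?_
    rw [MonoidAlgebra.coeff_single, Finsupp.single_apply] at hv
    by_cases hvw : w = v
    · rw [← hvw, h]
    · exact absurd (if_neg hvw) hv
  · refine degComp_eq_zero p fun v hv => ?_
    rw [MonoidAlgebra.coeff_single, Finsupp.single_apply] at hv
    by_cases hvw : w = v
    · rwa [← hvw]
    · exact absurd (if_neg hvw) hv

theorem degComp_single_mul (β : Fin r → ℤ) (w : FreeMonoid X) (c : k) (f : FreeAlg k X) :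
    degComp p (multideg p w + β) (MonoidAlgebra.single w c * f) =
      MonoidAlgebra.single w c * degComp p β f := by
  induction f using MonoidAlgebra.induction_linear with
  | zero => simp
  | add f g hf hg => rw [mul_add, map_add, map_add, mul_add, hf, hg]
  | single v d =>
    rw [MonoidAlgebra.single_mul_single, degComp_single, degComp_single, multideg_mul]
    simp only [add_right_inj]
    split_ifs
    · rw [MonoidAlgebra.single_mul_single]
    · rw [mul_zero]

theorem degComp_mul_single (β : Fin r → ℤ) (w : FreeMonoid X) (c : k) (f : FreeAlg k X) :
    degComp p (β + multideg p w) (f * MonoidAlgebra.single w c) =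
      degComp p β f * MonoidAlgebra.single w c := by
  induction f using MonoidAlgebra.induction_linear with
  | zero => simp
  | add f g hf hg => rw [add_mul, map_add, map_add, add_mul, hf, hg]
  | single v d =>
    rw [MonoidAlgebra.single_mul_single, degComp_single, degComp_single, multideg_mul]
    simp only [add_left_inj]
    split_ifs
    · rw [MonoidAlgebra.single_mul_single]
    · rw [zero_mul]

theorem single_mem_wordSpan {P : FreeMonoid X → Prop} {w : FreeMonoid X} (hw : P w) (c : k) :
    MonoidAlgebra.single w c ∈ wordSpan k P := by
  rw [← MonoidAlgebra.smul_of]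
  exact Submodule.smul_mem _ _ (Submodule.subset_span ⟨w, hw, rfl⟩)

/-- A product of two words reaches degree `α + β` only if each factor attains its bound, as the
order is strictly compatible with addition. -/
theorem degComp_mul {α β : Fin r → ℤ} {f g : FreeAlg k X}
    (hf : f ∈ wordSpan k fun w => DegLE (multideg p w) α)
    (hg : g ∈ wordSpan k fun w => DegLE (multideg p w) β) :
    degComp p (α + β) (f * g) = degComp p α f * degComp p β g := by
  rw [wordSpan] at hf
  induction hf using Submodule.span_induction with
  | zero => simp
  | add x y _ _ hx hy => rw [add_mul, map_add, map_add, add_mul, hx, hy]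
  | smul c x _ hx => rw [smul_mul_assoc, map_smul, map_smul, smul_mul_assoc, hx]
  | mem x hx =>
    obtain ⟨w, hw, rfl⟩ := hx
    rw [MonoidAlgebra.of_apply]
    rcases hw with hw | rfl
    · have h1 : degComp p α (MonoidAlgebra.single w (1 : k)) = 0 := by
        rw [degComp_single, if_neg]
        rintro rfl
        exact DegLT.irrefl _ hw
      have h2 : α + β = multideg p w + (-multideg p w + (α + β)) := by abel
      rw [h1, zero_mul, h2, degComp_single_mul]
      refine mul_eq_zero_of_right _ (degComp_eq_zero p fun v hv h => ?_)
      have h3 := mem_wordSpan.1 hg v hv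
      rw [h] at h3
      have h4 := DegLE.add (Or.inl hw) h3
      have h5 : DegLT (multideg p w + β) (α + β) := hw.add_right β
      rcases h3 with h3 | h3
      · have := (h3.add_left (multideg p w)).trans h5
        rw [← h2] at this
        exact DegLT.irrefl _ this
      · rw [h3.symm, ← h2, h3] at h5
        exact DegLT.irrefl _ h5
    · rw [degComp_single_mul, degComp_single, if_pos rfl]

end FreeAlgebra

/-! ### Gröbner bases and leading forms -/

section Groebner

variable {k : Type u} [Field k] {X : Type v} {r : ℕ} (p : X → Fin r)
  {lt : FreeMonoid X → FreeMonoid X → Prop} {I : TwoSidedIdeal (FreeAlg k X)}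
  {𝒢 : Set (FreeAlg k X)}

theorem single_mul_mem_wordSpan {P R : FreeMonoid X → Prop} {s : FreeMonoid X}
    (h : ∀ w, P w → R (s * w)) (c : k) {f : FreeAlg k X} (hf : f ∈ wordSpan k P) :
    MonoidAlgebra.single s c * f ∈ wordSpan k R := by
  have hs := single_mem_wordSpan (P := fun v => v = s) rfl c
  refine wordSpan_mul_mem (fun w w' hw hw' => ?_) hs hf
  rw [hw]
  exact h w' hw'

theorem mul_single_mem_wordSpan {P R : FreeMonoid X → Prop} {s : FreeMonoid X}
    (h : ∀ w, P w → R (w * s)) (c : k) {f : FreeAlg k X} (hf : f ∈ wordSpan k P) :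
    f * MonoidAlgebra.single s c ∈ wordSpan k R := by
  have hs := single_mem_wordSpan (P := fun v => v = s) rfl c
  refine wordSpan_mul_mem (fun w w' hw hw' => ?_) hf hs
  rw [hw']
  exact h w hw

theorem degComp_self (β : Fin r → ℤ) (f : FreeAlg k X) :
    degComp p β (degComp p β f) = degComp p β f :=
  (degComp_degComp p β β f).trans (if_pos rfl)

theorem degComp_sum_degComp {s : Finset (Fin r → ℤ)} (e : (Fin r → ℤ) → FreeAlg k X)
    {α : Fin r → ℤ} (hα : α ∈ s) :
    degComp p α (∑ β ∈ s, degComp p β (e β)) = degComp p α (e α) := by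
  rw [map_sum, Finset.sum_eq_single_of_mem α hα, degComp_self]
  intro β _ hβ
  rw [degComp_degComp, if_neg hβ]

theorem DegVec.wellFounded_multideg :
    WellFounded fun u v : FreeMonoid X => DegLT (multideg p u) (multideg p v) := by
  have h : WellFounded fun a b : {α : DegVec r | ∀ i, 0 ≤ α i} => a < b := by
    have := DegVec.isWF_nonneg r
    exact this
  exact InvImage.wf (fun u : FreeMonoid X => (⟨multideg p u, multideg_nonneg p u⟩ :
    {α : DegVec r | ∀ i, 0 ≤ α i})) h

/-- Lexicographic induction: first on the multidegree, then on `lt` among words of equal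
multidegree. -/
theorem IsMonomialOrder.wellFounded_refined (h : IsMonomialOrder lt) :
    WellFounded (RefinedLT p lt) := by
  have := h.wellOrder
  constructor
  intro w
  induction w using (DegVec.wellFounded_multideg p).induction with
  | h w ih =>
  have key : ∀ v, multideg p v = multideg p w → Acc (RefinedLT p lt) v := by
    intro v
    induction v using (IsWellFounded.wf (r := lt)).induction with
    | h v ihv =>
    intro hv
    constructor
    rintro u (hu | ⟨hu, hlt⟩)
    · exact ih u (hv ▸ hu)
    · exact ihv u hlt (hu.trans hv)
  exact key w rfl

theorem IsMonomialOrder.refined_trichotomous (h : IsMonomialOrder lt) (u v : FreeMonoid X) :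
    RefinedLT p lt u v ∨ u = v ∨ RefinedLT p lt v u := by
  have := h.wellOrder
  rcases DegLE.total (multideg p u) (multideg p v) with h1 | h1 <;> rcases h1 with h1 | h1
  · exact Or.inl (Or.inl h1)
  · rcases trichotomous_of lt u v with h2 | h2 | h2
    · exact Or.inl (Or.inr ⟨h1, h2⟩)
    · exact Or.inr (Or.inl h2)
    · exact Or.inr (Or.inr (Or.inr ⟨h1.symm, h2⟩))
  · exact Or.inr (Or.inr (Or.inl h1))
  · rcases trichotomous_of lt u v with h2 | h2 | h2
    · exact Or.inl (Or.inr ⟨h1.symm, h2⟩)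
    · exact Or.inr (Or.inl h2)
    · exact Or.inr (Or.inr (Or.inr ⟨h1, h2⟩))

theorem IsMonomialOrder.refined_trans (h : IsMonomialOrder lt) {u v w : FreeMonoid X}
    (h1 : RefinedLT p lt u v) (h2 : RefinedLT p lt v w) : RefinedLT p lt u w := by
  have := h.wellOrder
  rcases h1 with h1 | ⟨h1, h1'⟩ <;> rcases h2 with h2 | ⟨h2, h2'⟩
  · exact Or.inl (h1.trans h2)
  · exact Or.inl (h2 ▸ h1)
  · exact Or.inl (h1 ▸ h2)
  · exact Or.inr ⟨h1.trans h2, _root_.trans h1' h2'⟩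

theorem RefinedLT.degLE {u v : FreeMonoid X} (h : RefinedLT p lt u v) :
    DegLE (multideg p u) (multideg p v) :=
  h.imp id fun h => h.1

theorem IsMonomialOrder.refined_mul_mul (h : IsMonomialOrder lt) {u v : FreeMonoid X}
    (huv : RefinedLT p lt u v) (s t : FreeMonoid X) :
    RefinedLT p lt (s * u * t) (s * v * t) := by
  simp only [RefinedLT, multideg_mul]
  rcases huv with h1 | ⟨h1, h1'⟩
  · exact Or.inl ((h1.add_left _).add_right _)
  · exact Or.inr ⟨by rw [h1], h.mul_mul u v s t h1'⟩

theorem IsMonomialOrder.exists_leadingMonomial (h : IsMonomialOrder lt) {f : FreeAlg k X}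
    (hf : f ≠ 0) : ∃ w, IsLeadingMonomial (RefinedLT p lt) f w := by
  have hne : f.coeff.support.Nonempty := by
    rw [Finsupp.support_nonempty_iff]
    exact fun h => hf (MonoidAlgebra.coeff_eq_zero.1 h)
  have key : ∀ s : Finset (FreeMonoid X), s.Nonempty →
      ∃ w ∈ s, ∀ u ∈ s, u ≠ w → RefinedLT p lt u w := by
    classical
    intro s hs
    induction hs using Finset.Nonempty.cons_induction with
    | singleton a => exact ⟨a, Finset.mem_singleton_self a, fun u hu hne =>
        absurd (Finset.mem_singleton.1 hu) hne⟩
    | cons a s ha hs ih =>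
      obtain ⟨w, hw, hmax⟩ := ih
      rcases h.refined_trichotomous p a w with haw | rfl | haw
      · refine ⟨w, Finset.mem_cons_of_mem hw, fun u hu hne => ?_⟩
        rcases Finset.mem_cons.1 hu with rfl | hu
        · exact haw
        · exact hmax u hu hne
      · exact absurd hw ha
      · refine ⟨a, Finset.mem_cons_self a s, fun u hu hne => ?_⟩
        rcases Finset.mem_cons.1 hu with rfl | hu
        · exact absurd rfl hne
        · by_cases huw : u = w
          · rwa [huw]
          · exact h.refined_trans p (hmax u hu huw) haw
  exact key _ hne

theorem IsMonomialOrder.leadingMonomial_unique (h : IsMonomialOrder lt) {f : FreeAlg k X}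
    {u w : FreeMonoid X} (hu : IsLeadingMonomial (RefinedLT p lt) f u)
    (hw : IsLeadingMonomial (RefinedLT p lt) f w) : u = w := by
  by_contra hne
  exact (h.wellFounded_refined p).asymmetric _ _ (hw.2 u hu.1 hne) (hu.2 w hw.1 (Ne.symm hne))

variable {p} in
theorem IsLeadingMonomial.mem_wordSpan {f : FreeAlg k X} {w : FreeMonoid X}
    (h : IsLeadingMonomial (RefinedLT p lt) f w) :
    f ∈ wordSpan k fun v => DegLE (multideg p v) (multideg p w) := by
  refine _root_.mem_wordSpan.2 fun v hv => ?_
  by_cases hvw : v = w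
  · exact Or.inr (by rw [hvw])
  · exact (h.2 v (Finsupp.mem_support_iff.2 hv) hvw).degLE

variable {p} in
theorem IsLeadingMonomial.leadingForm_eq {f : FreeAlg k X} {w : FreeMonoid X}
    (h : IsLeadingMonomial (RefinedLT p lt) f w) :
    leadingForm p f = degComp p (multideg p w) f := by
  classical
  have hle := _root_.mem_wordSpan.1 h.mem_wordSpan
  ext v
  rw [coeff_degComp, leadingForm, MonoidAlgebra.coeff_ofCoeff, Finsupp.filter_apply]
  by_cases hv : f.coeff v = 0
  · rw [hv, ite_self, ite_self]
  · have : (∀ u ∈ f.coeff.support, DegLE (multideg p u) (multideg p v)) ↔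
        multideg p v = multideg p w := by
      constructor
      · intro h'
        rcases hle v hv with h1 | h1
        · rcases h' w h.1 with h2 | h2
          · exact absurd (h1.trans h2) (DegLT.irrefl _)
          · exact h2.symm
        · exact h1
      · intro h' u hu
        rw [h']
        exact hle u (Finsupp.mem_support_iff.1 hu)
    simp only [this]

/-- Division algorithm: cancel the leading monomial of `f` with a multiple of some `g ∈ 𝒢` and
induct on the leading monomial. The order compares multidegrees first, so the multidegree bound `β`
survives each step. -/
theorem degComp_mem_leadingFormIdeal (hlt : IsMonomialOrder lt)
    (h𝒢 : IsReducedGroebnerBasis (RefinedLT p lt) I 𝒢) {f : FreeAlg k X} (hf : f ∈ I)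
    {β : Fin r → ℤ} (hβ : f ∈ wordSpan k fun w => DegLE (multideg p w) β) :
    degComp p β f ∈ leadingFormIdeal p 𝒢 := by
  have key : ∀ w, ∀ f ∈ I, IsLeadingMonomial (RefinedLT p lt) f w →
      f ∈ wordSpan k (fun w => DegLE (multideg p w) β) →
      degComp p β f ∈ leadingFormIdeal p 𝒢 := by
    intro w
    induction w using (hlt.wellFounded_refined p).induction with
    | h w ih =>
    intro f hf hw hβ
    obtain ⟨g, hg, u, hu, s, t, rfl⟩ := h𝒢.groebner f hf w hw
    obtain ⟨u', hu', hu1⟩ := h𝒢.monic g hg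
    rw [← hlt.leadingMonomial_unique p hu hu'] at hu1
    set c := f.coeff (s * u * t)
    -- Since `g` is monic at `u`, this multiple has the same leading term as `f`.
    set e := MonoidAlgebra.single s c * g * MonoidAlgebra.single t 1 with he
    have heI : e ∈ I := I.mul_mem_right _ _ (I.mul_mem_left _ _ (h𝒢.subset g hg))
    have hesupp : ∀ v, e.coeff v ≠ 0 → v = s * u * t ∨ RefinedLT p lt v (s * u * t) := by
      have : e ∈ wordSpan k fun v => v = s * u * t ∨ RefinedLT p lt v (s * u * t) := by
        have hg' : g ∈ wordSpan k fun v => v = u ∨ RefinedLT p lt v u :=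
          mem_wordSpan.2 fun v hv => or_iff_not_imp_left.2
            fun hvu => hu.2 v (Finsupp.mem_support_iff.2 hv) hvu
        have hsg := single_mul_mem_wordSpan (R := fun v => v * t = s * u * t ∨
          RefinedLT p lt (v * t) (s * u * t)) (s := s) (fun v hv => ?_) c hg'
        · exact mul_single_mem_wordSpan (fun v hv => hv) 1 hsg
        · rcases hv with rfl | hv
          · exact Or.inl rfl
          · exact Or.inr (hlt.refined_mul_mul p hv s t)
      exact mem_wordSpan.1 this
    have hecoeff : e.coeff (s * u * t) = c := by
      rw [he, MonoidAlgebra.coeff_mul_single_mul, MonoidAlgebra.coeff_single_mul_mul, hu1, mul_one,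
        mul_one]
    have hwβ : DegLE (multideg p (s * u * t)) β :=
      mem_wordSpan.1 hβ _ (Finsupp.mem_support_iff.1 hw.1)
    have hdiff : ∀ v, (f - e).coeff v ≠ 0 → RefinedLT p lt v (s * u * t) := by
      intro v hv
      rw [MonoidAlgebra.coeff_sub, Finsupp.sub_apply] at hv
      by_cases hvw : v = s * u * t
      · exact absurd (by rw [hvw, hecoeff, sub_self]) hv
      · by_cases hfv : f.coeff v = 0
        · rw [hfv, zero_sub, neg_ne_zero] at hv
          exact (hesupp v hv).resolve_left hvw
        · exact hw.2 v (Finsupp.mem_support_iff.2 hfv) hvw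
    have h1 : degComp p β (f - e) ∈ leadingFormIdeal p 𝒢 := by
      by_cases h0 : f - e = 0
      · rw [h0, map_zero]; exact TwoSidedIdeal.zero_mem _
      · obtain ⟨w', hw'⟩ := hlt.exists_leadingMonomial p h0
        exact ih w' (hdiff w' (Finsupp.mem_support_iff.1 hw'.1)) _ (I.sub_mem hf heI) hw'
          (mem_wordSpan.2 fun v hv => ((hdiff v hv).degLE p).trans hwβ)
    have h2 : degComp p β e ∈ leadingFormIdeal p 𝒢 := by
      obtain ⟨γ, rfl⟩ : ∃ γ, β = multideg p s + γ + multideg p t :=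
        ⟨β - multideg p s - multideg p t, by abel⟩
      rw [he, degComp_mul_single, degComp_single_mul]
      refine TwoSidedIdeal.mul_mem_right _ _ _ (TwoSidedIdeal.mul_mem_left _ _ _ ?_)
      -- The component of `g` in degree `γ` is its leading form when `γ` is its top degree;
      -- otherwise `γ` exceeds the degrees of all its words, because `s * u * t` has degree at most
      -- `β`.
      by_cases hγ : multideg p u = γ
      · rw [← hγ, ← hu.leadingForm_eq]
        exact TwoSidedIdeal.subset_span ⟨g, hg, rfl⟩
      · rw [degComp_eq_zero]
        · exact TwoSidedIdeal.zero_mem _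
        · intro v hv hvγ
          rw [multideg_mul, multideg_mul] at hwβ
          have h3 := mem_wordSpan.1 hu.mem_wordSpan v hv
          rw [hvγ] at h3
          rcases h3 with h3 | h3
          · have h4 := (h3.add_left (multideg p s)).add_right (multideg p t)
            rcases hwβ with h5 | h5
            · exact DegLT.irrefl _ (h4.trans h5)
            · rw [h5] at h4; exact DegLT.irrefl _ h4
          · exact hγ h3.symm
    have := TwoSidedIdeal.add_mem _ h1 h2
    rwa [← map_add, sub_add_cancel] at this
  by_cases h0 : f = 0
  · rw [h0, map_zero]; exact TwoSidedIdeal.zero_mem _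
  · obtain ⟨w, hw⟩ := hlt.exists_leadingMonomial p h0
    exact key w f hf hw hβ

/-- Converse to `degComp_mem_leadingFormIdeal`: each component of an element of the ideal is the top
component of an element of `I`. A generator is realized by `g` itself in its top degree and by zero
in the others. -/
theorem exists_mem_of_mem_leadingFormIdeal (h𝒢 : IsReducedGroebnerBasis (RefinedLT p lt) I 𝒢)
    {j : FreeAlg k X} (hj : j ∈ leadingFormIdeal p 𝒢) (β : Fin r → ℤ) :
    ∃ h ∈ I, h ∈ wordSpan k (fun w => DegLE (multideg p w) β) ∧ degComp p β h = degComp p β j := by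
  rw [leadingFormIdeal] at hj
  -- The degree must vary: multiplication by a word `w` reduces the claim at `β` to the claim at `β
  -- - multideg p w`, which may have negative entries.
  induction hj using TwoSidedIdeal.span_induction generalizing β with
  | zero => exact ⟨0, I.zero_mem, zero_mem _, rfl⟩
  | mem x hx =>
    obtain ⟨g, hg, rfl⟩ := hx
    obtain ⟨u, hu, -⟩ := h𝒢.monic g hg
    rw [hu.leadingForm_eq, degComp_degComp]
    split_ifs with h
    · exact ⟨g, h𝒢.subset g hg, h ▸ hu.mem_wordSpan, by rw [h]⟩
    · exact ⟨0, I.zero_mem, zero_mem _, map_zero _⟩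
  | add x y _ _ hx hy =>
    obtain ⟨h, hI, hβ, he⟩ := hx β
    obtain ⟨h', hI', hβ', he'⟩ := hy β
    exact ⟨h + h', I.add_mem hI hI', add_mem hβ hβ', by rw [map_add, map_add, he, he']⟩
  | neg x _ hx =>
    obtain ⟨h, hI, hβ, he⟩ := hx β
    exact ⟨-h, I.neg_mem hI, neg_mem hβ, by rw [map_neg, map_neg, he]⟩
  | left_absorb a x _ hx =>
    induction a using MonoidAlgebra.induction_linear generalizing β with
    | zero => exact ⟨0, I.zero_mem, zero_mem _, by rw [zero_mul]⟩
    | add a b ha hb =>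
      obtain ⟨h, hI, hβ, he⟩ := ha β
      obtain ⟨h', hI', hβ', he'⟩ := hb β
      exact ⟨h + h', I.add_mem hI hI', add_mem hβ hβ', by rw [add_mul, map_add, map_add, he, he']⟩
    | single w c =>
      obtain ⟨γ, rfl⟩ : ∃ γ, β = multideg p w + γ := ⟨β - multideg p w, by abel⟩
      obtain ⟨h, hI, hγ, he⟩ := hx γ
      refine ⟨MonoidAlgebra.single w c * h, I.mul_mem_left _ _ hI,
        single_mul_mem_wordSpan (fun v hv => ?_) c hγ,
        by rw [degComp_single_mul, degComp_single_mul, he]⟩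
      rw [multideg_mul]
      exact DegLE.add (Or.inr rfl) hv
  | right_absorb a x _ hx =>
    induction a using MonoidAlgebra.induction_linear generalizing β with
    | zero => exact ⟨0, I.zero_mem, zero_mem _, by rw [mul_zero]⟩
    | add a b ha hb =>
      obtain ⟨h, hI, hβ, he⟩ := ha β
      obtain ⟨h', hI', hβ', he'⟩ := hb β
      exact ⟨h + h', I.add_mem hI hI', add_mem hβ hβ', by rw [mul_add, map_add, map_add, he, he']⟩
    | single w c =>
      obtain ⟨γ, rfl⟩ : ∃ γ, β = γ + multideg p w := ⟨β - multideg p w, by abel⟩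
      obtain ⟨h, hI, hγ, he⟩ := hx γ
      refine ⟨h * MonoidAlgebra.single w c, I.mul_mem_right _ _ hI,
        mul_single_mem_wordSpan (fun v hv => ?_) c hγ,
        by rw [degComp_mul_single, degComp_mul_single, he]⟩
      rw [multideg_mul]
      exact DegLE.add hv (Or.inr rfl)

/-- The ideal is homogeneous for the multidegree, which makes the components of the quotient
independent. -/
theorem degComp_mem_leadingFormIdeal_of_mem (hlt : IsMonomialOrder lt)
    (h𝒢 : IsReducedGroebnerBasis (RefinedLT p lt) I 𝒢) {j : FreeAlg k X}
    (hj : j ∈ leadingFormIdeal p 𝒢) (β : Fin r → ℤ) :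
    degComp p β j ∈ leadingFormIdeal p 𝒢 := by
  obtain ⟨h, hI, hβ, he⟩ := exists_mem_of_mem_leadingFormIdeal p h𝒢 hj β
  rw [← he]
  exact degComp_mem_leadingFormIdeal p hlt h𝒢 hI hβ

/-- The map which sends a polynomial of degree `≤ α` to its class in `k⟨X⟩ / I` and to the class
of its component of degree `α` in `k⟨X⟩ / (LH(𝒢))`. -/
noncomputable def leadingFormSymbol (I J : TwoSidedIdeal (FreeAlg k X)) (α : Fin r → ℤ) :
    FreeAlg k X →ₗ[k] QuotAlg I × QuotAlg J :=
  (proj I).toLinearMap.prod ((proj J).toLinearMap ∘ₗ degComp p α)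

/-- The filtered algebra `k⟨X⟩ / I`, with associated graded algebra `k⟨X⟩ / (LH(𝒢))`. -/
noncomputable def leadingFormSymbolRing (hlt : IsMonomialOrder lt)
    (h𝒢 : IsReducedGroebnerBasis (RefinedLT p lt) I 𝒢) :
    SymbolRing (DegVec r) (QuotAlg I) (QuotAlg (leadingFormIdeal p 𝒢)) where
  R α := ((wordSpan k fun w => DegLE (multideg p w) α).map
    (leadingFormSymbol p I (leadingFormIdeal p 𝒢) α)).toAddSubgroup
  zero_left {α s} := by
    rintro ⟨f, hf, he⟩
    obtain ⟨h, rfl⟩ := Prod.mk.inj he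
    exact proj_eq_zero_iff.2 (degComp_mem_leadingFormIdeal p hlt h𝒢 (proj_eq_zero_iff.1 h) hf)
  mono {α β a s} hαβ := by
    rintro ⟨f, hf, he⟩
    obtain ⟨rfl, rfl⟩ := Prod.mk.inj he
    refine ⟨f, mem_wordSpan.2 fun w hw => (mem_wordSpan.1 hf w hw).trans (Or.inl hαβ),
      Prod.ext rfl ?_⟩
    have h0 : degComp p β f = 0 := degComp_eq_zero p fun w hw h => by
      have h1 := mem_wordSpan.1 hf w hw
      rw [h] at h1
      exact absurd hαβ (not_lt_of_ge (α := DegVec r) h1)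
    exact (congrArg (proj (leadingFormIdeal p 𝒢)) h0).trans (map_zero (proj _))
  leading {a} ha := by
    have hex : ∀ f : FreeAlg k X, proj I f = a → ∃ w, f.coeff w ≠ 0 ∧
        f ∈ wordSpan k fun v => DegLE (multideg p v) (multideg p w) := fun f hf =>
      exists_max_multideg p (by rintro rfl; exact ha (hf.symm.trans (map_zero _)))
    have hwf : {β : DegVec r | (∀ i, 0 ≤ β i) ∧ ∃ f : FreeAlg k X, proj I f = a ∧
        f ∈ wordSpan k fun v => DegLE (multideg p v) β}.IsWF :=
      (DegVec.isWF_nonneg r).mono fun _ h => h.1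
    have hne : {β : DegVec r | (∀ i, 0 ≤ β i) ∧ ∃ f : FreeAlg k X, proj I f = a ∧
        f ∈ wordSpan k fun v => DegLE (multideg p v) β}.Nonempty := by
      obtain ⟨f, hf⟩ := proj_surjective I a
      obtain ⟨w, -, hw⟩ := hex f hf
      exact ⟨multideg p w, multideg_nonneg p w, f, hf, hw⟩
    obtain ⟨-, f, hfa, hf⟩ := hwf.min_mem hne
    refine ⟨hwf.min hne, proj _ (degComp p (hwf.min hne) f), ?_, ⟨f, hf, Prod.ext hfa rfl⟩⟩
    intro h0
    -- If the symbol vanished, the top component of `f` would be that of some `h ∈ I`, and `f - h`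
    -- would represent `a` in a smaller degree.
    obtain ⟨h, hI, hβ, he⟩ := exists_mem_of_mem_leadingFormIdeal p h𝒢 (proj_eq_zero_iff.1 h0)
      (hwf.min hne)
    replace he := he.trans (degComp_self p _ f)
    have hfh : proj I (f - h) = a := by
      rw [map_sub, proj_eq_zero_iff.2 hI, sub_zero, hfa]
    obtain ⟨w, hw, hmax⟩ := hex _ hfh
    have hle : DegLE (multideg p w) (hwf.min hne) := mem_wordSpan.1 (sub_mem hf hβ) w hw
    rcases hle with hlt | hle
    · exact hwf.not_lt_min hne ⟨multideg_nonneg p w, _, hfh, hmax⟩ hlt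
    · apply hw
      have h1 : degComp p (hwf.min hne) (f - h) = 0 := by rw [map_sub, he, sub_self]
      have h2 := coeff_degComp p (hwf.min hne) (f - h) w
      rw [h1, if_pos hle] at h2
      exact h2.symm
  wf := (DegVec.isWF_nonneg r).mono fun α => by
    rintro ⟨_, _, hs, f, hf, he⟩
    obtain ⟨rfl, rfl⟩ := Prod.mk.inj he
    by_contra hα
    refine hs ?_
    have h0 : degComp p α f = 0 := degComp_eq_zero p fun w _ h =>
      hα (by rw [← h]; exact multideg_nonneg p w)
    exact (congrArg (proj (leadingFormIdeal p 𝒢)) h0).trans (map_zero (proj _))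
  indep f hf h := by
    have hf' : ∀ α : Fin r → ℤ, ∃ e : FreeAlg k X, f α =
        proj (leadingFormIdeal p 𝒢) (degComp p α e) := by
      intro α
      obtain ⟨a, e, -, he⟩ := hf α
      exact ⟨e, (Prod.mk.inj he).2.symm⟩
    choose e he using hf'
    refine Finsupp.ext fun α => ?_
    by_cases hα : f α = 0
    · exact hα
    have hsum : (∑ β ∈ f.support, degComp p β (e β)) ∈ leadingFormIdeal p 𝒢 := by
      rw [← proj_eq_zero_iff, map_sum, ← h]
      exact Finset.sum_congr rfl fun β _ => (he β).symm
    have h1 := degComp_mem_leadingFormIdeal_of_mem p hlt h𝒢 hsum α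
    have h2 := degComp_sum_degComp p e (Finsupp.mem_support_iff.2 hα)
    exact (he α).trans (proj_eq_zero_iff.2 (h2 ▸ h1))
  one_mem := by
    have h1 : multideg p (1 : FreeMonoid X) = 0 := by simp [multideg]
    refine ⟨1, ?_, Prod.ext (map_one (proj I)) ?_⟩
    · exact single_mem_wordSpan (Or.inr h1) 1
    · have h2 : degComp p 0 (1 : FreeAlg k X) = 1 := by
        rw [MonoidAlgebra.one_def, degComp_single, if_pos h1]
      exact (congrArg (proj (leadingFormIdeal p 𝒢)) h2).trans (map_one (proj _))
  mul_mem {α β a b s t} := by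
    rintro ⟨f, hf, hfe⟩ ⟨g, hg, hge⟩
    obtain ⟨rfl, rfl⟩ := Prod.mk.inj hfe
    obtain ⟨rfl, rfl⟩ := Prod.mk.inj hge
    refine ⟨f * g, wordSpan_mul_mem (fun w w' hw hw' => ?_) hf hg,
      Prod.ext (map_mul (proj I) f g) ?_⟩
    · rw [multideg_mul]; exact hw.add hw'
    · exact (congrArg (proj (leadingFormIdeal p 𝒢)) (degComp_mul p hf hg)).trans (map_mul (proj _) _ _)
  span := by
    rw [eq_top_iff]
    rintro s -
    obtain ⟨f, rfl⟩ := proj_surjective _ s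
    induction f using MonoidAlgebra.induction_linear with
    | zero => rw [map_zero]; exact zero_mem _
    | add f g hf hg => rw [map_add]; exact add_mem hf hg
    | single w c =>
      refine AddSubgroup.subset_closure ⟨multideg p w, proj I (MonoidAlgebra.single w c),
        MonoidAlgebra.single w c, single_mem_wordSpan (Or.inr rfl) c, Prod.ext rfl ?_⟩
      exact congrArg (proj (leadingFormIdeal p 𝒢)) ((degComp_single p _ w c).trans (if_pos rfl))

theorem mem_multidegGrading_iff (hlt : IsMonomialOrder lt)
    (h𝒢 : IsReducedGroebnerBasis (RefinedLT p lt) I 𝒢) (α : DegVec r)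
    (s : QuotAlg (leadingFormIdeal p 𝒢)) : s ∈ multidegGrading p (leadingFormIdeal p 𝒢) α ↔
      ∃ a, (a, s) ∈ (leadingFormSymbolRing p hlt h𝒢).R α := by
  constructor
  · rintro ⟨f, hf, rfl⟩
    refine ⟨proj I f, f, mem_wordSpan.2 fun w hw => Or.inr (mem_wordSpan.1 hf w hw),
      Prod.ext rfl ?_⟩
    exact congrArg (proj (leadingFormIdeal p 𝒢)) (degComp_eq_self p (mem_wordSpan.1 hf))
  · rintro ⟨a, f, -, he⟩
    obtain ⟨-, rfl⟩ := Prod.mk.inj he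
    exact ⟨degComp p α f, degComp_mem_wordSpan p α f, rfl⟩

end Groebner

/-! ### The two transfer statements -/

theorem mainTheorem2 {k : Type u} [Field k] {X : Type v} (I : TwoSidedIdeal (FreeAlg k X))
    (hI : IsConnectedGradedIdeal I) {r : ℕ} (hr : 1 < r) (p : X → Fin r)
    (hp : Function.Surjective p) :
    (IsStronglyNoetherian k (partitionFiltration p I).Gr →
      IsGradedAuslanderRegular (partitionFiltration p I).grGrading →
      IsStronglyNoetherian k (QuotAlg I) ∧ IsAuslanderRegular (QuotAlg I) ∧
        IsGradedAuslanderRegular (lengthGrading I)) ∧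
    (∀ (lt : FreeMonoid X → FreeMonoid X → Prop) (𝒢 : Set (FreeAlg k X)),
      IsMonomialOrder lt → IsReducedGroebnerBasis (RefinedLT p lt) I 𝒢 →
      IsStronglyNoetherian k (QuotAlg (leadingFormIdeal p 𝒢)) →
      IsGradedAuslanderRegular (multidegGrading p (leadingFormIdeal p 𝒢)) →
      IsStronglyNoetherian k (QuotAlg I) ∧ IsAuslanderRegular (QuotAlg I) ∧
        IsGradedAuslanderRegular (lengthGrading I)) := by
  constructor
  · intro h₁ h₂
    let ρ := (partitionFiltration p I).symbolRing _ (DegVec.isWF_nonneg r)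
      (exists_partitionFiltration_mem p I)
    refine ρ.transfer (𝒮 := (partitionFiltration p I).grGrading)
      (fun α s => (partitionFiltration p I).mem_grGrading_iff α s) ?_ h₁ h₂ _
    intro α a s c h
    exact Submodule.smul_mem (LinearMap.range (((partitionFiltration p I).F α).subtype.prod
      ((partitionFiltration p I).symb α))) c h
  · intro lt 𝒢 hlt h𝒢 h₁ h₂
    let ρ := leadingFormSymbolRing p hlt h𝒢
    refine ρ.transfer (𝒮 := multidegGrading p (leadingFormIdeal p 𝒢))
      (mem_multidegGrading_iff p hlt h𝒢) ?_ h₁ h₂ _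
    intro α a s c h
    exact Submodule.smul_mem ((wordSpan k fun w => DegLE (multideg p w) α).map
      (leadingFormSymbol p I (leadingFormIdeal p 𝒢) α)) c h
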